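/- Let $T>0$ and let $(\Omega,\mathcal F,(\mathcal F_t)_{0\le t\le T},\mathbb P)$ be a filtered probability space satisfying the usual conditions of right continuity and completeness. Let $P=(P_t)_{0\le t\le T}$ be a càdlàg semimartingale with $E[P_0^2]<\infty$ and canonical decomposition $P=L+A$ into a local martingale $L$ and a predictable finite-variation process $A$ with $A_0=0$, such that $E[\langle L\rangle_T]+E\big[(\int_0^T|dA_s|)^2\big]<\infty$ (where $\langle L\rangle_0=0$). Let $N\ge 1$ be an integer, let $\kappa,\gamma,\rho,y,\lambda,\phi,\varrho>0$ and $x^{1},\dots,x^{N}\in\mathbb R$. Let $\mathcal A$ be the set of progressively measurable $v$ with $E[\int_0^T v_s^2\,ds]<\infty$, where strategies are identified if they agree $d\mathbb P\otimes dt$-a.e. For $u=(u^1,\dots,u^N)\in\mathcal A^N$ put $$X^{u^i}_t=x^{i}-\int_0^t u^i_s\,ds,\qquad Y^{u}_t=e^{-\rho t}y+\gamma\int_0^t e^{-\rho(t-s)}\Big(\frac1N\sum_{i=1}^N u^i_s\Big)ds,\qquad S^u_t=P_t-\kappa Y^u_t,$$ $$J^{i}(u^i;u^{-i})=E\Big[\int_0^T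 S^u_tu^i_t\,dt-\lambda\int_0^T (u^i_t)^2dt-\phi\int_0^T (X^{u^i}_t)^2dt+X^{u^i}_T\big(P_T-\varrho X^{u^i}_T\big)\Big].$$ A profile $u\in\mathcal A^N$ is an open-loop Nash equilibrium if $J^i(u^i;u^{-i})\ge J^i(v;u^{-i})$ for all $i\in\{1,\dots,N\}$ and all $v\in\mathcal A$. Consider the coupled linear FBSDE system, for $i=1,\dots,N$ and $0\le t\le T$, $$\begin{aligned} dX^i_t&=-u^i_t\,dt,\qquad X^i_0=x^i,\\ dY_t&=-\rho Y_t\,dt+\frac{\gamma}{N}\sum_{j=1}^N u^j_t\,dt,\qquad Y_0=y,\\ du^i_t&=\frac{dP_t}{2\lambda}+\frac{\kappa\rho Y_t}{2\lambda}dt-\frac{\gamma\kappa}{2\lambda N}\sum_{j\ne i}u^j_t\,dt-\frac{\phi X^i_t}{\lambda}dt+\frac{\rho Z^i_t}{2\lambda}dt+dM^i_t,\qquad u^i_T=\frac{\varrho}{\lambda}X^i_T-\frac{\kappa}{2\lambda}Y_T,\\ dZ^i_t&=\rho Z^i_t\,dt+\frac{\gamma\kappa}{N}u^i_t\,dt+dN^i_t,\qquad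 Z^i_T=0, \end{aligned}$$ where a solution consists of adapted càdlàg processes $X^i,Y,u^i,Z^i$ with $u^i\in\mathcal A$ for which the system holds with suitable square integrable martingales $M^i,N^i$, $i=1,\dots,N$. Then a profile $u=(u^1,\dots,u^N)\in\mathcal A^N$ is the unique open-loop Nash equilibrium if and only if (for a suitable version of $u$) there are processes $Z^1,\dots,Z^N$ such that $(X^{u^i},Y^{u},u^i,Z^i)_{i=1,\dots,N}$ solves this system. Moreover, the system has a unique solution: a solution exists, and for any two solutions the processes $X^i,Y,u^i,Z^i$ and $M^i-M^i_0$, $N^i-N^i_0$ are indistinguishable. -/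

import Mathlib

open MeasureTheory ProbabilityTheory Filter Topology
open scoped ENNReal

noncomputable section

namespace PriceImpactGame

/-- The time interval `[0,T]`. It carries Lebesgue measure as `volume`; the first time `0` is `⊥`
and the terminal time `T` is `⊤`. -/
abbrev Time (T : ℝ) : Type := Set.Icc (0 : ℝ) T

instance measureSpaceTime (T : ℝ) : MeasureSpace (Time T) := Measure.Subtype.measureSpace

instance factNonneg {T : ℝ} [h : Fact (0 < T)] : Fact ((0 : ℝ) ≤ T) := ⟨h.out.le⟩

variable {T : ℝ} {Ω : Type*} [mΩ : MeasurableSpace Ω]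

/-! ### Stochastic processes on `[0,T]` -/

/-- Right-continuous paths with left limits. -/
def IsCadlag (f : Time T → ℝ) : Prop :=
  ∀ t, ContinuousWithinAt f (Set.Ici t) t ∧ ∃ l, Tendsto f (𝓝[<] t) (𝓝 l)

/-- Every set of probability zero (measurable or not) belongs to `𝓕₀`. -/
def IsCompleteFiltration [Fact (0 < T)] (𝓕 : Filtration (Time T) mΩ) (μ : Measure Ω) : Prop :=
  ∀ s : Set Ω, μ s = 0 → MeasurableSet[𝓕 ⊥] s

/-- Adapted processes whose paths are almost surely càdlàg. -/
structure IsCadlagAdapted (𝓕 : Filtration (Time T) mΩ) (μ : Measure Ω)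
    (X : Time T → Ω → ℝ) : Prop where
  adapted : StronglyAdapted 𝓕 X
  cadlag : ∀ᵐ ω ∂μ, IsCadlag (fun t => X t ω)

/-- Square integrable (càdlàg) martingales on `[0,T]`. -/
structure IsSqIntMartingale (𝓕 : Filtration (Time T) mΩ) (μ : Measure Ω)
    (M : Time T → Ω → ℝ) : Prop where
  martingale : Martingale M 𝓕 μ
  sqIntegrable : ∀ t, MemLp (M t) 2 μ
  cadlag : ∀ᵐ ω ∂μ, IsCadlag (fun t => M t ω)

/-- `L` is a (locally square integrable) local martingale and `V = ⟨L⟩` is its predictable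
quadratic variation: the predictable nondecreasing process `V`, null at time `0`, for which
`L² - V` is a local martingale. The localization is carried out on the pair `(L, V)`: along some
localizing sequence, the stopped process of `L` is a square integrable martingale and its square
minus the stopped process of `V` is a martingale. -/
structure IsQuadVar [Fact (0 < T)] (𝓕 : Filtration (Time T) mΩ) (μ : Measure Ω)
    (L V : Time T → Ω → ℝ) : Prop where
  cadlagAdapted : IsCadlagAdapted 𝓕 μ L
  predictable : IsStronglyPredictable 𝓕 V
  init : ∀ᵐ ω ∂μ, V ⊥ ω = 0
  mono : ∀ᵐ ω ∂μ, Monotone (fun t => V t ω)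
  cadlag : ∀ᵐ ω ∂μ, IsCadlag (fun t => V t ω)
  localMartingale :
    Locally (fun W : Time T → Ω → ℝ × ℝ =>
        IsSqIntMartingale 𝓕 μ (fun t ω => (W t ω).1) ∧
        Martingale (fun t ω => (W t ω).1 ^ 2 - (W t ω).2) 𝓕 μ)
      𝓕 (fun t ω => (L t ω, V t ω)) μ

/-- The class `ℋ²` of semimartingales `P = L + A` with `L` a local martingale, `A` a predictable
càdlàg process of finite variation with `A₀ = 0` (so that `L₀ = P₀`), `P₀` square integrable and
`E[⟨L⟩_T] + E[(∫₀ᵀ |dA_s|)²] < ∞`. -/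
def IsH2 [Fact (0 < T)] (𝓕 : Filtration (Time T) mΩ) (μ : Measure Ω)
    (P : Time T → Ω → ℝ) : Prop :=
  MemLp (P ⊥) 2 μ ∧
  ∃ L A V : Time T → Ω → ℝ,
    (∀ᵐ ω ∂μ, ∀ t, P t ω = L t ω + A t ω) ∧
    IsQuadVar 𝓕 μ L V ∧
    IsStronglyPredictable 𝓕 A ∧
    (∀ᵐ ω ∂μ, A ⊥ ω = 0) ∧
    (∀ᵐ ω ∂μ, IsCadlag (fun t => A t ω)) ∧
    (∫⁻ ω, ENNReal.ofReal (V ⊤ ω) ∂μ)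
      + ∫⁻ ω, (eVariationOn (fun t => A t ω) Set.univ) ^ 2 ∂μ < ∞

/-- The set `𝒜` of admissible strategies: progressively measurable `v` with
`E[∫₀ᵀ v_s² ds] < ∞`. -/
def IsAdmissible (𝓕 : Filtration (Time T) mΩ) (μ : Measure Ω) (v : Time T → Ω → ℝ) : Prop :=
  IsStronglyProgressive 𝓕 v ∧
  ∫⁻ ω, ∫⁻ s, ENNReal.ofReal (v s ω ^ 2) ∂volume ∂μ < ∞

/-! ### The `N`-player game -/

/-- The constants of the model with `N` players: transient impact `κ`, `γ`, resilience rate `ρ`,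
initial distortion `y`, slippage cost `lam` (`λ`), running inventory penalty `φ`, terminal penalty
`varrho` (`ϱ`), and the initial positions `x i` of the players. -/
structure Params (N : ℕ) where
  κ : ℝ
  γ : ℝ
  ρ : ℝ
  y : ℝ
  lam : ℝ
  φ : ℝ
  varrho : ℝ
  x : Fin N → ℝ
  κ_pos : 0 < κ
  γ_pos : 0 < γ
  ρ_pos : 0 < ρ
  y_pos : 0 < y
  lam_pos : 0 < lam
  φ_pos : 0 < φ
  varrho_pos : 0 < varrho

variable {N : ℕ}

/-- The inventory `X_t = x^i - ∫₀ᵗ v_s ds` of player `i` who sells at rate `v`. -/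
def inventory (p : Params N) (i : Fin N) (v : Time T → Ω → ℝ) (t : Time T) (ω : Ω) : ℝ :=
  p.x i - ∫ s in Set.Iic t, v s ω

/-- The aggregated transient price distortion
`Y_t = e^{-ρt} y + γ ∫₀ᵗ e^{-ρ(t-s)} (1/N) ∑ᵢ uⁱ_s ds`. -/
def distortion (p : Params N) (u : Fin N → Time T → Ω → ℝ) (t : Time T) (ω : Ω) : ℝ :=
  Real.exp (-p.ρ * (t : ℝ)) * p.y
    + p.γ * ∫ s in Set.Iic t,
        Real.exp (-p.ρ * ((t : ℝ) - (s : ℝ))) * ((1 / (N : ℝ)) * ∑ i, u i s ω)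

/-- The execution price `S_t = P_t - κ Y_t`. -/
def execPrice (p : Params N) (P : Time T → Ω → ℝ) (u : Fin N → Time T → Ω → ℝ)
    (t : Time T) (ω : Ω) : ℝ :=
  P t ω - p.κ * distortion p u t ω

/-- The performance functional `J^{i,N}(uⁱ; u^{-i})` of player `i` under the strategy
profile `u = (u¹, …, u^N)`. -/
def performance [Fact (0 < T)] (p : Params N) (μ : Measure Ω) (P : Time T → Ω → ℝ)
    (i : Fin N) (u : Fin N → Time T → Ω → ℝ) : ℝ :=
  ∫ ω, ((∫ t, execPrice p P u t ω * u i t ω)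
      - p.lam * (∫ t, (u i t ω) ^ 2)
      - p.φ * (∫ t, (inventory p i (u i) t ω) ^ 2)
      + inventory p i (u i) ⊤ ω * (P ⊤ ω - p.varrho * inventory p i (u i) ⊤ ω)) ∂μ

/-- Open-loop Nash equilibria. -/
def IsNash [Fact (0 < T)] (p : Params N) (𝓕 : Filtration (Time T) mΩ) (μ : Measure Ω)
    (P : Time T → Ω → ℝ) (u : Fin N → Time T → Ω → ℝ) : Prop :=
  (∀ i, IsAdmissible 𝓕 μ (u i)) ∧
  ∀ i, ∀ v : Time T → Ω → ℝ, IsAdmissible 𝓕 μ v →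
    performance p μ P i (Function.update u i v) ≤ performance p μ P i u

/-- The strategies `v` and `w` agree `dt ⊗ dμ`-almost everywhere on `[0,T] × Ω`. -/
def SameStrategy (μ : Measure Ω) (v w : Time T → Ω → ℝ) : Prop :=
  ∀ᵐ z ∂((volume : Measure (Time T)).prod μ), v z.1 z.2 = w z.1 z.2

/-- `u` is the unique open-loop Nash equilibrium (strategies being identified when they agree
`dt ⊗ dμ`-almost everywhere). -/
def IsUniqueNash [Fact (0 < T)] (p : Params N) (𝓕 : Filtration (Time T) mΩ) (μ : Measure Ω)
    (P : Time T → Ω → ℝ) (u : Fin N → Time T → Ω → ℝ) : Prop :=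
  IsNash p 𝓕 μ P u ∧ ∀ w, IsNash p 𝓕 μ P w → ∀ i, SameStrategy μ (w i) (u i)

/-! ### The forward backward system -/

/-- The processes `X i`, `Y`, `u i`, `Z i`, together with the square integrable martingales `M i`
and `K i`, solve the coupled linear forward backward system. Each stochastic differential equation
is written in integrated form, for all times simultaneously, almost surely. -/
structure IsFBSDESolution [Fact (0 < T)] (p : Params N) (𝓕 : Filtration (Time T) mΩ)
    (μ : Measure Ω) (P : Time T → Ω → ℝ)
    (X : Fin N → Time T → Ω → ℝ) (Y : Time T → Ω → ℝ) (u Z M K : Fin N → Time T → Ω → ℝ) :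
    Prop where
  admissible_u : ∀ i, IsAdmissible 𝓕 μ (u i)
  cadlag_X : ∀ i, IsCadlagAdapted 𝓕 μ (X i)
  cadlag_Y : IsCadlagAdapted 𝓕 μ Y
  cadlag_u : ∀ i, IsCadlagAdapted 𝓕 μ (u i)
  cadlag_Z : ∀ i, IsCadlagAdapted 𝓕 μ (Z i)
  martingale_M : ∀ i, IsSqIntMartingale 𝓕 μ (M i)
  martingale_K : ∀ i, IsSqIntMartingale 𝓕 μ (K i)
  /-- `dX = -u dt`, `X₀ = x` -/
  eq_X : ∀ i, ∀ᵐ ω ∂μ, ∀ t, X i t ω = p.x i - ∫ s in Set.Iic t, u i s ω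
  /-- `dY = -ρ Y dt + (γ/N) ∑ᵢ uⁱ dt`, `Y₀ = y` -/
  eq_Y : ∀ᵐ ω ∂μ, ∀ t, Y t ω = p.y
    + ∫ s in Set.Iic t, (-p.ρ * Y s ω + p.γ / (N : ℝ) * ∑ i, u i s ω)
  /-- `du = dP/(2λ) + κρY/(2λ) dt - γκ/(2λN) ∑_{j≠i} uʲ dt - φX/λ dt + ρZ/(2λ) dt + dM` -/
  eq_u : ∀ i, ∀ᵐ ω ∂μ, ∀ t, u i t ω = u i ⊥ ω + (P t ω - P ⊥ ω) / (2 * p.lam)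
    + (∫ s in Set.Iic t,
        (p.κ * p.ρ * Y s ω / (2 * p.lam)
          - p.γ * p.κ / (2 * p.lam * (N : ℝ)) * ∑ j ∈ Finset.univ.erase i, u j s ω
          - p.φ * X i s ω / p.lam
          + p.ρ * Z i s ω / (2 * p.lam)))
    + (M i t ω - M i ⊥ ω)
  /-- `u_T = (ϱ/λ) X_T - κ/(2λ) Y_T` -/
  terminal_u : ∀ i, ∀ᵐ ω ∂μ,
    u i ⊤ ω = p.varrho / p.lam * X i ⊤ ω - p.κ / (2 * p.lam) * Y ⊤ ω
  /-- `dZ = ρ Z dt + (γκ/N) u dt + dK` -/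
  eq_Z : ∀ i, ∀ᵐ ω ∂μ, ∀ t, Z i t ω = Z i ⊥ ω
    + (∫ s in Set.Iic t, (p.ρ * Z i s ω + p.γ * p.κ / (N : ℝ) * u i s ω))
    + (K i t ω - K i ⊥ ω)
  /-- `Z_T = 0` -/
  terminal_Z : ∀ i, ∀ᵐ ω ∂μ, Z i ⊤ ω = 0

end PriceImpactGame

end

/-! The payoff of a player is an exact quadratic polynomial in her own strategy, on the Hilbert
space of progressively measurable square integrable processes: perturbing `u i` by `h` changes it by
minus the pairing of `h` with `grad`, minus a nonnegative quadratic form (`performance_update`).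
Hence a profile is a Nash equilibrium exactly when every `grad p P u i` is orthogonal to all
admissible strategies, that is, when its projection onto the present vanishes
(`isNash_iff_isCritical`).

These conditions are linear in `u`. Apart from the multiple `2λ` of the identity, the operator
consists of an exponential Volterra operator, its adjoint, the product of the adjoint of integration
with integration, and a rank one term. Each has a nonnegative quadratic form, so the whole is
coercive. Summing over the players closes the system for the aggregate rate; once the aggregate is
known, the players decouple. Lax-Milgram then gives existence (`exists_isCritical`) and coercivity
gives uniqueness (`IsCritical.unique`).

The link with the forward backward system is that a future increment `M_t - M_T` of a martingale,
even times a function of time, is orthogonal to every adapted process (`integral_test_eq_zero`). For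
a solution of the system the drifts cancel and the terminal conditions leave `grad` as a sum of such
increments, so the strategies are critical. Conversely, projecting the first order condition onto
the present expresses `u` through `P`, the distortion, the past inventory and two closed
martingales. The right-hand side is càdlàg and adapted, and agrees with `u` almost everywhere: the
difference, tested against itself, vanishes. Differentiating this expression yields the system, and
reading it at time `T` yields the terminal condition.

The martingales need càdlàg versions. These come from Doob's maximal and upcrossing inequalities
along dyadic grids, together with the usual conditions (`exists_cadlag_martingale`). Two solutions
of the system have critical strategies, hence agree almost everywhere; right continuity and the
terminal conditions upgrade this to indistinguishability. -/

namespace PriceImpactGame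

set_option linter.unusedSectionVars false
set_option linter.style.haveILetI false

/-! ### Deterministic Volterra calculus on the time interval. -/

section Pathwise

variable {T : ℝ}

/-! ### Lebesgue measure on the time interval -/

lemma volume_time_def : (volume : Measure (Time T)) = Measure.comap Subtype.val volume := rfl

instance isFiniteMeasure_time : IsFiniteMeasure (volume : Measure (Time T)) := by
  refine ⟨?_⟩
  rw [volume_time_def, comap_subtype_coe_apply measurableSet_Icc, Set.image_univ,
    Subtype.range_coe, Real.volume_Icc]
  exact ENNReal.ofReal_lt_top

instance nullSingletonClass_time : NullSingletonClass (volume : Measure (Time T)) := by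
  refine ⟨fun x => ?_⟩
  rw [volume_time_def, comap_subtype_coe_apply measurableSet_Icc]
  simp

lemma setIntegral_Iic_coe (g : ℝ → ℝ) (t : Time T) :
    ∫ r in Set.Iic t, g r = ∫ r in (0 : ℝ)..t, g r := by
  have h1 : ∫ r in Set.Iic t, g r = ∫ r : Time T, (Set.Iic (t : ℝ)).indicator g r := by
    rw [← integral_indicator measurableSet_Iic]
    rfl
  have h2 : Set.Icc 0 T ∩ Set.Iic (t : ℝ) = Set.Icc 0 (t : ℝ) := by
    ext x
    simp only [Set.mem_inter_iff, Set.mem_Icc, Set.mem_Iic]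
    exact ⟨fun h => ⟨h.1.1, h.2⟩, fun h => ⟨⟨h.1, h.2.trans t.2.2⟩, h.2⟩⟩
  rw [h1, volume_time_def, integral_subtype_comap measurableSet_Icc,
    setIntegral_indicator measurableSet_Iic, h2, intervalIntegral.integral_of_le t.2.1,
    integral_Icc_eq_integral_Ioc]

lemma volume_Ico_pos (s t : Time T) (hst : s < t) : 0 < volume (Set.Ico s t) := by
  rw [volume_time_def, comap_subtype_coe_apply measurableSet_Icc]
  have : (Subtype.val '' Set.Ico s t : Set ℝ) = Set.Ico (s : ℝ) t := by
    ext x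
    constructor
    · rintro ⟨y, hy, rfl⟩; exact hy
    · intro hx
      exact ⟨⟨x, s.2.1.trans hx.1, hx.2.le.trans t.2.2⟩, hx, rfl⟩
  rw [this, Real.volume_Ico]
  simpa using hst

lemma integrable_continuous_mul {f : Time T → ℝ} (hf : Integrable f) {g : Time T → ℝ}
    (hg : Continuous g) : Integrable (fun s => g s * f s) := by
  obtain ⟨C, hC⟩ := isCompact_univ.exists_bound_of_continuousOn hg.continuousOn
  exact hf.bdd_mul (c := C) hg.aestronglyMeasurable (ae_of_all _ fun x => hC x (Set.mem_univ x))

/-! ### Volterra operators with exponential kernel -/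

/-- The causal exponential Volterra operator `f ↦ ∫₀ᵗ e^{-a(t-s)} f(s) ds`. -/
noncomputable def volt (a : ℝ) (f : Time T → ℝ) (t : Time T) : ℝ :=
  ∫ s in Set.Iic t, Real.exp (-a * ((t : ℝ) - (s : ℝ))) * f s

/-- The adjoint operator `f ↦ ∫ₜᵀ e^{-a(s-t)} f(s) ds`. -/
noncomputable def voltAdj (a : ℝ) (f : Time T → ℝ) (t : Time T) : ℝ :=
  ∫ s in Set.Ici t, Real.exp (-a * ((s : ℝ) - (t : ℝ))) * f s

lemma volt_zero (f : Time T → ℝ) (t : Time T) : volt 0 f t = ∫ s in Set.Iic t, f s := by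
  simp [volt]

lemma voltAdj_zero (f : Time T → ℝ) (t : Time T) : voltAdj 0 f t = ∫ s in Set.Ici t, f s := by
  simp [voltAdj]

lemma integrable_exp_neg_mul {f : Time T → ℝ} (hf : Integrable f) (a b : ℝ) :
    Integrable (fun s : Time T => Real.exp (-a * (b - s)) * f s) :=
  integrable_continuous_mul hf (by fun_prop)

lemma integrable_exp_neg_mul' {f : Time T → ℝ} (hf : Integrable f) (a b : ℝ) :
    Integrable (fun s : Time T => Real.exp (-a * (s - b)) * f s) :=
  integrable_continuous_mul hf (by fun_prop)

lemma volt_congr {f g : Time T → ℝ} (h : f =ᵐ[volume] g) (a : ℝ) (t : Time T) :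
    volt a f t = volt a g t := by
  refine integral_congr_ae (ae_restrict_of_ae ?_)
  filter_upwards [h] with s hs
  simp only [hs]

lemma voltAdj_congr {f g : Time T → ℝ} (h : f =ᵐ[volume] g) (a : ℝ) (t : Time T) :
    voltAdj a f t = voltAdj a g t := by
  refine integral_congr_ae (ae_restrict_of_ae ?_)
  filter_upwards [h] with s hs
  simp only [hs]

lemma volt_add {f g : Time T → ℝ} (hf : Integrable f) (hg : Integrable g) (a : ℝ) (t : Time T) :
    volt a (fun s => f s + g s) t = volt a f t + volt a g t := by
  simp only [volt, mul_add]
  exact integral_add (integrable_exp_neg_mul hf _ _).integrableOn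
    (integrable_exp_neg_mul hg _ _).integrableOn

lemma voltAdj_add {f g : Time T → ℝ} (hf : Integrable f) (hg : Integrable g) (a : ℝ)
    (t : Time T) :
    voltAdj a (fun s => f s + g s) t = voltAdj a f t + voltAdj a g t := by
  simp only [voltAdj, mul_add]
  exact integral_add (integrable_exp_neg_mul' hf _ _).integrableOn
    (integrable_exp_neg_mul' hg _ _).integrableOn

lemma volt_const_mul (f : Time T → ℝ) (b a : ℝ) (t : Time T) :
    volt a (fun s => b * f s) t = b * volt a f t := by
  simp only [volt, ← integral_const_mul]
  congr 1 with s
  ring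

lemma voltAdj_const_mul (f : Time T → ℝ) (b a : ℝ) (t : Time T) :
    voltAdj a (fun s => b * f s) t = b * voltAdj a f t := by
  simp only [voltAdj, ← integral_const_mul]
  congr 1 with s
  ring

lemma abs_volt_le {a : ℝ} (ha : 0 ≤ a) {f : Time T → ℝ} (hf : Integrable f) (t : Time T) :
    |volt a f t| ≤ ∫ s, |f s| := by
  calc |volt a f t| ≤ ∫ s in Set.Iic t, |Real.exp (-a * ((t : ℝ) - (s : ℝ))) * f s| :=
        abs_integral_le_integral_abs
    _ ≤ ∫ s in Set.Iic t, |f s| := by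
        refine setIntegral_mono_on (integrable_exp_neg_mul hf _ _).abs.integrableOn
          hf.abs.integrableOn measurableSet_Iic fun s hs => ?_
        rw [abs_mul, Real.abs_exp]
        refine mul_le_of_le_one_left (abs_nonneg _) (Real.exp_le_one_iff.2 ?_)
        have : (s : ℝ) ≤ t := hs
        nlinarith
    _ ≤ ∫ s, |f s| := setIntegral_le_integral hf.abs (ae_of_all _ fun s => abs_nonneg _)

lemma abs_voltAdj_le {a : ℝ} (ha : 0 ≤ a) {f : Time T → ℝ} (hf : Integrable f) (t : Time T) :
    |voltAdj a f t| ≤ ∫ s, |f s| := by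
  calc |voltAdj a f t| ≤ ∫ s in Set.Ici t, |Real.exp (-a * ((s : ℝ) - (t : ℝ))) * f s| :=
        abs_integral_le_integral_abs
    _ ≤ ∫ s in Set.Ici t, |f s| := by
        refine setIntegral_mono_on (integrable_exp_neg_mul' hf _ _).abs.integrableOn
          hf.abs.integrableOn measurableSet_Ici fun s hs => ?_
        rw [abs_mul, Real.abs_exp]
        refine mul_le_of_le_one_left (abs_nonneg _) (Real.exp_le_one_iff.2 ?_)
        have : (t : ℝ) ≤ s := hs
        nlinarith
    _ ≤ ∫ s, |f s| := setIntegral_le_integral hf.abs (ae_of_all _ fun s => abs_nonneg _)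

lemma continuous_primitive {f : Time T → ℝ} (hf : Integrable f) :
    Continuous fun t : Time T => ∫ s in Set.Iic t, f s := by
  have h : ∀ t : Time T, ∫ s in Set.Iic t, f s = ∫ s, (Set.Iic t).indicator f s := fun t =>
    (integral_indicator measurableSet_Iic).symm
  simp only [h]
  rw [continuous_iff_continuousAt]
  intro t
  refine continuousAt_of_dominated (bound := fun s => |f s|)
    (Eventually.of_forall fun x => (hf.indicator measurableSet_Iic).aestronglyMeasurable)
    (Eventually.of_forall fun x => ae_of_all _ fun s => norm_indicator_le_norm_self _ _)
    hf.abs ?_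
  have hne : ∀ᵐ s : Time T, s ≠ t := by
    simp [ae_iff]
  filter_upwards [hne] with s hs
  rcases lt_or_gt_of_ne hs with h | h
  · refine (continuousAt_const (y := f s)).congr ?_
    filter_upwards [lt_mem_nhds h] with x hx
    simp [Set.indicator_of_mem (Set.mem_Iic.2 (le_of_lt hx))]
  · refine (continuousAt_const (y := (0 : ℝ))).congr ?_
    filter_upwards [gt_mem_nhds h] with x hx
    simp [Set.indicator_of_notMem (show s ∉ Set.Iic x from not_le.2 hx)]

lemma volt_eq (a : ℝ) (f : Time T → ℝ) (t : Time T) :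
    volt a f t = Real.exp (-a * t) * ∫ s in Set.Iic t, Real.exp (a * s) * f s := by
  rw [volt, ← integral_const_mul]
  congr 1 with s
  rw [← mul_assoc, ← Real.exp_add]
  ring_nf

lemma setIntegral_Ici_eq {f : Time T → ℝ} (hf : Integrable f) (t : Time T) :
    ∫ s in Set.Ici t, f s = (∫ s, f s) - ∫ s in Set.Iic t, f s := by
  rw [← integral_add_compl (measurableSet_Iic (a := t)) hf, Set.compl_Iic, integral_Ici_eq_integral_Ioi]
  ring

lemma voltAdj_eq {f : Time T → ℝ} (hf : Integrable f) (a : ℝ) (t : Time T) :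
    voltAdj a f t = Real.exp (a * t) * ((∫ s : Time T, Real.exp (-a * s) * f s)
      - ∫ s in Set.Iic t, Real.exp (-a * s) * f s) := by
  rw [← setIntegral_Ici_eq (integrable_continuous_mul hf (by fun_prop)), voltAdj,
    ← integral_const_mul]
  congr 1 with s
  rw [← mul_assoc, ← Real.exp_add]
  ring_nf

lemma continuous_volt {f : Time T → ℝ} (hf : Integrable f) (a : ℝ) : Continuous (volt a f) := by
  have : volt a f = fun t : Time T => Real.exp (-a * t) * ∫ s in Set.Iic t, Real.exp (a * s) * f s :=
    funext (volt_eq a f)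
  rw [this]
  exact (by fun_prop : Continuous fun t : Time T => Real.exp (-a * (t : ℝ))).mul
    (continuous_primitive (integrable_continuous_mul hf (by fun_prop)))

lemma continuous_voltAdj {f : Time T → ℝ} (hf : Integrable f) (a : ℝ) :
    Continuous (voltAdj a f) := by
  have : voltAdj a f = fun t : Time T => Real.exp (a * t) * ((∫ s : Time T, Real.exp (-a * s) * f s)
      - ∫ s in Set.Iic t, Real.exp (-a * s) * f s) :=
    funext (voltAdj_eq hf a)
  rw [this]
  exact (by fun_prop : Continuous fun t : Time T => Real.exp (a * (t : ℝ))).mul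
    (continuous_const.sub (continuous_primitive (integrable_continuous_mul hf (by fun_prop))))

lemma integrable_of_continuous {g : Time T → ℝ} (hg : Continuous g) : Integrable g := by
  simpa using integrable_continuous_mul (integrable_const (1 : ℝ)) hg

/-- Fubini on the triangle `s ≤ t`: this is what makes `voltAdj` the adjoint of `volt`. -/
lemma integral_mul_volt {f h : Time T → ℝ} (hf : Integrable f) (hh : Integrable h) (a : ℝ) :
    ∫ t, h t * volt a f t = ∫ t, f t * voltAdj a h t := by
  let F : Time T → Time T → ℝ := fun t s =>
    {z : Time T × Time T | z.2 ≤ z.1}.indicator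
      (fun z => Real.exp (-a * ((z.1 : ℝ) - (z.2 : ℝ))) * (h z.1 * f z.2)) (t, s)
  have hmeas : MeasurableSet {z : Time T × Time T | z.2 ≤ z.1} :=
    measurableSet_le measurable_snd measurable_fst
  have hF : Integrable (Function.uncurry F) (volume.prod volume) := by
    have h1 : Integrable (fun z : Time T × Time T =>
        Real.exp (-a * ((z.1 : ℝ) - (z.2 : ℝ))) * (h z.1 * f z.2)) (volume.prod volume) := by
      have hg : Continuous fun z : Time T × Time T => Real.exp (-a * ((z.1 : ℝ) - (z.2 : ℝ))) := by
        fun_prop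
      obtain ⟨C, hC⟩ := isCompact_univ.exists_bound_of_continuousOn hg.continuousOn
      exact (hh.mul_prod hf).bdd_mul (c := C) hg.aestronglyMeasurable
        (ae_of_all _ fun x => hC x (Set.mem_univ x))
    exact h1.indicator hmeas
  have h1 : ∀ t, ∫ s, F t s = h t * volt a f t := by
    intro t
    rw [volt, ← integral_const_mul, ← integral_indicator measurableSet_Iic]
    congr 1 with s
    simp only [F, Set.indicator, Set.mem_Iic, Set.mem_ofPred_eq]
    split_ifs <;> ring
  have h2 : ∀ s, ∫ t, F t s = f s * voltAdj a h s := by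
    intro s
    rw [voltAdj, ← integral_const_mul, ← integral_indicator measurableSet_Ici]
    congr 1 with t
    simp only [F, Set.indicator, Set.mem_Ici, Set.mem_ofPred_eq]
    split_ifs <;> ring
  simp only [← h1, ← h2]
  exact integral_integral_swap hF

/-! ### Calculus of primitives -/

/-- Integration by parts for merely integrable densities, with no derivatives taken. It is
adjointness at `a = 0`, because `voltAdj 0 h` is the total integral of `h` minus its primitive. -/
lemma integral_mul_primitive_add {f h : Time T → ℝ} (hf : Integrable f) (hh : Integrable h) :
    (∫ t, f t) * (∫ t, h t)
      = ∫ t, (f t * (∫ s in Set.Iic t, h s) + h t * ∫ s in Set.Iic t, f s) := by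
  have key := integral_mul_volt hf hh 0
  simp only [volt_zero, voltAdj_zero, setIntegral_Ici_eq hh] at key
  have i1 : Integrable fun t => f t * ∫ s in Set.Iic t, h s := by
    simpa only [mul_comm] using integrable_continuous_mul hf (continuous_primitive hh)
  have i2 : Integrable fun t => h t * ∫ s in Set.Iic t, f s := by
    simpa only [mul_comm] using integrable_continuous_mul hh (continuous_primitive hf)
  rw [integral_add i1 i2, key]
  simp only [mul_sub]
  rw [integral_sub (hf.mul_const _) i1, integral_mul_const]
  ring

/-- The formula over the whole interval, applied to densities cut off at `t`. -/
lemma primitive_mul_primitive {f h : Time T → ℝ} (hf : Integrable f) (hh : Integrable h)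
    (t : Time T) :
    (∫ s in Set.Iic t, f s) * (∫ s in Set.Iic t, h s)
      = ∫ s in Set.Iic t, (f s * (∫ r in Set.Iic s, h r) + h s * ∫ r in Set.Iic s, f r) := by
  have key := integral_mul_primitive_add (hf.indicator (measurableSet_Iic (a := t)))
    (hh.indicator (measurableSet_Iic (a := t)))
  rw [integral_indicator measurableSet_Iic, integral_indicator measurableSet_Iic] at key
  rw [key, ← integral_indicator measurableSet_Iic]
  congr 1 with s
  by_cases hs : s ∈ Set.Iic t
  · have hs' : Set.Iic s ∩ Set.Iic t = Set.Iic s :=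
      Set.inter_eq_left.2 (Set.Iic_subset_Iic.2 hs)
    simp only [Set.indicator_of_mem hs, setIntegral_indicator measurableSet_Iic, hs']
  · simp [Set.indicator_of_notMem hs]

lemma primitive_exp (a : ℝ) (t : Time T) :
    ∫ s in Set.Iic t, a * Real.exp (a * s) = Real.exp (a * t) - 1 := by
  rw [setIntegral_Iic_coe (fun s => a * Real.exp (a * s))]
  have : ∀ x ∈ Set.uIcc (0 : ℝ) t, HasDerivAt (fun s => Real.exp (a * s)) (a * Real.exp (a * x)) x := by
    intro x _
    have := ((hasDerivAt_id x).const_mul a).exp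
    simpa [mul_comm] using this
  rw [intervalIntegral.integral_eq_sub_of_hasDerivAt this
    (by apply Continuous.intervalIntegrable; fun_prop)]
  simp

/-- Integration by parts against an exponential. -/
lemma exp_mul_eq_of_primitive {g h : Time T → ℝ} {g₀ : ℝ} (hh : Integrable h)
    (hg : ∀ t, g t = g₀ + ∫ s in Set.Iic t, h s) (a : ℝ) (t : Time T) :
    Real.exp (a * t) * g t
      = g₀ + ∫ s in Set.Iic t, (a * Real.exp (a * s) * g s + Real.exp (a * s) * h s) := by
  have hE : Integrable fun s : Time T => a * Real.exp (a * s) :=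
    integrable_of_continuous (by fun_prop)
  have hgc : Continuous g := by
    have : g = fun t => g₀ + ∫ s in Set.Iic t, h s := funext hg
    rw [this]
    exact continuous_const.add (continuous_primitive hh)
  have key := primitive_mul_primitive hE hh t
  simp only [primitive_exp] at key
  have i1 : Integrable fun s : Time T => a * Real.exp (a * s) * g s :=
    integrable_of_continuous (by fun_prop)
  have i2 : Integrable fun s : Time T => Real.exp (a * s) * h s :=
    integrable_continuous_mul hh (by fun_prop)
  have e1 : ∀ s : Time T, a * Real.exp (a * s) * (∫ r in Set.Iic s, h r)
      + h s * (Real.exp (a * s) - 1)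
      = (a * Real.exp (a * s) * g s + Real.exp (a * s) * h s)
        - (g₀ * (a * Real.exp (a * s)) + h s) := by
    intro s
    rw [hg s]; ring
  simp only [e1] at key
  have i12 : Integrable fun s : Time T =>
      a * Real.exp (a * s) * g s + Real.exp (a * s) * h s := i1.add i2
  have i3 : Integrable fun s : Time T => g₀ * (a * Real.exp (a * s)) := hE.const_mul g₀
  have i4 : Integrable fun s : Time T => g₀ * (a * Real.exp (a * s)) + h s := i3.add hh
  rw [integral_sub i12.integrableOn i4.integrableOn,
    integral_add i3.integrableOn hh.integrableOn, integral_const_mul, primitive_exp] at key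
  rw [hg t]
  linarith

/-- Integrated form of the equation `V' = f - a V`, `V(0) = 0`, solved by `V = volt a f`. -/
lemma volt_eq_primitive {f : Time T → ℝ} (hf : Integrable f) (a : ℝ) (t : Time T) :
    volt a f t = ∫ s in Set.Iic t, (f s - a * volt a f s) := by
  have h1 : Integrable fun s : Time T => Real.exp (a * s) * f s :=
    integrable_continuous_mul hf (by fun_prop)
  have := exp_mul_eq_of_primitive (g := fun t => ∫ s in Set.Iic t, Real.exp (a * s) * f s)
    (g₀ := 0) h1 (fun t => by simp) (-a) t
  rw [volt_eq, this, zero_add]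
  congr 1 with s
  rw [volt_eq, ← mul_assoc (Real.exp (-a * s)), ← Real.exp_add]
  ring_nf
  simp

/-- The integrating factor `exp (-a t)` makes the integrand vanish identically. -/
lemma eq_zero_of_linear_ode {D : Time T → ℝ} (hD : Integrable D) (a : ℝ)
    (h : ∀ t, D t = ∫ s in Set.Iic t, a * D s) (t : Time T) : D t = 0 := by
  have := exp_mul_eq_of_primitive (g := D) (g₀ := 0) (hD.const_mul a) (by simpa using h) (-a) t
  have h0 : ∀ s : Time T, -a * Real.exp (-a * s) * D s + Real.exp (-a * s) * (a * D s) = 0 :=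
    fun s => by ring
  simp only [h0, integral_zero, add_zero] at this
  simpa [Real.exp_ne_zero] using this

/-- The exponential kernel is positive definite. With `V = volt a f` one has `f = V' + a V`, so the
integral equals `V(T)² / 2 + a ∫ V²`. -/
lemma integral_mul_volt_nonneg {f : Time T → ℝ} (hf : Integrable f) {a : ℝ} (ha : 0 ≤ a) :
    0 ≤ ∫ t, f t * volt a f t := by
  have hv := continuous_volt hf a
  have iv : Integrable (volt a f) := integrable_of_continuous hv
  have hd : Integrable fun t => f t - a * volt a f t := hf.sub (iv.const_mul a)
  have key := integral_mul_primitive_add hd hd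
  simp only [← volt_eq_primitive hf a] at key
  have e : ∀ t, (f t - a * volt a f t) * volt a f t + (f t - a * volt a f t) * volt a f t
      = 2 * (f t * volt a f t) - 2 * a * (volt a f t) ^ 2 := fun t => by ring
  have i1 : Integrable fun t => f t * volt a f t := by
    simpa only [mul_comm] using integrable_continuous_mul hf hv
  simp only [e] at key
  have i2 : Integrable fun t => 2 * a * volt a f t ^ 2 :=
    integrable_of_continuous (by fun_prop)
  rw [integral_sub (i1.const_mul 2) i2,
    integral_const_mul, integral_const_mul] at key
  have h1 : 0 ≤ ∫ t, volt a f t ^ 2 := integral_nonneg fun t => sq_nonneg _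
  nlinarith [mul_self_nonneg (∫ t, (f t - a * volt a f t)), mul_nonneg ha h1]

lemma integral_mul_voltAdj_volt {f h : Time T → ℝ} (hf : Integrable f) (hh : Integrable h)
    (a : ℝ) : ∫ t, h t * voltAdj a (volt a f) t = ∫ t, volt a h t * volt a f t := by
  rw [← integral_mul_volt hh (integrable_of_continuous (continuous_volt hf a))]
  simp only [mul_comm]

/-- A discrepancy at `t` would persist on some `[t, u)`, a set of positive measure. The terminal
time has no such neighbourhood, hence the later time `s`. -/
lemma eq_of_ae_eq_of_rightCont {f g : Time T → ℝ}
    (hf : ∀ t, ContinuousWithinAt f (Set.Ici t) t) (hg : ∀ t, ContinuousWithinAt g (Set.Ici t) t)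
    (h : f =ᵐ[volume] g) {t s : Time T} (hts : t < s) : f t = g t := by
  by_contra hne
  have h1 : ContinuousWithinAt (fun r => f r - g r) (Set.Ici t) t := (hf t).sub (hg t)
  have h2 : ∀ᶠ r in 𝓝[≥] t, f r - g r ≠ 0 :=
    h1.eventually_ne (sub_ne_zero.2 hne)
  obtain ⟨u, hu, hsub⟩ := (mem_nhdsGE_iff_exists_Ico_subset' hts).1 h2
  have h3 := volume_Ico_pos t u hu
  refine h3.ne' (measure_mono_null ?_ h)
  intro r hr heq
  exact hsub hr (by simpa [sub_eq_zero] using heq)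

end Pathwise

/-! ### Progressive measurability and square integrable processes. -/

section Processes

variable {T : ℝ} {Ω : Type*} [mΩ : MeasurableSpace Ω]

/-! ### Progressive measurability -/

/-- Extending by zero after `t₀` trades the subtype `Set.Iic t₀` for the full product, where
measurability of parametric integrals is directly available. -/
lemma isStronglyProgressive_iff {𝓕 : Filtration (Time T) mΩ} {v : Time T → Ω → ℝ} :
    IsStronglyProgressive 𝓕 v ↔ ∀ t₀ : Time T,
      StronglyMeasurable[Prod.instMeasurableSpace (m₂ := 𝓕 t₀)]
        (fun z : Time T × Ω => (Set.Iic t₀).indicator (fun s => v s z.2) z.1) := by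
  refine forall_congr' fun t₀ => ⟨fun h => ?_, fun h => ?_⟩
  · letI : MeasurableSpace Ω := 𝓕 t₀
    -- Freezing time at `min z.1 t₀` pulls the process back from `Set.Iic t₀`; the indicator then
    -- discards the later times.
    have hφ : Measurable fun z : Time T × Ω => ((⟨min z.1 t₀, Set.mem_Iic.2 (min_le_right _ _)⟩ : Set.Iic t₀), z.2) :=
      ((measurable_fst.min measurable_const).subtype_mk).prodMk measurable_snd
    have h1 : StronglyMeasurable fun z : Time T × Ω => v (min z.1 t₀) z.2 := by
      have := StronglyMeasurable.comp_measurable (g := fun z : Time T × Ω =>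
        ((⟨min z.1 t₀, Set.mem_Iic.2 (min_le_right _ _)⟩ : Set.Iic t₀), z.2)) h hφ
      exact this
    have h2 := h1.indicator (measurableSet_Iic.preimage measurable_fst :
      MeasurableSet (Prod.fst ⁻¹' Set.Iic t₀ : Set (Time T × Ω)))
    convert h2 using 1
    ext z
    by_cases hz : z.1 ≤ t₀
    · simp [Set.indicator, hz]
    · simp [Set.indicator, hz]
  · letI : MeasurableSpace Ω := 𝓕 t₀
    have hφ : Measurable fun p : Set.Iic t₀ × Ω => ((p.1 : Time T), p.2) :=
      (measurable_subtype_coe.comp measurable_fst).prodMk measurable_snd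
    have h1 := StronglyMeasurable.comp_measurable h hφ
    have h2 : (fun p : Set.Iic t₀ × Ω => v p.1 p.2)
        = (fun z : Time T × Ω => (Set.Iic t₀).indicator (fun s => v s z.2) z.1)
          ∘ fun p : Set.Iic t₀ × Ω => ((p.1 : Time T), p.2) := by
      funext q
      exact (Set.indicator_of_mem (show (q.1 : Time T) ∈ Set.Iic t₀ from q.1.2)
        (fun s => v s q.2)).symm
    rw [h2]
    exact h1

lemma stronglyMeasurable_of_progressive [Fact (0 < T)] {𝓕 : Filtration (Time T) mΩ}
    {v : Time T → Ω → ℝ} (h : IsStronglyProgressive 𝓕 v) :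
    StronglyMeasurable fun z : Time T × Ω => v z.1 z.2 := by
  have h1 := isStronglyProgressive_iff.1 h ⊤
  have h2 : (Prod.instMeasurableSpace (m₂ := 𝓕 ⊤) : MeasurableSpace (Time T × Ω))
      ≤ Prod.instMeasurableSpace :=
    sup_le_sup le_rfl (MeasurableSpace.comap_mono (𝓕.le ⊤))
  have h3 := StronglyMeasurable.mono h1 h2
  simpa [Set.indicator] using h3

lemma stronglyMeasurable_volt {m : MeasurableSpace Ω} {v : Time T → Ω → ℝ}
    (hv : StronglyMeasurable fun z : Time T × Ω => v z.1 z.2) (a : ℝ) :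
    StronglyMeasurable fun z : Time T × Ω => volt a (fun s => v s z.2) z.1 := by
  have hset : MeasurableSet {q : (Time T × Ω) × Time T | q.2 ≤ q.1.1} :=
    measurableSet_le measurable_snd (measurable_fst.comp measurable_fst)
  have h1 : StronglyMeasurable fun q : (Time T × Ω) × Time T =>
      Real.exp (-a * ((q.1.1 : ℝ) - (q.2 : ℝ))) * v q.2 q.1.2 := by
    refine StronglyMeasurable.mul (Measurable.stronglyMeasurable (by fun_prop)) ?_
    exact hv.comp_measurable (g := fun q : (Time T × Ω) × Time T => (q.2, q.1.2)) (by fun_prop)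
  have h2 := (h1.indicator hset).integral_prod_right' (ν := (volume : Measure (Time T)))
  convert h2 using 2 with z
  rw [volt, ← integral_indicator measurableSet_Iic]
  rfl

lemma stronglyMeasurable_voltAdj {m : MeasurableSpace Ω} {v : Time T → Ω → ℝ}
    (hv : StronglyMeasurable fun z : Time T × Ω => v z.1 z.2) (a : ℝ) :
    StronglyMeasurable fun z : Time T × Ω => voltAdj a (fun s => v s z.2) z.1 := by
  have hset : MeasurableSet {q : (Time T × Ω) × Time T | q.1.1 ≤ q.2} :=
    measurableSet_le (measurable_fst.comp measurable_fst) measurable_snd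
  have h1 : StronglyMeasurable fun q : (Time T × Ω) × Time T =>
      Real.exp (-a * ((q.2 : ℝ) - (q.1.1 : ℝ))) * v q.2 q.1.2 := by
    refine StronglyMeasurable.mul (Measurable.stronglyMeasurable (by fun_prop)) ?_
    exact hv.comp_measurable (g := fun q : (Time T × Ω) × Time T => (q.2, q.1.2)) (by fun_prop)
  have h2 := (h1.indicator hset).integral_prod_right' (ν := (volume : Measure (Time T)))
  convert h2 using 2 with z
  rw [voltAdj, ← integral_indicator measurableSet_Ici]
  rfl

/-- Causality: for `t ≤ t₀` the value at `t` only sees the process on `Set.Iic t₀`, so cutting off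
at `t₀` changes nothing there. The adjoint operator has no such property. -/
lemma progressive_volt {𝓕 : Filtration (Time T) mΩ} {v : Time T → Ω → ℝ}
    (hv : IsStronglyProgressive 𝓕 v) (a : ℝ) :
    IsStronglyProgressive 𝓕 fun t ω => volt a (fun s => v s ω) t := by
  rw [isStronglyProgressive_iff]
  intro t₀
  have h1 := isStronglyProgressive_iff.1 hv t₀
  letI : MeasurableSpace Ω := 𝓕 t₀
  have h2 := stronglyMeasurable_volt
    (v := fun s ω => (Set.Iic t₀).indicator (fun s => v s ω) s) h1 a
  have h3 := h2.indicator (measurableSet_Iic.preimage measurable_fst :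
      MeasurableSet (Prod.fst ⁻¹' Set.Iic t₀ : Set (Time T × Ω)))
  convert h3 using 1
  ext z
  by_cases hz : z.1 ≤ t₀
  · simp only [Set.indicator, Set.mem_Iic, Set.mem_preimage, hz, if_true]
    refine setIntegral_congr_fun measurableSet_Iic fun s hs => ?_
    have : s ≤ t₀ := le_trans hs hz
    simp [this]
  · simp [Set.indicator, hz]

lemma isStronglyProgressive_of_continuous_const {𝓕 : Filtration (Time T) mΩ} {g : Time T → ℝ}
    (hg : Continuous g) : IsStronglyProgressive 𝓕 fun t _ => g t := by
  intro t₀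
  letI : MeasurableSpace Ω := 𝓕 t₀
  exact (hg.stronglyMeasurable.comp_measurable
    (measurable_subtype_coe.comp measurable_fst) : StronglyMeasurable fun p : Set.Iic t₀ × Ω => g p.1)

/-! ### Square integrable processes -/

/-- Processes that are square integrable with respect to `dt ⊗ dμ`. -/
def SqInt (μ : Measure Ω) (v : Time T → Ω → ℝ) : Prop :=
  MemLp (fun z : Time T × Ω => v z.1 z.2) 2 ((volume : Measure (Time T)).prod μ)

variable {μ : Measure Ω} [IsProbabilityMeasure μ]

lemma ae_ae_swap {p : Time T → Ω → Prop}
    (h : ∀ᵐ z ∂((volume : Measure (Time T)).prod μ), p z.1 z.2) : ∀ᵐ ω ∂μ, ∀ᵐ t, p t ω := by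
  have := (Measure.measurePreserving_swap (μ := μ) (ν := (volume : Measure (Time T)))).quasiMeasurePreserving.ae h
  exact Measure.ae_ae_of_ae_prod this

lemma ae_prod_of_ae_forall {p : Time T → Ω → Prop} (h : ∀ᵐ ω ∂μ, ∀ t, p t ω) :
    ∀ᵐ z ∂((volume : Measure (Time T)).prod μ), p z.1 z.2 := by
  have := (Measure.quasiMeasurePreserving_snd (μ := (volume : Measure (Time T))) (ν := μ)).ae h
  filter_upwards [this] with z hz using hz z.1

/-- By Tonelli, the iterated integral of the definition is the squared norm in `L²(dt ⊗ dμ)`. -/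
lemma isAdmissible_iff [Fact (0 < T)] {𝓕 : Filtration (Time T) mΩ} {v : Time T → Ω → ℝ} :
    IsAdmissible 𝓕 μ v ↔ IsStronglyProgressive 𝓕 v ∧ SqInt μ v := by
  refine and_congr_right fun h => ?_
  have hm := stronglyMeasurable_of_progressive h
  rw [SqInt, memLp_two_iff_integrable_sq hm.aestronglyMeasurable,
    ← lintegral_prod_symm' (μ := (volume : Measure (Time T))) (ν := μ)
      (fun z : Time T × Ω => ENNReal.ofReal (v z.1 z.2 ^ 2))
      (hm.measurable.pow_const 2).ennreal_ofReal]
  refine ⟨fun h => ⟨(hm.pow 2).aestronglyMeasurable, ?_⟩, fun h => ?_⟩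
  · rw [hasFiniteIntegral_iff_ofReal (ae_of_all _ fun z => sq_nonneg _)]
    exact h
  · exact (hasFiniteIntegral_iff_ofReal (ae_of_all _ fun z => sq_nonneg _)).1 h.2

lemma IsAdmissible.add [Fact (0 < T)] {𝓕 : Filtration (Time T) mΩ} {v w : Time T → Ω → ℝ}
    (hv : IsAdmissible 𝓕 μ v) (hw : IsAdmissible 𝓕 μ w) :
    IsAdmissible 𝓕 μ fun t ω => v t ω + w t ω := by
  rw [isAdmissible_iff] at *
  exact ⟨hv.1.add hw.1, MemLp.add hv.2 hw.2⟩

lemma IsAdmissible.sub [Fact (0 < T)] {𝓕 : Filtration (Time T) mΩ} {v w : Time T → Ω → ℝ}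
    (hv : IsAdmissible 𝓕 μ v) (hw : IsAdmissible 𝓕 μ w) :
    IsAdmissible 𝓕 μ fun t ω => v t ω - w t ω := by
  rw [isAdmissible_iff] at *
  exact ⟨hv.1.sub hw.1, MemLp.sub hv.2 hw.2⟩

lemma IsAdmissible.const_mul [Fact (0 < T)] {𝓕 : Filtration (Time T) mΩ} {v : Time T → Ω → ℝ}
    (hv : IsAdmissible 𝓕 μ v) (a : ℝ) :
    IsAdmissible 𝓕 μ fun t ω => a * v t ω := by
  rw [isAdmissible_iff] at *
  exact ⟨IsStronglyProgressive.mul (isStronglyProgressive_const 𝓕 a) hv.1, MemLp.const_mul hv.2 a⟩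

lemma IsAdmissible.sqInt [Fact (0 < T)] {𝓕 : Filtration (Time T) mΩ} {v : Time T → Ω → ℝ}
    (hv : IsAdmissible 𝓕 μ v) : SqInt μ v := (isAdmissible_iff.1 hv).2

lemma IsAdmissible.finsetSum [Fact (0 < T)] {𝓕 : Filtration (Time T) mΩ} {ι : Type*}
    (S : Finset ι) {v : ι → Time T → Ω → ℝ} (hv : ∀ i, IsAdmissible 𝓕 μ (v i)) :
    IsAdmissible 𝓕 μ fun t ω => ∑ i ∈ S, v i t ω := by
  simp only [isAdmissible_iff] at *
  exact ⟨IsStronglyProgressive.finsetSum fun i _ => (hv i).1,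
    memLp_finsetSum S fun i _ => (hv i).2⟩

namespace SqInt

variable {v w : Time T → Ω → ℝ}

lemma congr (hv : SqInt μ v) (h : SameStrategy μ v w) : SqInt μ w := MemLp.ae_eq h hv

lemma integrable (hv : SqInt μ v) :
    Integrable (fun z : Time T × Ω => v z.1 z.2) ((volume : Measure (Time T)).prod μ) :=
  MemLp.integrable one_le_two hv

lemma integrable_mul (hv : SqInt μ v) (hw : SqInt μ w) :
    Integrable (fun z : Time T × Ω => v z.1 z.2 * w z.1 z.2)
      ((volume : Measure (Time T)).prod μ) :=
  MemLp.integrable_mul hv hw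

lemma ae_memLp (hv : SqInt μ v) : ∀ᵐ ω ∂μ, MemLp (fun t => v t ω) 2 := by
  have h1 := hv.integrable.swap.prod_right_ae
  have h2 := (MemLp.integrable_sq hv).swap.prod_right_ae
  filter_upwards [h1, h2] with ω h1 h2
  exact (memLp_two_iff_integrable_sq h1.1).2 h2

lemma ae_integrable (hv : SqInt μ v) : ∀ᵐ ω ∂μ, Integrable (fun t => v t ω) := by
  filter_upwards [hv.ae_memLp] with ω h using h.integrable one_le_two

lemma ae_all_integrable {ι : Type*} [Countable ι] {v : ι → Time T → Ω → ℝ}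
    (hv : ∀ i, SqInt μ (v i)) : ∀ᵐ ω ∂μ, ∀ i, Integrable (fun t => v i t ω) :=
  ae_all_iff.2 fun i => (hv i).ae_integrable

lemma integral_eq (hv : SqInt μ v) (hw : SqInt μ w) :
    ∫ z, v z.1 z.2 * w z.1 z.2 ∂((volume : Measure (Time T)).prod μ)
      = ∫ ω, (∫ t, v t ω * w t ω) ∂μ :=
  integral_prod_symm _ (hv.integrable_mul hw)

lemma integrable_integral (hv : SqInt μ v) (hw : SqInt μ w) :
    Integrable (fun ω => ∫ t, v t ω * w t ω) μ :=
  (hv.integrable_mul hw).integral_prod_right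

lemma of_const {g : Ω → ℝ} (hg : MemLp g 2 μ) : SqInt (T := T) μ fun _ ω => g ω :=
  MemLp.comp_snd hg _

lemma of_continuous {g : Time T → ℝ} (hg : Continuous g) : SqInt μ fun t (_ : Ω) => g t := by
  obtain ⟨C, hC⟩ := isCompact_univ.exists_bound_of_continuousOn hg.continuousOn
  exact MemLp.of_bound (hg.aestronglyMeasurable.comp_fst) C
    (ae_of_all _ fun z => hC z.1 (Set.mem_univ _))

lemma continuous_mul {g : Time T → ℝ} (hg : Continuous g) (hv : SqInt μ v) :
    SqInt μ fun t ω => g t * v t ω := by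
  obtain ⟨C, hC⟩ := isCompact_univ.exists_bound_of_continuousOn hg.continuousOn
  refine MemLp.of_le_mul (c := C) hv (hg.aestronglyMeasurable.comp_fst.mul hv.1)
    (ae_of_all _ fun z => ?_)
  rw [norm_mul]
  exact mul_le_mul_of_nonneg_right (hC z.1 (Set.mem_univ _)) (norm_nonneg _)

/-- Cauchy-Schwarz against the constant one, read off from the nonnegativity of `∫ (V |f| - I)²`. -/
lemma sq_integral_abs_le {f : Time T → ℝ} (hf : MemLp f 2) :
    (∫ t, |f t|) ^ 2 ≤ volume.real (Set.univ : Set (Time T)) * ∫ t, f t ^ 2 := by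
  set V := volume.real (Set.univ : Set (Time T))
  set I := ∫ t, |f t|
  have i1 : Integrable fun t => |f t| := (hf.integrable one_le_two).abs
  have i2 : Integrable fun t => f t ^ 2 := hf.integrable_sq
  have h : ∫ t, (V * |f t| - I) ^ 2 = V ^ 2 * (∫ t, f t ^ 2) - V * I ^ 2 := by
    have e : ∀ t, (V * |f t| - I) ^ 2 = (V ^ 2 * f t ^ 2 - 2 * V * I * |f t|) + I ^ 2 := by
      intro t; rw [sub_sq, mul_pow, sq_abs]; ring
    simp only [e]
    have i3 : Integrable fun t => V ^ 2 * f t ^ 2 - 2 * V * I * |f t| :=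
      (i2.const_mul _).sub (i1.const_mul _)
    rw [integral_add i3 (integrable_const _), integral_sub (i2.const_mul _) (i1.const_mul _),
      integral_const_mul, integral_const_mul, integral_const, smul_eq_mul]
    ring
  have h0 : 0 ≤ ∫ t, (V * |f t| - I) ^ 2 := integral_nonneg fun t => sq_nonneg _
  -- Positivity of `T` is not assumed here, so the total mass `V` may vanish.
  rcases (measureReal_nonneg : 0 ≤ V).eq_or_lt with hV | hV
  · have hvol : (volume : Measure (Time T)) = 0 := by
      rw [← Measure.measure_univ_eq_zero]
      exact (measureReal_eq_zero_iff (measure_ne_top _ _)).1 hV.symm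
    simp [I, hvol]
  · have : V * I ^ 2 ≤ V * (V * ∫ t, f t ^ 2) := by nlinarith
    exact le_of_mul_le_mul_left this hV

lemma memLp_integral_abs (hv : SqInt μ v) : MemLp (fun ω => ∫ t, |v t ω|) 2 μ := by
  have hm : AEStronglyMeasurable (fun ω => ∫ t, |v t ω|) μ :=
    hv.integrable.abs.integral_prod_right.aestronglyMeasurable
  rw [memLp_two_iff_integrable_sq hm]
  have h2 : Integrable (fun ω => ∫ t, v t ω ^ 2) μ :=
    (MemLp.integrable_sq hv).integral_prod_right
  refine (h2.const_mul (volume.real (Set.univ : Set (Time T)))).mono' (hm.pow 2) ?_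
  filter_upwards [hv.ae_memLp] with ω h
  rw [Real.norm_of_nonneg (sq_nonneg _)]
  exact sq_integral_abs_le h

lemma memLp_integral (hv : SqInt μ v) : MemLp (fun ω => ∫ t, v t ω) 2 μ := by
  refine hv.memLp_integral_abs.mono hv.integrable.integral_prod_right.aestronglyMeasurable
    (ae_of_all _ fun ω => ?_)
  rw [Real.norm_of_nonneg (integral_nonneg fun t => abs_nonneg _)]
  exact abs_integral_le_integral_abs

lemma exists_ae_eq (hv : SqInt μ v) : ∃ v' : Time T → Ω → ℝ,
    StronglyMeasurable (fun z : Time T × Ω => v' z.1 z.2) ∧ SameStrategy μ v v' ∧ SqInt μ v' :=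
  ⟨fun t ω => hv.1.mk _ (t, ω), hv.1.stronglyMeasurable_mk, hv.1.ae_eq_mk,
    MemLp.ae_eq hv.1.ae_eq_mk hv⟩

lemma of_abs_le {g : Ω → ℝ} (hg : MemLp g 2 μ)
    (hm : AEStronglyMeasurable (fun z : Time T × Ω => v z.1 z.2) ((volume : Measure (Time T)).prod μ))
    (h : ∀ᵐ ω ∂μ, ∀ t, |v t ω| ≤ g ω) : SqInt μ v := by
  refine MemLp.mono (of_const (T := T) hg) hm ?_
  filter_upwards [ae_prod_of_ae_forall h] with z hz
  exact hz.trans (le_abs_self _)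

lemma volt (hv : SqInt μ v) {a : ℝ} (ha : 0 ≤ a) :
    SqInt μ fun t ω => volt a (fun s => v s ω) t := by
  obtain ⟨v', hm, he, -⟩ := hv.exists_ae_eq
  refine of_abs_le hv.memLp_integral_abs ?_ ?_
  · refine (stronglyMeasurable_volt hm a).aestronglyMeasurable.congr ?_
    have : ∀ᵐ ω ∂μ, ∀ t, PriceImpactGame.volt a (fun s => v' s ω) t
        = PriceImpactGame.volt a (fun s => v s ω) t := by
      filter_upwards [ae_ae_swap (p := fun t ω => v t ω = v' t ω) he] with ω hω t
      exact (volt_congr hω a t).symm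
    exact ae_prod_of_ae_forall this
  · filter_upwards [hv.ae_integrable] with ω hω t
    exact abs_volt_le ha hω t

lemma voltAdj (hv : SqInt μ v) {a : ℝ} (ha : 0 ≤ a) :
    SqInt μ fun t ω => voltAdj a (fun s => v s ω) t := by
  obtain ⟨v', hm, he, -⟩ := hv.exists_ae_eq
  refine of_abs_le hv.memLp_integral_abs ?_ ?_
  · refine (stronglyMeasurable_voltAdj hm a).aestronglyMeasurable.congr ?_
    have : ∀ᵐ ω ∂μ, ∀ t, PriceImpactGame.voltAdj a (fun s => v' s ω) t
        = PriceImpactGame.voltAdj a (fun s => v s ω) t := by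
      filter_upwards [ae_ae_swap (p := fun t ω => v t ω = v' t ω) he] with ω hω t
      exact (voltAdj_congr hω a t).symm
    exact ae_prod_of_ae_forall this
  · filter_upwards [hv.ae_integrable] with ω hω t
    exact abs_voltAdj_le ha hω t

end SqInt

lemma IsAdmissible.volt [Fact (0 < T)] {𝓕 : Filtration (Time T) mΩ} {v : Time T → Ω → ℝ}
    (hv : IsAdmissible 𝓕 μ v) {a : ℝ} (ha : 0 ≤ a) :
    IsAdmissible 𝓕 μ fun t ω => volt a (fun s => v s ω) t := by
  rw [isAdmissible_iff] at *
  exact ⟨progressive_volt hv.1 a, hv.2.volt ha⟩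

end Processes

/-! ### Right-continuous regularization along dyadic times. -/

section Regularization

variable {T : ℝ} [hT : Fact (0 < T)]

/-! ### Dyadic grids -/

/-- The `k`-th point of the dyadic grid of mesh `T / 2 ^ n`. -/
noncomputable def grid (n k : ℕ) : Time T := Set.projIcc 0 T hT.out.le (T * (k / 2 ^ n))

lemma grid_mono (n : ℕ) : Monotone (grid (T := T) n) := fun i j hij => by
  refine Set.monotone_projIcc _ (mul_le_mul_of_nonneg_left ?_ hT.out.le)
  gcongr

lemma coe_grid {n k : ℕ} (hk : k ≤ 2 ^ n) : ((grid n k : Time T) : ℝ) = T * (k / 2 ^ n) := by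
  have h1 : (k : ℝ) / 2 ^ n ≤ 1 := by
    rw [div_le_one (by positivity)]
    exact_mod_cast hk
  have h2 : 0 ≤ (k : ℝ) / 2 ^ n := by positivity
  have h3 := hT.out
  exact congrArg Subtype.val (Set.projIcc_of_mem hT.out.le
    (show T * ((k : ℝ) / 2 ^ n) ∈ Set.Icc 0 T from ⟨by positivity, by nlinarith⟩))

lemma grid_zero (n : ℕ) : (grid n 0 : Time T) = ⊥ := by
  apply Subtype.ext
  rw [coe_grid (Nat.zero_le _)]
  simp only [Nat.cast_zero, zero_div, mul_zero]
  rfl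

lemma grid_last (n : ℕ) : (grid n (2 ^ n) : Time T) = ⊤ := by
  apply Subtype.ext
  rw [coe_grid le_rfl]
  simp only [Nat.cast_pow, Nat.cast_ofNat, ne_eq, pow_eq_zero_iff', OfNat.ofNat_ne_zero,
    false_and, not_false_eq_true, div_self, mul_one]
  rfl

lemma grid_refine (n k j : ℕ) : (grid n k : Time T) = grid (n + j) (k * 2 ^ j) := by
  unfold grid
  congr 2
  push_cast
  rw [pow_add, mul_div_mul_right _ _ (by positivity)]

/-- The dyadic times. -/
def dyadicTimes (T : ℝ) [Fact (0 < T)] : Set (Time T) := {d | ∃ n k, k ≤ 2 ^ n ∧ grid n k = d}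

lemma exists_grid_eq {d : Time T} (hd : d ∈ dyadicTimes T) :
    ∃ n₀, ∀ n ≥ n₀, ∃ k ≤ 2 ^ n, grid n k = d := by
  obtain ⟨n₀, k, hk, rfl⟩ := hd
  refine ⟨n₀, fun n hn => ?_⟩
  obtain ⟨j, rfl⟩ := Nat.exists_eq_add_of_le hn
  refine ⟨k * 2 ^ j, ?_, (grid_refine n₀ k j).symm⟩
  rw [pow_add]
  exact Nat.mul_le_mul_right _ hk

lemma exists_dyadic_between {t u : Time T} (htu : t < u) : ∃ d ∈ dyadicTimes T, t < d ∧ d < u := by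
  have hT' := hT.out
  have hlt : (t : ℝ) < u := htu
  obtain ⟨n, hn⟩ := exists_nat_gt (T / (u - t))
  have h2n : (n : ℝ) < 2 ^ n := by exact_mod_cast Nat.lt_two_pow_self
  have hmesh : T / 2 ^ n < u - t := by
    rw [div_lt_iff₀ (by positivity)]
    rw [div_lt_iff₀ (by linarith)] at hn
    nlinarith
  -- Index of the first grid point strictly after `t`; it falls below `u` because the mesh `T / 2 ^
  -- n` is less than `u - t`.
  set k := ⌊(t : ℝ) * 2 ^ n / T⌋₊ + 1 with hk
  have h0 : 0 ≤ (t : ℝ) * 2 ^ n / T := by have := t.2.1; positivity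
  have h1 : (t : ℝ) * 2 ^ n / T < k := by
    rw [hk]; push_cast; exact Nat.lt_floor_add_one _
  have h2 : (k : ℝ) ≤ (t : ℝ) * 2 ^ n / T + 1 := by
    rw [hk]; push_cast; linarith [Nat.floor_le h0]
  have h3 : (t : ℝ) < T * (k / 2 ^ n) := by
    rw [div_lt_iff₀ hT'] at h1
    rw [mul_div_assoc', lt_div_iff₀ (by positivity)]
    linarith
  have h4 : T * (k / 2 ^ n) < u := by
    have : T * (k / 2 ^ n) ≤ T * (((t : ℝ) * 2 ^ n / T + 1) / 2 ^ n) := by gcongr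
    have e : T * (((t : ℝ) * 2 ^ n / T + 1) / 2 ^ n) = t + T / 2 ^ n := by
      field_simp
    linarith
  have h5 : k ≤ 2 ^ n := by
    have : T * (k / 2 ^ n) < T * 1 := by linarith [u.2.2]
    have := lt_of_mul_lt_mul_left this hT'.le
    rw [div_lt_one (by positivity)] at this
    exact_mod_cast this.le
  refine ⟨grid n k, ⟨n, k, h5, rfl⟩, ?_, ?_⟩
  · rw [← Subtype.coe_lt_coe, coe_grid h5]; exact h3
  · rw [← Subtype.coe_lt_coe, coe_grid h5]; exact h4

/-- The filter of dyadic times decreasing strictly to `t`. -/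
def dyadicGT (t : Time T) : Filter (Time T) := 𝓝[dyadicTimes T ∩ Set.Ioi t] t

/-- The filter of dyadic times increasing strictly to `t`. -/
def dyadicLT (t : Time T) : Filter (Time T) := 𝓝[dyadicTimes T ∩ Set.Iio t] t

lemma mem_dyadicGT {t u : Time T} (htu : t < u) :
    dyadicTimes T ∩ Set.Ioo t u ∈ dyadicGT t := by
  have h : Set.Iio u ∈ 𝓝 t := Iio_mem_nhds htu
  filter_upwards [mem_nhdsWithin_of_mem_nhds h, self_mem_nhdsWithin] with x hx hx'
  exact ⟨hx'.1, hx'.2, hx⟩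

lemma mem_dyadicLT {t u : Time T} (hut : u < t) :
    dyadicTimes T ∩ Set.Ioo u t ∈ dyadicLT t := by
  have h : Set.Ioi u ∈ 𝓝 t := Ioi_mem_nhds hut
  filter_upwards [mem_nhdsWithin_of_mem_nhds h, self_mem_nhdsWithin] with x hx hx'
  exact ⟨hx'.1, hx, hx'.2⟩

lemma dyadicGT_basis {t : Time T} (ht : t < ⊤) {S : Set (Time T)} (hS : S ∈ dyadicGT t) :
    ∃ u, t < u ∧ dyadicTimes T ∩ Set.Ioo t u ⊆ S := by
  obtain ⟨U, hU, hsub⟩ := mem_nhdsWithin_iff_exists_mem_nhds_inter.1 hS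
  obtain ⟨u, hu, hsub'⟩ := (mem_nhdsGE_iff_exists_Ico_subset' ht).1 (mem_nhdsWithin_of_mem_nhds hU)
  exact ⟨u, hu, fun x hx => hsub ⟨hsub' ⟨hx.2.1.le, hx.2.2⟩, hx.1, hx.2.1⟩⟩

lemma dyadicLT_basis {t : Time T} (ht : ⊥ < t) {S : Set (Time T)} (hS : S ∈ dyadicLT t) :
    ∃ u, u < t ∧ dyadicTimes T ∩ Set.Ioo u t ⊆ S := by
  obtain ⟨U, hU, hsub⟩ := mem_nhdsWithin_iff_exists_mem_nhds_inter.1 hS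
  obtain ⟨u, hu, hsub'⟩ := (mem_nhdsLE_iff_exists_Ioc_subset' ht).1 (mem_nhdsWithin_of_mem_nhds hU)
  exact ⟨u, hu, fun x hx => hsub ⟨hsub' ⟨hx.2.1, hx.2.2.le⟩, hx.1, hx.2.2⟩⟩

lemma dyadicGT_neBot {t : Time T} (ht : t < ⊤) : (dyadicGT t).NeBot := by
  rw [← forall_mem_nonempty_iff_neBot]
  intro S hS
  obtain ⟨u, hu, hsub⟩ := dyadicGT_basis ht hS
  obtain ⟨d, hd, h⟩ := exists_dyadic_between hu
  exact ⟨d, hsub ⟨hd, h⟩⟩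

/-! ### Upcrossings along dyadic times -/

/-- `HasUpcrossings f a b m r e`: along dyadic times in `(r, e]`, the function `f` crosses `m` times
from below `a` to above `b`. -/
inductive HasUpcrossings (f : Time T → ℝ) (a b : ℝ) : ℕ → Time T → Time T → Prop
  | zero {r e : Time T} (h : r ≤ e) : HasUpcrossings f a b 0 r e
  | succ {m : ℕ} {r e s u e' : Time T} (h : HasUpcrossings f a b m r e) (hes : e < s) (hsu : s < u)
      (hue : u ≤ e') (hs : s ∈ dyadicTimes T) (hu : u ∈ dyadicTimes T) (hfs : f s < a)
      (hfu : b < f u) : HasUpcrossings f a b (m + 1) r e'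

/-- The inductive definition appends crossings on the right; near a right limit they are found
successively further to the left. -/
lemma HasUpcrossings.prepend {f : Time T → ℝ} {a b : ℝ} {m : ℕ} {r e r' s u : Time T}
    (h : HasUpcrossings f a b m r e) (hrs : r' < s) (hsu : s < u) (hur : u ≤ r)
    (hs : s ∈ dyadicTimes T) (hu : u ∈ dyadicTimes T) (hfs : f s < a) (hfu : b < f u) :
    HasUpcrossings f a b (m + 1) r' e := by
  induction h with
  | zero h => exact .succ (.zero le_rfl) hrs hsu (hur.trans h) hs hu hfs hfu
  | succ h h1 h2 h3 h4 h5 h6 h7 ih => exact .succ (ih hur) h1 h2 h3 h4 h5 h6 h7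

/-- Finitely many dyadic times lie on one common fine grid, so the discrete upcrossing count detects
all of them. The horizon is `K + 1` because only crossings completed strictly before the horizon are
counted. -/
lemma HasUpcrossings.le_upcrossingsBefore {Ω : Type*} {M : Time T → Ω → ℝ} {ω : Ω}
    {f : Time T → ℝ} (hM : ∀ t, M t ω = f t) {a b : ℝ} (hab : a < b) {m : ℕ}
    {r e : Time T} (h : HasUpcrossings f a b m r e) :
    ∃ n₀, ∀ n ≥ n₀, ∃ K ≤ 2 ^ n, grid n K ≤ e ∧
      m ≤ upcrossingsBefore a b (fun k => M (grid n k)) (K + 1) ω := by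
  induction h with
  | zero h => exact ⟨0, fun n _ => ⟨0, Nat.zero_le _, by simp [grid_zero], Nat.zero_le _⟩⟩
  | @succ m r e s u e' h hes hsu hue hs hu hfs hfu ih =>
    obtain ⟨n₁, h₁⟩ := ih
    obtain ⟨n₂, h₂⟩ := exists_grid_eq hs
    obtain ⟨n₃, h₃⟩ := exists_grid_eq hu
    refine ⟨max n₁ (max n₂ n₃), fun n hn => ?_⟩
    obtain ⟨K, hK, hKe, hm⟩ := h₁ n ((le_max_left _ _).trans hn)
    obtain ⟨i, hi, hsi⟩ := h₂ n (((le_max_left _ _).trans (le_max_right _ _)).trans hn)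
    obtain ⟨j, hj, huj⟩ := h₃ n (((le_max_right _ _).trans (le_max_right _ _)).trans hn)
    have hKi : K < i := by
      by_contra hcon
      have := grid_mono (T := T) n (not_lt.1 hcon)
      rw [hsi] at this
      exact absurd (hes.trans_le this) (not_lt.2 hKe)
    have hij : i < j := by
      by_contra hcon
      have := grid_mono (T := T) n (not_lt.1 hcon)
      rw [hsi, huj] at this
      exact absurd hsu (not_lt.2 this)
    refine ⟨j, hj, huj ▸ hue, ?_⟩
    have := upcrossingsBefore_lt_of_exists_upcrossing (f := fun k => M (grid n k))
      (ω := ω) hab (N := K + 1) (N₁ := i) (N₂ := j) hKi (by simpa [hsi, hM] using hfs) hij.le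
      (by simpa [huj, hM] using hfu)
    omega

/-- Bounded along dyadic times, with finitely many upcrossings of every rational interval. -/
structure IsTame (f : Time T → ℝ) : Prop where
  bounded : ∃ R, ∀ d ∈ dyadicTimes T, |f d| ≤ R
  upcrossings : ∀ a b : ℚ, a < b → ∃ m, ∀ r e, ¬ HasUpcrossings f a b m r e

/-- A bounded function without limit along `l` would be frequently below `a` and frequently above
`b` for some rationals `a < b`; by `H` this forces arbitrarily many upcrossings. -/
lemma IsTame.exists_tendsto {f : Time T → ℝ} (hf : IsTame f) {l : Filter (Time T)}
    (hl : dyadicTimes T ∈ l)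
    (H : ∀ a b : ℚ, a < b → (∃ᶠ d in l, f d < a) → (∃ᶠ d in l, b < f d) →
      ∀ m, ∃ r e, HasUpcrossings f a b m r e) : ∃ c, Tendsto f l (𝓝 c) := by
  obtain ⟨R, hR⟩ := hf.bounded
  refine tendsto_of_no_upcrossings (s := Set.range ((↑) : ℚ → ℝ)) Rat.isDenseEmbedding_coe_real.dense
    ?_ ⟨R, ?_⟩ ⟨-R, ?_⟩
  · rintro _ ⟨a, rfl⟩ _ ⟨b, rfl⟩ hab ⟨h1, h2⟩
    have hab' : a < b := by exact_mod_cast hab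
    obtain ⟨m, hm⟩ := hf.upcrossings a b hab'
    obtain ⟨r, e, h⟩ := H a b hab' h1 h2 m
    exact hm r e h
  · rw [eventually_map]
    filter_upwards [hl] with d hd using (abs_le.1 (hR d hd)).2
  · rw [eventually_map]
    filter_upwards [hl] with d hd using (abs_le.1 (hR d hd)).1

lemma IsTame.exists_tendsto_dyadicGT {f : Time T → ℝ} (hf : IsTame f) {t : Time T} (ht : t < ⊤) :
    ∃ c, Tendsto f (dyadicGT t) (𝓝 c) := by
  refine hf.exists_tendsto (mem_of_superset (mem_dyadicGT ht) Set.inter_subset_left) ?_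
  intro a b hab h1 h2
  -- The crossings are required in an arbitrarily small window after `t` and strictly away from `t`,
  -- which leaves room for a further crossing to be prepended.
  suffices h : ∀ m : ℕ, ∀ v, t < v → ∃ r, t < r ∧ r < v ∧ HasUpcrossings f a b m r v by
    intro m
    obtain ⟨r, -, -, h⟩ := h m ⊤ ht
    exact ⟨r, ⊤, h⟩
  intro m
  induction m with
  | zero =>
    intro v hv
    obtain ⟨r, hr1, hr2⟩ := exists_between hv
    exact ⟨r, hr1, hr2, .zero hr2.le⟩
  | succ m ih =>
    intro v hv
    obtain ⟨r, hr1, hr2, hr⟩ := ih v hv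
    obtain ⟨u, hfu, hu, htu, hur⟩ := (h2.and_eventually (mem_dyadicGT hr1)).exists
    obtain ⟨s, hfs, hs, hts, hsu⟩ := (h1.and_eventually (mem_dyadicGT htu)).exists
    obtain ⟨r', h3, h4⟩ := exists_between hts
    exact ⟨r', h3, h4.trans (hsu.trans (hur.trans hr2)), hr.prepend h4 hsu hur.le hs hu hfs hfu⟩

lemma IsTame.exists_tendsto_dyadicLT {f : Time T → ℝ} (hf : IsTame f) {t : Time T} (ht : ⊥ < t) :
    ∃ c, Tendsto f (dyadicLT t) (𝓝 c) := by
  refine hf.exists_tendsto (mem_of_superset (mem_dyadicLT ht) Set.inter_subset_left) ?_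
  intro a b hab h1 h2
  suffices h : ∀ m : ℕ, ∃ e, e < t ∧ HasUpcrossings f a b m ⊥ e by
    intro m
    obtain ⟨e, -, h⟩ := h m
    exact ⟨⊥, e, h⟩
  intro m
  induction m with
  | zero => exact ⟨⊥, ht, .zero le_rfl⟩
  | succ m ih =>
    obtain ⟨e, he, h⟩ := ih
    obtain ⟨s, hfs, hs, hes, hst⟩ := (h1.and_eventually (mem_dyadicLT he)).exists
    obtain ⟨u, hfu, hu, hsu, hut⟩ := (h2.and_eventually (mem_dyadicLT hst)).exists
    exact ⟨u, hut, .succ h hes hsu le_rfl hs hu hfs hfu⟩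

open Classical in
/-- The right-continuous regularization of `f` along dyadic times. -/
noncomputable def rightReg (f : Time T → ℝ) (t : Time T) : ℝ :=
  if t = ⊤ then f ⊤ else limUnder (dyadicGT t) f

lemma IsTame.tendsto_rightReg {f : Time T → ℝ} (hf : IsTame f) {t : Time T} (ht : t < ⊤) :
    Tendsto f (dyadicGT t) (𝓝 (rightReg f t)) := by
  haveI := dyadicGT_neBot ht
  obtain ⟨c, hc⟩ := hf.exists_tendsto_dyadicGT ht
  rw [rightReg, if_neg ht.ne, hc.limUnder_eq]
  exact hc

/-- For `r` strictly between `t` and `u`, the regularized value at `r` is a limit of values of `f`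
at dyadic times in `(r, u)`. A closed ball containing `f` on the dyadic times near `t` therefore
contains the regularization near `t`, on either side. -/
lemma IsTame.isCadlag {f : Time T → ℝ} (hf : IsTame f) : IsCadlag (rightReg f) := by
  intro t
  constructor
  · rcases eq_or_lt_of_le (le_top : t ≤ ⊤) with rfl | ht
    · have : Set.Ici (⊤ : Time T) = {⊤} := Set.Ici_top
      rw [this]
      exact continuousWithinAt_singleton
    · rw [ContinuousWithinAt, Metric.nhds_basis_closedBall.tendsto_right_iff]
      intro ε hε
      obtain ⟨u, hu, hsub⟩ := dyadicGT_basis ht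
        ((hf.tendsto_rightReg ht) (Metric.closedBall_mem_nhds _ hε))
      filter_upwards [Ico_mem_nhdsGE hu] with r hr
      rcases eq_or_lt_of_le hr.1 with rfl | hr1
      · exact Metric.mem_closedBall_self hε.le
      have hr3 : r < ⊤ := hr.2.trans_le le_top
      haveI := dyadicGT_neBot hr3
      refine Metric.isClosed_closedBall.mem_of_tendsto (hf.tendsto_rightReg hr3) ?_
      filter_upwards [mem_dyadicGT hr.2] with d hd
      exact hsub ⟨hd.1, hr1.trans hd.2.1, hd.2.2⟩
  · rcases eq_or_lt_of_le (bot_le : ⊥ ≤ t) with rfl | ht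
    -- No time precedes `⊥`, so any number serves as left limit.
    · refine ⟨0, ?_⟩
      simp
    · obtain ⟨c, hc⟩ := hf.exists_tendsto_dyadicLT ht
      refine ⟨c, ?_⟩
      rw [Metric.nhds_basis_closedBall.tendsto_right_iff]
      intro ε hε
      obtain ⟨u, hu, hsub⟩ := dyadicLT_basis ht (hc (Metric.closedBall_mem_nhds _ hε))
      filter_upwards [Ioo_mem_nhdsLT hu] with r hr
      have hr3 : r < ⊤ := hr.2.trans_le le_top
      haveI := dyadicGT_neBot hr3
      refine Metric.isClosed_closedBall.mem_of_tendsto (hf.tendsto_rightReg hr3) ?_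
      filter_upwards [mem_dyadicGT hr.2] with d hd
      exact hsub ⟨hd.1, hr.1.trans hd.2.1, hd.2.2⟩

end Regularization

/-! ### Càdlàg versions of closed martingales under the usual conditions. -/

section RegularizationMartingale

variable {T : ℝ} [hT : Fact (0 < T)] {Ω : Type*} [mΩ : MeasurableSpace Ω]
  {μ : Measure Ω} [IsProbabilityMeasure μ] {𝓕 : Filtration (Time T) mΩ}

lemma measure_eventually_mem_le {A : ℕ → Set Ω} {c : ℝ≥0∞} (h : ∀ n, μ (A n) ≤ c) :
    μ {ω | ∀ᶠ n in atTop, ω ∈ A n} ≤ c := by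
  have e : {ω | ∀ᶠ n in atTop, ω ∈ A n} = ⋃ n, ⋂ m ≥ n, A m := by
    ext ω
    simp [eventually_atTop]
  have hmono : Monotone fun n => ⋂ m ≥ n, A m := by
    intro i j hij ω hω
    simp only [Set.mem_iInter] at hω ⊢
    exact fun m hm => hω m (hij.trans hm)
  rw [e, hmono.measure_iUnion]
  exact iSup_le fun n => (measure_mono (Set.iInter₂_subset n le_rfl)).trans (h n)

/-- Markov type bounds that are uniform in the grid level `n` survive the limit `n → ∞`: the event
has probability at most `C / m` for every `m`. Both Doob inequalities are used in this form. -/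
lemma measure_forall_eventually_eq_zero {A : ℕ → ℕ → Set Ω} {C : ℝ≥0∞} (hC : C ≠ ∞)
    (h : ∀ m n, m * μ (A m n) ≤ C) : μ {ω | ∀ m, ∀ᶠ n in atTop, ω ∈ A m n} = 0 := by
  have h1 : ∀ m : ℕ, m * μ {ω | ∀ m, ∀ᶠ n in atTop, ω ∈ A m n} ≤ C := by
    intro m
    rcases Nat.eq_zero_or_pos m with rfl | hm
    · simp
    have hm0 : (m : ℝ≥0∞) ≠ 0 := by exact_mod_cast hm.ne'
    rw [mul_comm, ← ENNReal.le_div_iff_mul_le (.inl hm0) (.inl (ENNReal.natCast_ne_top m))]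
    refine (measure_mono (t := {ω | ∀ᶠ n in atTop, ω ∈ A m n}) fun ω hω => (hω : ∀ m, ∀ᶠ n in atTop, ω ∈ A m n) m).trans
      (measure_eventually_mem_le fun n => ?_)
    rw [ENNReal.le_div_iff_mul_le (.inl hm0) (.inl (ENNReal.natCast_ne_top m)), mul_comm]
    exact h m n
  by_contra hne
  obtain ⟨m, hm⟩ := ENNReal.exists_nat_mul_gt hne hC
  exact absurd (h1 m) (not_le.2 hm)

/-- The filtration sampled on a dyadic grid. -/
noncomputable def gridFiltration (𝓕 : Filtration (Time T) mΩ) (n : ℕ) : Filtration ℕ mΩ where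
  seq k := 𝓕 (grid n k)
  mono' _ _ hij := 𝓕.mono (grid_mono n hij)
  le' k := 𝓕.le (grid n k)

lemma _root_.MeasureTheory.Martingale.sampleGrid {M : Time T → Ω → ℝ} (hM : Martingale M 𝓕 μ) (n : ℕ) :
    Martingale (fun k => M (grid n k)) (gridFiltration 𝓕 n) μ :=
  ⟨fun k => hM.1 (grid n k), fun _ _ hij => hM.2 _ _ (grid_mono n hij)⟩

/-- Doob's maximal inequality for `|M|` on each grid, whose bound `E|M_T|` does not depend on the
grid. -/
lemma ae_bounded_dyadic {M : Time T → Ω → ℝ} (hM : Martingale M 𝓕 μ) :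
    ∀ᵐ ω ∂μ, ∃ R, ∀ d ∈ dyadicTimes T, |M d ω| ≤ R := by
  let S : ℕ → Ω → ℝ := fun n ω =>
    (Finset.range (2 ^ n + 1)).sup' Finset.nonempty_range_add_one fun k => |M (grid n k) ω|
  let A : ℕ → ℕ → Set Ω := fun m n => {ω | (m : ℝ) ≤ S n ω}
  have hA : ∀ m n : ℕ, m * μ (A m n) ≤ ENNReal.ofReal (∫ ω, |M ⊤ ω| ∂μ) := by
    intro m n
    have hs : Submartingale (fun k ω => |M (grid n k) ω|) (gridFiltration 𝓕 n) μ :=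
      (hM.sampleGrid n).submartingale.sup (hM.sampleGrid n).neg.submartingale
    have h1 := maximal_ineq hs (fun k ω => abs_nonneg _) (ε := (m : NNReal)) (2 ^ n)
    simp only [grid_last] at h1
    have h2 : (((m : NNReal) : ℝ≥0∞)) = m := by simp
    rw [h2] at h1
    refine le_trans (by simpa [A, S] using h1) (ENNReal.ofReal_le_ofReal ?_)
    exact setIntegral_le_integral (hM.integrable ⊤).abs (ae_of_all _ fun ω => abs_nonneg _)
  have h0 := measure_forall_eventually_eq_zero ENNReal.ofReal_ne_top hA
  rw [ae_iff]
  refine measure_mono_null ?_ h0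
  intro ω hω m
  simp only [Set.mem_ofPred_eq, not_exists, not_forall, not_le] at hω
  obtain ⟨d, hd, hlt⟩ := hω m
  obtain ⟨n₀, h⟩ := exists_grid_eq hd
  filter_upwards [eventually_ge_atTop n₀] with n hn
  obtain ⟨k, hk, rfl⟩ := h n hn
  exact hlt.le.trans (Finset.le_sup' (fun k => |M (grid n k) ω|)
    (Finset.mem_range.2 (Nat.lt_succ_of_le hk)))

/-- Doob's upcrossing inequality on each grid, again with a bound that depends only on `M_T`. -/
lemma ae_upcrossings_dyadic {M : Time T → Ω → ℝ} (hM : Martingale M 𝓕 μ) {a b : ℝ} (hab : a < b) :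
    ∀ᵐ ω ∂μ, ∃ m, ∀ r e, ¬ HasUpcrossings (fun t => M t ω) a b m r e := by
  let U : ℕ → Ω → ℕ := fun n => upcrossingsBefore a b (fun k => M (grid n k)) (2 ^ n + 1)
  let A : ℕ → ℕ → Set Ω := fun m n => {ω | m ≤ U n ω}
  -- One index past the end of the grid is clamped to the terminal time by the projection in `grid`.
  have hgl : ∀ n, (grid n (2 ^ n + 1) : Time T) = ⊤ := fun n =>
    top_le_iff.1 ((grid_last n).symm.le.trans (grid_mono n (Nat.le_succ _)))
  have hA : ∀ m n : ℕ, m * μ (A m n) ≤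
      ENNReal.ofReal ((∫ ω, (M ⊤ ω - a)⁺ ∂μ) / (b - a)) := by
    intro m n
    have h1 := (hM.sampleGrid n).submartingale.mul_integral_upcrossingsBefore_le_integral_pos_part
      a b (2 ^ n + 1)
    rw [hgl] at h1
    have hint : Integrable (fun ω => (U n ω : ℝ)) μ :=
      (hM.sampleGrid n).1.integrable_upcrossingsBefore hab
    have h2 := mul_meas_ge_le_integral_of_nonneg (ae_of_all μ fun ω => (Nat.cast_nonneg (U n ω)))
      hint (m : ℝ)
    have h3 : {ω | (m : ℝ) ≤ (U n ω : ℝ)} = A m n := by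
      ext ω; simp [A]
    rw [h3] at h2
    have h4 : (m : ℝ≥0∞) * μ (A m n) = ENNReal.ofReal (m * μ.real (A m n)) := by
      rw [ENNReal.ofReal_mul (Nat.cast_nonneg m), ENNReal.ofReal_natCast, ofReal_measureReal]
    rw [h4]
    refine ENNReal.ofReal_le_ofReal (h2.trans ?_)
    rw [le_div_iff₀ (sub_pos.2 hab), mul_comm]
    exact h1
  have h0 := measure_forall_eventually_eq_zero ENNReal.ofReal_ne_top hA
  rw [ae_iff]
  refine measure_mono_null ?_ h0
  intro ω hω m
  simp only [Set.mem_ofPred_eq, not_exists, not_forall, not_not] at hω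
  obtain ⟨r, e, h⟩ := hω m
  obtain ⟨n₀, h⟩ := h.le_upcrossingsBefore (M := M) (ω := ω) (fun t => rfl) hab
  filter_upwards [eventually_ge_atTop n₀] with n hn
  obtain ⟨K, hK, -, hm⟩ := h n hn
  exact hm.trans (upcrossingsBefore_mono hab (Nat.succ_le_succ hK) ω)

lemma ae_isTame {M : Time T → Ω → ℝ} (hM : Martingale M 𝓕 μ) :
    ∀ᵐ ω ∂μ, IsTame (fun t => M t ω) := by
  have h1 : ∀ᵐ ω ∂μ, ∀ a b : ℚ, a < b →
      ∃ m, ∀ r e, ¬ HasUpcrossings (fun t => M t ω) a b m r e := by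
    rw [ae_all_iff]; intro a
    rw [ae_all_iff]; intro b
    by_cases hab : a < b
    · filter_upwards [ae_upcrossings_dyadic hM (a := a) (b := b) (by exact_mod_cast hab)] with ω hω _
      exact hω
    · exact ae_of_all _ fun ω h => absurd h hab
  filter_upwards [ae_bounded_dyadic hM, h1] with ω h1 h2 using ⟨h1, h2⟩

lemma IsCompleteFiltration.measurableSet_of_ae_eq (h : IsCompleteFiltration 𝓕 μ) (t : Time T)
    {s s' : Set Ω} (hs : MeasurableSet[𝓕 t] s) (hss' : s =ᵐ[μ] s') : MeasurableSet[𝓕 t] s' := by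
  have h0 : ∀ u : Set Ω, μ u = 0 → MeasurableSet[𝓕 t] u := fun u hu => 𝓕.mono bot_le _ (h u hu)
  have h1 := h0 _ (ae_le_set.1 hss'.le)
  have h2 := h0 _ (ae_le_set.1 hss'.symm.le)
  have : s' = (s \ (s \ s')) ∪ (s' \ s) := by
    ext x; by_cases x ∈ s <;> by_cases x ∈ s' <;> simp [*]
  rw [this]
  exact (hs.diff h1).union h2

lemma IsCompleteFiltration.stronglyMeasurable_of_ae_eq (h : IsCompleteFiltration 𝓕 μ) (t : Time T)
    {f g : Ω → ℝ} (hf : StronglyMeasurable[𝓕 t] f) (hfg : f =ᵐ[μ] g) :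
    StronglyMeasurable[𝓕 t] g := by
  have hm : Measurable[𝓕 t] g := by
    intro s hs
    refine h.measurableSet_of_ae_eq t (hf.measurable hs) ?_
    filter_upwards [hfg] with ω hω
    exact propext (by
      change f ω ∈ s ↔ g ω ∈ s
      rw [hω])
  exact hm.stronglyMeasurable

lemma stronglyMeasurable_of_forall_gt [𝓕.IsRightContinuous] {t : Time T} (ht : t < ⊤) {f : Ω → ℝ}
    (h : ∀ u, t < u → StronglyMeasurable[𝓕 u] f) : StronglyMeasurable[𝓕 t] f := by
  have hm : Measurable[𝓕 t] f := by
    intro s hs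
    apply Filtration.IsRightContinuous.measurableSet
    have h1 : ¬ IsMax t := not_isMax_iff.2 ⟨⊤, ht⟩
    rw [Filtration.rightCont_eq_of_not_isMax _ h1]
    simp only [MeasurableSpace.measurableSet_iInf]
    exact fun u hu => (h u hu).measurable hs
  exact hm.stronglyMeasurable

/-- Along dyadic times decreasing to `t` the martingale converges almost surely and, by uniform
integrability, in `L¹`. The limit therefore integrates like `ξ` over sets of `𝓕 t`; it is `𝓕
t`-measurable by right continuity and completeness of the filtration. -/
lemma rightReg_ae_eq [𝓕.IsRightContinuous] (h𝓕 : IsCompleteFiltration 𝓕 μ) {ξ : Ω → ℝ}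
    (hξ : Integrable ξ μ) (t : Time T) :
    (fun ω => rightReg (fun s => (μ[ξ|𝓕 s]) ω) t) =ᵐ[μ] μ[ξ|𝓕 t] := by
  rcases eq_or_lt_of_le (le_top : t ≤ ⊤) with rfl | ht
  · simp [rightReg]
  set M : Time T → Ω → ℝ := fun s => μ[ξ|𝓕 s]
  have hM : Martingale M 𝓕 μ := martingale_condExp ξ 𝓕 μ
  haveI := dyadicGT_neBot ht
  haveI : (dyadicGT t).IsCountablyGenerated := by unfold dyadicGT; infer_instance
  obtain ⟨d, hd⟩ := exists_seq_tendsto (dyadicGT t)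
  set g : Ω → ℝ := fun ω => rightReg (fun s => M s ω) t
  have hlim : ∀ᵐ ω ∂μ, Tendsto (fun n => M (d n) ω) atTop (𝓝 (g ω)) := by
    filter_upwards [ae_isTame hM] with ω hω
    exact (hω.tendsto_rightReg ht).comp hd
  have hgt : ∀ u, t < u → ∀ᶠ n in atTop, t < d n ∧ d n < u := by
    intro u hu
    filter_upwards [hd.eventually (mem_dyadicGT hu)] with n hn using hn.2
  have hgm : StronglyMeasurable[𝓕 t] g := by
    refine stronglyMeasurable_of_forall_gt ht fun u hu => ?_
    obtain ⟨n₀, hn₀⟩ := eventually_atTop.1 (hgt u hu)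
    -- The convergence set has full measure, so completeness puts it in every `𝓕 u`. On it `g` is a
    -- limit of `𝓕 u`-measurable variables.
    set G : Set Ω := {ω | Tendsto (fun n => M (d n) ω) atTop (𝓝 (g ω))}
    have hG : MeasurableSet[𝓕 u] G := by
      refine MeasurableSet.of_compl (𝓕.mono bot_le _ (h𝓕 _ ?_))
      exact hlim
    have h1 : StronglyMeasurable[𝓕 u] (G.indicator g) := by
      refine stronglyMeasurable_of_tendsto (m := 𝓕 u) atTop
        (f := fun n => G.indicator (M (d (n + n₀)))) (fun n => ?_) ?_
      · exact ((hM.1 _).mono (𝓕.mono (hn₀ _ (Nat.le_add_left _ _)).2.le)).indicator hG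
      · rw [tendsto_pi_nhds]
        intro ω
        by_cases hω : ω ∈ G
        · simp only [Set.indicator_of_mem hω]
          exact Tendsto.comp (hω : Tendsto (fun n => M (d n) ω) atTop (𝓝 (g ω)))
            (tendsto_add_atTop_nat n₀)
        · simp [Set.indicator_of_notMem hω]
    refine h𝓕.stronglyMeasurable_of_ae_eq u h1 ?_
    filter_upwards [hlim] with ω hω
    exact Set.indicator_of_mem (show ω ∈ G from hω) g
  have hui : UniformIntegrable (fun n => M (d n)) 1 μ :=
    hξ.uniformIntegrable_condExp fun n => 𝓕.le (d n)
  have hgi : MemLp g 1 μ := hui.memLp_of_ae_tendsto hlim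
  have hL1 := tendsto_Lp_finite_of_tendsto_ae le_rfl ENNReal.one_ne_top
    (fun n => hui.1 n) hgi hui.2.1 hlim
  refine ae_eq_condExp_of_forall_setIntegral_eq (𝓕.le t) hξ
    (fun s _ _ => (memLp_one_iff_integrable.1 hgi).integrableOn) (fun s hs _ => ?_)
    hgm.aestronglyMeasurable
  have h1 : Tendsto (fun n => ∫ ω in s, M (d n) ω ∂μ) atTop (𝓝 (∫ ω in s, g ω ∂μ)) := by
    refine tendsto_setIntegral_of_L1' g hgi.1
      (Eventually.of_forall fun n => hM.integrable _) hL1 s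
  have h2 : ∀ᶠ n in atTop, ∫ ω in s, M (d n) ω ∂μ = ∫ ω in s, ξ ω ∂μ := by
    filter_upwards [hgt ⊤ ht] with n hn
    exact setIntegral_condExp (𝓕.le _) hξ (𝓕.mono hn.1.le _ hs)
  exact tendsto_nhds_unique (h1.congr' h2) tendsto_const_nhds

/-- Under the usual conditions, every square integrable random variable is closed by a square
integrable càdlàg martingale. -/
theorem exists_cadlag_martingale [𝓕.IsRightContinuous] (h𝓕 : IsCompleteFiltration 𝓕 μ) {ξ : Ω → ℝ}
    (hξ : MemLp ξ 2 μ) :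
    ∃ M : Time T → Ω → ℝ, IsSqIntMartingale 𝓕 μ M ∧ ∀ t, M t =ᵐ[μ] μ[ξ|𝓕 t] := by
  have hξi : Integrable ξ μ := hξ.integrable one_le_two
  have hae := rightReg_ae_eq h𝓕 hξi
  have hM : Martingale (fun s => μ[ξ|𝓕 s]) 𝓕 μ := martingale_condExp ξ 𝓕 μ
  refine ⟨fun t ω => rightReg (fun s => (μ[ξ|𝓕 s]) ω) t, ⟨⟨fun t => ?_, fun s t hst => ?_⟩,
    fun t => ?_, ?_⟩, hae⟩
  · exact h𝓕.stronglyMeasurable_of_ae_eq t stronglyMeasurable_condExp (hae t).symm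
  · exact ((condExp_congr_ae (hae t)).trans (hM.2 s t hst)).trans (hae s).symm
  · exact (MemLp.condExp one_le_two hξ).ae_eq (hae t).symm
  · filter_upwards [ae_isTame hM] with ω hω using hω.isCadlag

end RegularizationMartingale

/-! ### Càdlàg adapted processes and square integrable martingales. -/

section CadlagAdapted

variable {T : ℝ} [hT : Fact (0 < T)] {Ω : Type*} [mΩ : MeasurableSpace Ω]
  {μ : Measure Ω} [IsProbabilityMeasure μ] {𝓕 : Filtration (Time T) mΩ}

/-! ### Càdlàg paths -/

lemma isCadlag_of_continuous {f : Time T → ℝ} (hf : Continuous f) : IsCadlag f := fun t =>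
  ⟨hf.continuousWithinAt, f t, hf.continuousWithinAt⟩

lemma IsCadlag.add {f g : Time T → ℝ} (hf : IsCadlag f) (hg : IsCadlag g) :
    IsCadlag fun t => f t + g t := fun t => by
  obtain ⟨a, ha⟩ := (hf t).2
  obtain ⟨b, hb⟩ := (hg t).2
  exact ⟨(hf t).1.add (hg t).1, a + b, ha.add hb⟩

lemma IsCadlag.mul {f g : Time T → ℝ} (hf : IsCadlag f) (hg : IsCadlag g) :
    IsCadlag fun t => f t * g t := fun t => by
  obtain ⟨a, ha⟩ := (hf t).2
  obtain ⟨b, hb⟩ := (hg t).2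
  exact ⟨(hf t).1.mul (hg t).1, a * b, ha.mul hb⟩

lemma IsCadlag.sub {f g : Time T → ℝ} (hf : IsCadlag f) (hg : IsCadlag g) :
    IsCadlag fun t => f t - g t := fun t => by
  obtain ⟨a, ha⟩ := (hf t).2
  obtain ⟨b, hb⟩ := (hg t).2
  exact ⟨(hf t).1.sub (hg t).1, a - b, ha.sub hb⟩

/-- A grid point slightly to the right of `s`. -/
noncomputable def gridIndex (T : ℝ) (n : ℕ) (s : Time T) : ℕ := ⌊(s : ℝ) * 2 ^ n / T⌋₊ + 1

lemma le_grid_gridIndex (n : ℕ) (s : Time T) : s ≤ grid n (gridIndex T n s) := by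
  have hT' := hT.out
  have h1 : (s : ℝ) * 2 ^ n / T < gridIndex T n s := by
    rw [gridIndex]; push_cast; exact Nat.lt_floor_add_one _
  have h2 : (s : ℝ) ≤ T * (gridIndex T n s / 2 ^ n) := by
    rw [div_lt_iff₀ hT'] at h1
    rw [mul_div_assoc', le_div_iff₀ (by positivity)]
    linarith
  calc s = Set.projIcc 0 T hT.out.le s := (Set.projIcc_val hT.out.le s).symm
    _ ≤ _ := Set.monotone_projIcc _ h2

lemma tendsto_grid_gridIndex (s : Time T) :
    Tendsto (fun n => (grid n (gridIndex T n s) : Time T)) atTop (𝓝 s) := by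
  have hT' := hT.out
  have h0 : ∀ n : ℕ, 0 ≤ (s : ℝ) * 2 ^ n / T := fun n => by have := s.2.1; positivity
  have h1 : Tendsto (fun n : ℕ => T * ((gridIndex T n s : ℝ) / 2 ^ n)) atTop (𝓝 (s : ℝ)) := by
    have h2 : Tendsto (fun n : ℕ => (s : ℝ) + T * (1 / 2) ^ n) atTop (𝓝 ((s : ℝ) + T * 0)) :=
      tendsto_const_nhds.add (tendsto_const_nhds.mul
        (tendsto_pow_atTop_nhds_zero_of_lt_one (by norm_num) (by norm_num)))
    rw [mul_zero, add_zero] at h2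
    refine tendsto_of_tendsto_of_tendsto_of_le_of_le tendsto_const_nhds h2 (fun n => ?_) fun n => ?_
    · have h1 : (s : ℝ) * 2 ^ n / T < gridIndex T n s := by
        rw [gridIndex]; push_cast; exact Nat.lt_floor_add_one _
      rw [div_lt_iff₀ hT'] at h1
      show (s : ℝ) ≤ T * ((gridIndex T n s : ℝ) / 2 ^ n)
      rw [mul_div_assoc', le_div_iff₀ (by positivity)]
      linarith
    · have h2 : (gridIndex T n s : ℝ) ≤ (s : ℝ) * 2 ^ n / T + 1 := by
        rw [gridIndex]; push_cast; linarith [Nat.floor_le (h0 n)]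
      have : T * (gridIndex T n s / 2 ^ n) ≤ T * (((s : ℝ) * 2 ^ n / T + 1) / 2 ^ n) := by gcongr
      refine this.trans (le_of_eq ?_)
      rw [one_div, inv_pow]
      field_simp
  have h3 := ((continuous_projIcc (h := hT.out.le)).tendsto (s : ℝ)).comp h1
  rw [Set.projIcc_val] at h3
  exact h3

/-- Approximation by processes constant in time on grid cells, sampled at the next grid point.
Capping that point at `t₀` keeps the samples `𝓕 t₀`-measurable while still approaching from the
right. -/
lemma isStronglyProgressive_of_rightCont {X : Time T → Ω → ℝ} (hX : StronglyAdapted 𝓕 X)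
    (hc : ∀ ω t, ContinuousWithinAt (fun t => X t ω) (Set.Ici t) t) :
    IsStronglyProgressive 𝓕 X := by
  intro t₀
  letI : MeasurableSpace Ω := 𝓕 t₀
  have h1 : ∀ n, StronglyMeasurable fun p : Set.Iic t₀ × Ω =>
      X (min t₀ (grid n (gridIndex T n p.1))) p.2 := by
    intro n
    have h2 : Measurable fun q : ℕ × Ω => X (min t₀ (grid n q.1)) q.2 :=
      measurable_from_prod_countable_right fun k =>
        ((hX (min t₀ (grid n k))).mono (𝓕.mono (min_le_left _ _))).measurable
    have h3 : Measurable fun s : Time T => gridIndex T n s := by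
      unfold gridIndex
      fun_prop
    have h4 : Measurable fun p : Set.Iic t₀ × Ω => (gridIndex T n p.1, p.2) :=
      (h3.comp (measurable_subtype_coe.comp measurable_fst)).prodMk measurable_snd
    exact (h2.comp h4).stronglyMeasurable
  refine stronglyMeasurable_of_tendsto atTop h1 ?_
  rw [tendsto_pi_nhds]
  rintro ⟨⟨s, hs⟩, ω⟩
  refine Tendsto.comp (hc ω s) ?_
  refine tendsto_nhdsWithin_iff.2 ⟨?_, Eventually.of_forall fun n => ?_⟩
  · have := tendsto_const_nhds (x := t₀) (f := atTop (α := ℕ)) |>.min (tendsto_grid_gridIndex s)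
    rwa [min_eq_right (show s ≤ t₀ from hs)] at this
  · exact le_min hs (le_grid_gridIndex n s)

/-! ### Càdlàg adapted processes -/

namespace IsCadlagAdapted

variable {X Y : Time T → Ω → ℝ}

/-- Paths are càdlàg only almost surely; the exceptional null set is in `𝓕 ⊥` by completeness, so
the process may be set to zero there without losing adaptedness. -/
lemma exists_modification (h𝓕 : IsCompleteFiltration 𝓕 μ) (hX : IsCadlagAdapted 𝓕 μ X) :
    ∃ X' : Time T → Ω → ℝ, IsStronglyProgressive 𝓕 X' ∧ (∀ ω, IsCadlag fun t => X' t ω) ∧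
      ∀ᵐ ω ∂μ, ∀ t, X t ω = X' t ω := by
  set G : Set Ω := {ω | IsCadlag fun t => X t ω}
  have hG : MeasurableSet[𝓕 ⊥] G := MeasurableSet.of_compl (h𝓕 _ hX.cadlag)
  have hc : ∀ ω, IsCadlag fun t => G.indicator (X t) ω := by
    intro ω
    by_cases hω : ω ∈ G
    · have hω' : IsCadlag fun t => X t ω := hω
      simpa only [Set.indicator_of_mem hω] using hω'
    · simpa only [Set.indicator_of_notMem hω] using isCadlag_of_continuous continuous_const
  refine ⟨fun t => G.indicator (X t), isStronglyProgressive_of_rightCont (fun t => ?_)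
    (fun ω t => (hc ω t).1), hc, ?_⟩
  · exact (hX.adapted t).indicator (𝓕.mono bot_le _ hG)
  · filter_upwards [hX.cadlag] with ω hω t
    exact (Set.indicator_of_mem (show ω ∈ G from hω) (X t)).symm

lemma aestronglyMeasurable (h𝓕 : IsCompleteFiltration 𝓕 μ) (hX : IsCadlagAdapted 𝓕 μ X) :
    AEStronglyMeasurable (fun z : Time T × Ω => X z.1 z.2)
      ((volume : Measure (Time T)).prod μ) := by
  obtain ⟨X', h1, -, h2⟩ := hX.exists_modification h𝓕
  refine (stronglyMeasurable_of_progressive h1).aestronglyMeasurable.congr ?_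
  filter_upwards [ae_prod_of_ae_forall h2] with z hz using hz.symm

lemma congr (h𝓕 : IsCompleteFiltration 𝓕 μ) (hX : IsCadlagAdapted 𝓕 μ X)
    (h : ∀ᵐ ω ∂μ, ∀ t, X t ω = Y t ω) : IsCadlagAdapted 𝓕 μ Y where
  adapted t := h𝓕.stronglyMeasurable_of_ae_eq t (hX.adapted t) (by
    filter_upwards [h] with ω hω using hω t)
  cadlag := by
    filter_upwards [h, hX.cadlag] with ω h1 h2
    rwa [← funext h1]

lemma add (hX : IsCadlagAdapted 𝓕 μ X) (hY : IsCadlagAdapted 𝓕 μ Y) :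
    IsCadlagAdapted 𝓕 μ fun t ω => X t ω + Y t ω where
  adapted t := (hX.adapted t).add (hY.adapted t)
  cadlag := by filter_upwards [hX.cadlag, hY.cadlag] with ω h1 h2 using h1.add h2

lemma sub (hX : IsCadlagAdapted 𝓕 μ X) (hY : IsCadlagAdapted 𝓕 μ Y) :
    IsCadlagAdapted 𝓕 μ fun t ω => X t ω - Y t ω where
  adapted t := (hX.adapted t).sub (hY.adapted t)
  cadlag := by filter_upwards [hX.cadlag, hY.cadlag] with ω h1 h2 using h1.sub h2

lemma continuous_mul (hX : IsCadlagAdapted 𝓕 μ X) {g : Time T → ℝ} (hg : Continuous g) :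
    IsCadlagAdapted 𝓕 μ fun t ω => g t * X t ω where
  adapted t := (hX.adapted t).const_mul (g t)
  cadlag := by filter_upwards [hX.cadlag] with ω h1 using (isCadlag_of_continuous hg).mul h1

lemma const_mul (hX : IsCadlagAdapted 𝓕 μ X) (a : ℝ) :
    IsCadlagAdapted 𝓕 μ fun t ω => a * X t ω := hX.continuous_mul continuous_const

lemma of_continuous {g : Time T → ℝ} (hg : Continuous g) :
    IsCadlagAdapted 𝓕 μ fun t (_ : Ω) => g t where
  adapted _ := stronglyMeasurable_const
  cadlag := ae_of_all _ fun _ => isCadlag_of_continuous hg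

end IsCadlagAdapted

lemma IsAdmissible.cadlagAdapted_volt {v : Time T → Ω → ℝ} (hv : IsAdmissible 𝓕 μ v) (a : ℝ) :
    IsCadlagAdapted 𝓕 μ fun t ω => PriceImpactGame.volt a (fun s => v s ω) t where
  adapted := (progressive_volt hv.1 a).stronglyAdapted
  cadlag := by
    filter_upwards [hv.sqInt.ae_integrable] with ω hω
    exact isCadlag_of_continuous (continuous_volt hω a)

lemma IsCadlagAdapted.exists_admissible (h𝓕 : IsCompleteFiltration 𝓕 μ) {X : Time T → Ω → ℝ}
    (hX : IsCadlagAdapted 𝓕 μ X) (h : SqInt μ X) :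
    ∃ X' : Time T → Ω → ℝ, IsAdmissible 𝓕 μ X' ∧ IsCadlagAdapted 𝓕 μ X' ∧
      ∀ᵐ ω ∂μ, ∀ t, X t ω = X' t ω := by
  obtain ⟨X', h1, h2, h3⟩ := hX.exists_modification h𝓕
  exact ⟨X', isAdmissible_iff.2 ⟨h1, h.congr (ae_prod_of_ae_forall h3)⟩, hX.congr h𝓕 h3, h3⟩

lemma IsCadlagAdapted.volt (h𝓕 : IsCompleteFiltration 𝓕 μ) {X : Time T → Ω → ℝ}
    (hX : IsCadlagAdapted 𝓕 μ X) (h : SqInt μ X) (a : ℝ) :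
    IsCadlagAdapted 𝓕 μ fun t ω => PriceImpactGame.volt a (fun s => X s ω) t := by
  obtain ⟨X', h1, -, h3⟩ := hX.exists_admissible h𝓕 h
  refine (h1.cadlagAdapted_volt a).congr h𝓕 ?_
  filter_upwards [h3] with ω hω t
  simp only [hω]

lemma IsCadlagAdapted.memLp_volt_zero (h𝓕 : IsCompleteFiltration 𝓕 μ) {X : Time T → Ω → ℝ}
    (hX : IsCadlagAdapted 𝓕 μ X) (h : SqInt μ X) (t : Time T) :
    MemLp (fun ω => PriceImpactGame.volt 0 (fun s => X s ω) t) 2 μ := by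
  refine h.memLp_integral_abs.mono
    (((hX.volt h𝓕 h 0).adapted t).mono (𝓕.le t)).aestronglyMeasurable ?_
  filter_upwards [h.ae_integrable] with ω hω
  exact (abs_volt_le le_rfl hω t).trans (le_abs_self _)

lemma sqInt_of_eLpNorm_le {v : Time T → Ω → ℝ}
    (hm : AEStronglyMeasurable (fun z : Time T × Ω => v z.1 z.2)
      ((volume : Measure (Time T)).prod μ)) {C : ℝ≥0∞} (hC : C ≠ ∞)
    (h : ∀ t, ∫⁻ ω, ‖v t ω‖ₑ ^ 2 ∂μ ≤ C) : SqInt μ v := by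
  refine ⟨hm, ?_⟩
  rw [eLpNorm_lt_top_iff_lintegral_rpow_enorm_lt_top two_ne_zero ENNReal.ofNat_ne_top]
  simp only [ENNReal.toReal_ofNat, ENNReal.rpow_ofNat]
  rw [lintegral_prod _ (hm.enorm.pow_const 2)]
  calc ∫⁻ t, ∫⁻ ω, ‖v t ω‖ₑ ^ 2 ∂μ ≤ ∫⁻ _ : Time T, C := lintegral_mono fun t => h t
    _ < ∞ := by
      rw [lintegral_const]
      exact ENNReal.mul_lt_top hC.lt_top (measure_lt_top _ _)

/-! ### Square integrable martingales -/

namespace IsSqIntMartingale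

variable {M M' : Time T → Ω → ℝ}

lemma cadlagAdapted (hM : IsSqIntMartingale 𝓕 μ M) : IsCadlagAdapted 𝓕 μ M :=
  ⟨hM.martingale.1, hM.cadlag⟩

/-- Conditional expectation contracts `L²`, so the second moments are bounded by that of `M_T`,
uniformly in time. -/
lemma sqInt (h𝓕 : IsCompleteFiltration 𝓕 μ) (hM : IsSqIntMartingale 𝓕 μ M) : SqInt μ M := by
  have key : ∀ f : Ω → ℝ, ∫⁻ ω, ‖f ω‖ₑ ^ 2 ∂μ = eLpNorm f 2 μ ^ 2 := fun f => by
    rw [eLpNorm_eq_lintegral_rpow_enorm_toReal two_ne_zero ENNReal.ofNat_ne_top]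
    simp only [ENNReal.toReal_ofNat, ENNReal.rpow_ofNat]
    rw [← ENNReal.rpow_natCast, ← ENNReal.rpow_mul]
    simp
  refine sqInt_of_eLpNorm_le (hM.cadlagAdapted.aestronglyMeasurable h𝓕)
    (C := eLpNorm (M ⊤) 2 μ ^ 2) (ENNReal.pow_ne_top (hM.sqIntegrable ⊤).2.ne) fun t => ?_
  rw [key]
  gcongr
  rw [← eLpNorm_congr_ae (hM.martingale.2 t ⊤ le_top)]
  exact eLpNorm_condExp_le_eLpNorm _ one_le_two

lemma add (hM : IsSqIntMartingale 𝓕 μ M) (hM' : IsSqIntMartingale 𝓕 μ M') :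
    IsSqIntMartingale 𝓕 μ fun t ω => M t ω + M' t ω where
  martingale := hM.martingale.add hM'.martingale
  sqIntegrable t := (hM.sqIntegrable t).add (hM'.sqIntegrable t)
  cadlag := (hM.cadlagAdapted.add hM'.cadlagAdapted).cadlag

lemma sub (hM : IsSqIntMartingale 𝓕 μ M) (hM' : IsSqIntMartingale 𝓕 μ M') :
    IsSqIntMartingale 𝓕 μ fun t ω => M t ω - M' t ω where
  martingale := hM.martingale.sub hM'.martingale
  sqIntegrable t := (hM.sqIntegrable t).sub (hM'.sqIntegrable t)
  cadlag := (hM.cadlagAdapted.sub hM'.cadlagAdapted).cadlag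

lemma const_mul (hM : IsSqIntMartingale 𝓕 μ M) (a : ℝ) :
    IsSqIntMartingale 𝓕 μ fun t ω => a * M t ω where
  martingale := hM.martingale.smul a
  sqIntegrable t := (hM.sqIntegrable t).const_mul a
  cadlag := (hM.cadlagAdapted.const_mul a).cadlag

lemma integral_mul_sub_top (hM : IsSqIntMartingale 𝓕 μ M) {t : Time T} {w : Ω → ℝ}
    (hw : StronglyMeasurable[𝓕 t] w) (hw2 : MemLp w 2 μ) :
    ∫ ω, w ω * (M t ω - M ⊤ ω) ∂μ = 0 := by
  have i1 : Integrable (fun ω => w ω * M t ω) μ := hw2.integrable_mul (hM.sqIntegrable t)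
  have i2 : Integrable (fun ω => w ω * M ⊤ ω) μ := hw2.integrable_mul (hM.sqIntegrable ⊤)
  have h1 : μ[fun ω => w ω * M ⊤ ω|𝓕 t] =ᵐ[μ] fun ω => w ω * M t ω := by
    have h2 := condExp_mul_of_stronglyMeasurable_left hw i2 (hM.martingale.integrable ⊤)
    filter_upwards [h2, hM.martingale.2 t ⊤ le_top] with ω h3 h4
    rw [← h4]; exact h3
  simp only [mul_sub]
  rw [integral_sub i1 i2, ← integral_congr_ae h1, integral_condExp (𝓕.le t), sub_self]

/-- The orthogonality on which the whole argument rests: at almost every fixed time the increment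
from `t` to `T` is orthogonal to `𝓕 t`, and Fubini integrates this over time. -/
lemma integral_test_eq_zero (h𝓕 : IsCompleteFiltration 𝓕 μ) (hM : IsSqIntMartingale 𝓕 μ M)
    {w : Time T → Ω → ℝ} (hw : IsAdmissible 𝓕 μ w) {g : Time T → ℝ} (hg : Continuous g) :
    ∫ z, w z.1 z.2 * (g z.1 * (M z.1 z.2 - M ⊤ z.2)) ∂((volume : Measure (Time T)).prod μ) = 0 := by
  have hD : SqInt μ fun t ω => g t * (M t ω - M ⊤ ω) :=
    SqInt.continuous_mul hg
      (MemLp.sub (hM.sqInt h𝓕) (SqInt.of_const (T := T) (hM.sqIntegrable ⊤)))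
  have hint := hw.sqInt.integrable_mul hD
  rw [integral_prod _ hint]
  have h2 : ∀ᵐ t : Time T, Integrable (fun ω => w t ω ^ 2) μ :=
    (MemLp.integrable_sq hw.sqInt).prod_right_ae
  have hzero : ∀ᵐ t : Time T, ∫ ω, w t ω * (g t * (M t ω - M ⊤ ω)) ∂μ = 0 := by
    filter_upwards [h2] with t ht
    have hwm : StronglyMeasurable[𝓕 t] (w t) := IsStronglyProgressive.stronglyAdapted hw.1 t
    have hw2 : MemLp (w t) 2 μ :=
      (memLp_two_iff_integrable_sq (hwm.mono (𝓕.le t)).aestronglyMeasurable).2 ht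
    have e : ∀ ω, w t ω * (g t * (M t ω - M ⊤ ω)) = g t * (w t ω * (M t ω - M ⊤ ω)) :=
      fun ω => by ring
    simp only [e]
    rw [integral_const_mul, hM.integral_mul_sub_top hwm hw2, mul_zero]
  rw [integral_congr_ae hzero]
  simp

end IsSqIntMartingale

end CadlagAdapted

/-! ### Integrating exponentials against martingales. -/

section Transform

variable {T : ℝ} [hT : Fact (0 < T)] {Ω : Type*} [mΩ : MeasurableSpace Ω]
  {μ : Measure Ω} [IsProbabilityMeasure μ] {𝓕 : Filtration (Time T) mΩ}

lemma isAdmissible_indicator_Ioc {s t : Time T} {A : Set Ω} (hA : MeasurableSet[𝓕 s] A) :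
    IsAdmissible 𝓕 μ fun r ω => (Set.Ioc s t ×ˢ A).indicator (fun _ => (1 : ℝ)) (r, ω) := by
  have hpred : IsStronglyPredictable 𝓕
      fun r ω => (Set.Ioc s t ×ˢ A).indicator (fun _ => (1 : ℝ)) (r, ω) := by
    have h := measurableSet_predictable_Ioc_prod (𝓕 := 𝓕) s t hA
    exact stronglyMeasurable_const.indicator h
  have hprog := hpred.isStronglyProgressive
  refine isAdmissible_iff.2 ⟨hprog, ?_⟩
  refine MemLp.of_bound (stronglyMeasurable_of_progressive hprog).aestronglyMeasurable 1
    (ae_of_all _ fun z => ?_)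
  simp only [Set.indicator]
  split_ifs <;> simp

/-- The stochastic integral `∫ e^{as} dM_s`, expressed through integration by parts. -/
noncomputable def expTransform (a : ℝ) (M : Time T → Ω → ℝ) (t : Time T) (ω : Ω) : ℝ :=
  Real.exp (a * t) * M t ω - ∫ s in Set.Iic t, a * Real.exp (a * s) * M s ω

/-- To integrate an increment of the transform over `A ∈ 𝓕 s`, the orthogonality relation is tested
with the strategy equal to one on `(s, t] × A`. What remains are boundary terms in `M_t - M_T` and
`M_s - M_T`, with zero integral over `A`. -/
lemma IsSqIntMartingale.expTransform (h𝓕 : IsCompleteFiltration 𝓕 μ) {M : Time T → Ω → ℝ}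
    (hM : IsSqIntMartingale 𝓕 μ M) (a : ℝ) : IsSqIntMartingale 𝓕 μ (expTransform a M) := by
  have hg : Continuous fun s : Time T => a * Real.exp (a * s) := by fun_prop
  have hS : SqInt μ fun s ω => a * Real.exp (a * (s : ℝ)) * M s ω :=
    SqInt.continuous_mul hg (hM.sqInt h𝓕)
  have hC : IsCadlagAdapted 𝓕 μ fun s ω => a * Real.exp (a * (s : ℝ)) * M s ω :=
    hM.cadlagAdapted.continuous_mul hg
  have hN : IsCadlagAdapted 𝓕 μ (PriceImpactGame.expTransform a M) := by
    have := (hM.cadlagAdapted.continuous_mul (g := fun s : Time T => Real.exp (a * s))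
      (by fun_prop)).sub (hC.volt h𝓕 hS 0)
    simp only [volt_zero] at this
    exact this
  have hL : ∀ t, MemLp (PriceImpactGame.expTransform a M t) 2 μ := by
    intro t
    have := ((hM.sqIntegrable t).const_mul (Real.exp (a * t))).sub (hC.memLp_volt_zero h𝓕 hS t)
    simp only [volt_zero] at this
    exact this
  refine ⟨⟨hN.adapted, fun s t hst => ?_⟩, hL, hN.cadlag⟩
  symm
  refine ae_eq_condExp_of_forall_setIntegral_eq (𝓕.le s) ((hL t).integrable one_le_two)
    (fun A _ _ => ((hL s).integrable one_le_two).integrableOn) (fun A hA _ => ?_)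
    (hN.adapted s).aestronglyMeasurable
  have hAm : MeasurableSet A := 𝓕.le s _ hA
  -- the increment of the integral term
  have htest := hM.integral_test_eq_zero h𝓕 (isAdmissible_indicator_Ioc (t := t) hA) hg
  have hD : SqInt μ fun r ω => a * Real.exp (a * (r : ℝ)) * (M r ω - M ⊤ ω) :=
    SqInt.continuous_mul hg
      (MemLp.sub (hM.sqInt h𝓕) (SqInt.of_const (T := T) (hM.sqIntegrable ⊤)))
  rw [SqInt.integral_eq (isAdmissible_indicator_Ioc (t := t) hA).sqInt hD] at htest
  have hdec : ∀ᵐ ω ∂μ, (∫ r : Time T, (Set.Ioc s t ×ˢ A).indicator (fun _ => (1 : ℝ)) (r, ω)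
        * (a * Real.exp (a * (r : ℝ)) * (M r ω - M ⊤ ω)))
      = A.indicator (fun ω => PriceImpactGame.expTransform a M s ω
          - PriceImpactGame.expTransform a M t ω
          + Real.exp (a * t) * (M t ω - M ⊤ ω) - Real.exp (a * s) * (M s ω - M ⊤ ω)) ω := by
    filter_upwards [(hM.sqInt h𝓕).ae_integrable] with ω hω
    by_cases hωA : ω ∈ A
    · rw [Set.indicator_of_mem hωA]
      have e1 : ∀ r : Time T, (Set.Ioc s t ×ˢ A).indicator (fun _ => (1 : ℝ)) (r, ω)
          * (a * Real.exp (a * (r : ℝ)) * (M r ω - M ⊤ ω))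
          = (Set.Ioc s t).indicator
            (fun r : Time T => a * Real.exp (a * (r : ℝ)) * M r ω
              - a * Real.exp (a * (r : ℝ)) * M ⊤ ω) r := by
        intro r
        by_cases hr : r ∈ Set.Ioc s t
        · rw [Set.indicator_of_mem hr, Set.indicator_of_mem (Set.mk_mem_prod hr hωA)]
          ring
        · rw [Set.indicator_of_notMem hr, Set.indicator_of_notMem (fun h => hr h.1)]
          ring
      simp only [e1]
      rw [integral_indicator measurableSet_Ioc]
      have i1 : Integrable fun r : Time T => a * Real.exp (a * (r : ℝ)) * M r ω :=
        integrable_continuous_mul hω hg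
      have i2 : Integrable fun r : Time T => a * Real.exp (a * (r : ℝ)) :=
        integrable_of_continuous hg
      have hI : ∀ f : Time T → ℝ, Integrable f →
          ∫ r in Set.Ioc s t, f r = (∫ r in Set.Iic t, f r) - ∫ r in Set.Iic s, f r := by
        intro f hf
        have hu : Set.Iic t = Set.Iic s ∪ Set.Ioc s t := (Set.Iic_union_Ioc_eq_Iic hst).symm
        rw [hu, setIntegral_union (Set.Iic_disjoint_Ioc le_rfl) measurableSet_Ioc
          hf.integrableOn hf.integrableOn]
        ring
      rw [integral_sub i1.integrableOn (i2.mul_const _).integrableOn, integral_mul_const,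
        hI _ i1, hI _ i2, primitive_exp, primitive_exp, PriceImpactGame.expTransform,
        PriceImpactGame.expTransform]
      ring
    · rw [Set.indicator_of_notMem hωA]
      have e1 : ∀ r : Time T, (Set.Ioc s t ×ˢ A).indicator (fun _ => (1 : ℝ)) (r, ω) = 0 :=
        fun r => Set.indicator_of_notMem (fun h => hωA h.2) _
      simp [e1]
  rw [integral_congr_ae hdec, integral_indicator hAm] at htest
  have hz : ∀ r, s ≤ r → ∫ ω in A, (M r ω - M ⊤ ω) ∂μ = 0 := by
    intro r hr
    have := hM.integral_mul_sub_top (t := r) (w := A.indicator fun _ => (1 : ℝ))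
      ((stronglyMeasurable_const (β := ℝ)).indicator (𝓕.mono hr _ hA))
      ((memLp_const (1 : ℝ)).indicator hAm)
    rw [← integral_indicator hAm]
    refine Eq.trans (integral_congr_ae (ae_of_all _ fun ω => ?_)) this
    by_cases hω : ω ∈ A <;> simp [hω]
  have iN : ∀ r, IntegrableOn (PriceImpactGame.expTransform a M r) A μ := fun r =>
    ((hL r).integrable one_le_two).integrableOn
  have iM : ∀ r, IntegrableOn (fun ω => M r ω - M ⊤ ω) A μ := fun r =>
    ((hM.martingale.integrable r).sub (hM.martingale.integrable ⊤)).integrableOn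
  have i3 : IntegrableOn (fun ω => PriceImpactGame.expTransform a M s ω
      - PriceImpactGame.expTransform a M t ω) A μ := (iN s).sub (iN t)
  have i4 : IntegrableOn (fun ω => PriceImpactGame.expTransform a M s ω
      - PriceImpactGame.expTransform a M t ω + Real.exp (a * t) * (M t ω - M ⊤ ω)) A μ :=
    i3.add ((iM t).const_mul _)
  rw [integral_sub i4 ((iM s).const_mul _), integral_add i3 ((iM t).const_mul _),
    integral_sub (iN s) (iN t), integral_const_mul, integral_const_mul, hz t hst,
    hz s le_rfl] at htest
  linarith

end Transform

/-! ### Second moment bounds for the price process. -/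

section PriceProcess

variable {T : ℝ} [hT : Fact (0 < T)] {Ω : Type*} [mΩ : MeasurableSpace Ω]
  {μ : Measure Ω} [IsProbabilityMeasure μ] {𝓕 : Filtration (Time T) mΩ}

/-- The consequences of the `ℋ²` condition that matter for the game. -/
structure IsSqIntPrice (𝓕 : Filtration (Time T) mΩ) (μ : Measure Ω) (P : Time T → Ω → ℝ) :
    Prop where
  cadlagAdapted : IsCadlagAdapted 𝓕 μ P
  sqInt : SqInt μ P
  memLp_top : MemLp (P ⊤) 2 μ

/-- `WithTop` adds a point above the terminal time, and this point is isolated because the times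
already have a greatest element. On almost every path a localizing sequence is thus eventually
inactive. -/
lemma eventually_eq_top_of_tendsto {τ : ℕ → WithTop (Time T)} (h : Tendsto τ atTop (𝓝 ⊤)) :
    ∀ᶠ n in atTop, τ n = ⊤ := by
  have : Set.Ioi (((⊤ : Time T) : WithTop (Time T))) ∈ 𝓝 (⊤ : WithTop (Time T)) :=
    Ioi_mem_nhds (WithTop.coe_lt_top _)
  filter_upwards [h this] with n hn
  by_contra hne
  obtain ⟨x, hx⟩ := WithTop.ne_top_iff_exists.1 hne
  rw [Set.mem_preimage, ← hx, Set.mem_Ioi, WithTop.coe_lt_coe] at hn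
  exact absurd hn (not_lt.2 le_top)

lemma untopA_coe_time (t : Time T) : (t : WithTop (Time T)).untopA = t := by
  simp [WithTop.untopA]

/-- For each stopped pair the martingale property of the square minus the bracket gives the bound,
since the stopped bracket lies between zero and `V_T`. Fatou's lemma removes the localization. -/
lemma IsQuadVar.lintegral_sq_le {L V : Time T → Ω → ℝ} (h : IsQuadVar 𝓕 μ L V)
    (t : Time T) :
    ∫⁻ ω, ‖L t ω‖ₑ ^ 2 ∂μ ≤ ∫⁻ ω, ‖L ⊥ ω‖ₑ ^ 2 ∂μ + ∫⁻ ω, ENNReal.ofReal (V ⊤ ω) ∂μ := by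
  obtain ⟨τ, hτ, hn⟩ := h.localMartingale
  set W : ℕ → Time T → Ω → ℝ × ℝ := fun n =>
    stoppedProcess (fun i => {ω | ⊥ < τ n ω}.indicator fun ω => (L i ω, V i ω)) (τ n)
  have hsq : ∀ x : ℝ, ‖x‖ₑ ^ 2 = ENNReal.ofReal (x ^ 2) := fun x => by
    rw [← sq_abs, ENNReal.ofReal_pow (abs_nonneg x), ← Real.norm_eq_abs, ofReal_norm]
  have hWbot : ∀ n ω, W n ⊥ ω = {ω | ⊥ < τ n ω}.indicator (fun ω => (L ⊥ ω, V ⊥ ω)) ω := by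
    intro n ω
    have : (min ((⊥ : Time T) : WithTop (Time T)) (τ n ω)) = ((⊥ : Time T) : WithTop (Time T)) :=
      min_eq_left (by rw [WithTop.coe_bot]; exact bot_le)
    simp only [W, stoppedProcess, this, untopA_coe_time]
  have hW2 : ∀ᵐ ω ∂μ, ∀ n r, 0 ≤ (W n r ω).2 ∧ (W n r ω).2 ≤ V ⊤ ω := by
    filter_upwards [h.init, h.mono] with ω h0 hm n r
    have hV : ∀ s, 0 ≤ V s ω := fun s => h0.symm.le.trans (hm bot_le)
    by_cases hω : ω ∈ {ω | ⊥ < τ n ω}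
    · simp only [W, stoppedProcess, Set.indicator_of_mem hω]
      exact ⟨hV _, hm le_top⟩
    · simp only [W, stoppedProcess, Set.indicator_of_notMem hω]
      exact ⟨le_rfl, hV _⟩
  have hbound : ∀ n, ∫⁻ ω, ‖(W n t ω).1‖ₑ ^ 2 ∂μ
      ≤ ∫⁻ ω, ‖L ⊥ ω‖ₑ ^ 2 ∂μ + ∫⁻ ω, ENNReal.ofReal (V ⊤ ω) ∂μ := by
    intro n
    obtain ⟨h1, h2⟩ := hn n
    have i1 : ∀ r, Integrable (fun ω => (W n r ω).1 ^ 2) μ := fun r =>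
      (h1.sqIntegrable r).integrable_sq
    have i2 : ∀ r, Integrable (fun ω => (W n r ω).2) μ := fun r => by
      have := (i1 r).sub (h2.integrable r)
      refine this.congr (ae_of_all _ fun ω => ?_)
      simp only [Pi.sub_apply]
      exact sub_sub_cancel _ _
    have e1 : ∫ ω, ((W n t ω).1 ^ 2 - (W n t ω).2) ∂μ
        = ∫ ω, ((W n ⊥ ω).1 ^ 2 - (W n ⊥ ω).2) ∂μ := by
      have := h2.setIntegral_eq (bot_le : ⊥ ≤ t) (s := Set.univ) MeasurableSet.univ
      simp only [setIntegral_univ] at this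
      exact this.symm
    rw [integral_sub (i1 t) (i2 t), integral_sub (i1 ⊥) (i2 ⊥)] at e1
    have e2 : 0 ≤ ∫ ω, (W n ⊥ ω).2 ∂μ := integral_nonneg_of_ae (by
      filter_upwards [hW2] with ω hω using (hω n ⊥).1)
    have e3 : ENNReal.ofReal (∫ ω, (W n t ω).2 ∂μ) ≤ ∫⁻ ω, ENNReal.ofReal (V ⊤ ω) ∂μ := by
      rw [ofReal_integral_eq_lintegral_ofReal (i2 t) (by
        filter_upwards [hW2] with ω hω using (hω n t).1)]
      refine lintegral_mono_ae ?_
      filter_upwards [hW2] with ω hω using ENNReal.ofReal_le_ofReal (hω n t).2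
    have e4 : ENNReal.ofReal (∫ ω, (W n ⊥ ω).1 ^ 2 ∂μ) ≤ ∫⁻ ω, ‖L ⊥ ω‖ₑ ^ 2 ∂μ := by
      rw [ofReal_integral_eq_lintegral_ofReal (i1 ⊥) (ae_of_all _ fun ω => sq_nonneg _)]
      refine lintegral_mono fun ω => ?_
      simp only [hsq]
      refine ENNReal.ofReal_le_ofReal ?_
      rw [hWbot]
      by_cases hω : ω ∈ {ω | ⊥ < τ n ω}
      · simp only [Set.indicator_of_mem hω, le_refl]
      · simp only [Set.indicator_of_notMem hω, Prod.fst_zero]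
        simpa using sq_nonneg (L ⊥ ω)
    simp only [hsq] at e4 ⊢
    rw [← ofReal_integral_eq_lintegral_ofReal (i1 t) (ae_of_all _ fun ω => sq_nonneg _)]
    calc ENNReal.ofReal (∫ ω, (W n t ω).1 ^ 2 ∂μ)
        ≤ ENNReal.ofReal (∫ ω, (W n ⊥ ω).1 ^ 2 ∂μ + ∫ ω, (W n t ω).2 ∂μ) :=
          ENNReal.ofReal_le_ofReal (by linarith)
      _ ≤ _ := ENNReal.ofReal_add_le.trans (add_le_add e4 e3)
  calc ∫⁻ ω, ‖L t ω‖ₑ ^ 2 ∂μ ≤ ∫⁻ ω, liminf (fun n => ‖(W n t ω).1‖ₑ ^ 2) atTop ∂μ := by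
        refine lintegral_mono_ae ?_
        filter_upwards [hτ.tendsto_top] with ω hω
        have he : (fun n => ‖(W n t ω).1‖ₑ ^ 2) =ᶠ[atTop] fun _ => ‖L t ω‖ₑ ^ 2 := by
          filter_upwards [eventually_eq_top_of_tendsto hω] with n hn
          have hmem : ω ∈ {ω | ⊥ < τ n ω} := by
            rw [Set.mem_ofPred_eq, hn]
            exact bot_lt_top
          simp only [W, stoppedProcess, Set.indicator_of_mem hmem, hn, min_top_right,
            untopA_coe_time]
        rw [liminf_congr he, liminf_const]
    _ ≤ liminf (fun n => ∫⁻ ω, ‖(W n t ω).1‖ₑ ^ 2 ∂μ) atTop :=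
        lintegral_liminf_le' fun n => ((hn n).1.sqIntegrable t).1.enorm.pow_const 2
    _ ≤ _ := (liminf_le_liminf (Eventually.of_forall hbound)).trans (liminf_const _).le

theorem IsH2.isSqIntPrice (h𝓕 : IsCompleteFiltration 𝓕 μ) {P : Time T → Ω → ℝ}
    (hP : IsH2 𝓕 μ P) : IsSqIntPrice 𝓕 μ P := by
  obtain ⟨hP0, L, A, V, hPLA, hLV, hA, hA0, hAc, hfin⟩ := hP
  have hfin1 := (ENNReal.add_lt_top.1 hfin).1
  have hfin2 := (ENNReal.add_lt_top.1 hfin).2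
  have hL0 : MemLp (L ⊥) 2 μ := by
    refine hP0.ae_eq ?_
    filter_upwards [hPLA, hA0] with ω h1 h2
    rw [h1, h2, add_zero]
  have hAca : IsCadlagAdapted 𝓕 μ A := ⟨hA.stronglyAdapted, hAc⟩
  have hC0 : ∫⁻ ω, ‖L ⊥ ω‖ₑ ^ 2 ∂μ < ∞ := by
    have := (eLpNorm_lt_top_iff_lintegral_rpow_enorm_lt_top two_ne_zero ENNReal.ofNat_ne_top).1
      hL0.2
    simpa only [ENNReal.toReal_ofNat, ENNReal.rpow_ofNat] using this
  -- As `A` starts at zero, its total variation dominates `|A_t|` at every time.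
  have hAb : ∀ t, ∫⁻ ω, ‖A t ω‖ₑ ^ 2 ∂μ ≤
      ∫⁻ ω, (eVariationOn (fun t => A t ω) Set.univ) ^ 2 ∂μ := by
    intro t
    refine lintegral_mono_ae ?_
    filter_upwards [hA0] with ω hω
    gcongr
    have := eVariationOn.edist_le (fun t => A t ω) (Set.mem_univ t) (Set.mem_univ ⊥)
    rwa [hω, edist_zero_right] at this
  have hLb := hLV.lintegral_sq_le
  have hmem : ∀ {v : Ω → ℝ}, AEStronglyMeasurable v μ → ∫⁻ ω, ‖v ω‖ₑ ^ 2 ∂μ < ∞ → MemLp v 2 μ := by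
    intro v hv h
    refine ⟨hv, ?_⟩
    rw [eLpNorm_lt_top_iff_lintegral_rpow_enorm_lt_top two_ne_zero ENNReal.ofNat_ne_top]
    simpa only [ENNReal.toReal_ofNat, ENNReal.rpow_ofNat] using h
  have hLtop : ∫⁻ ω, ‖L ⊥ ω‖ₑ ^ 2 ∂μ + ∫⁻ ω, ENNReal.ofReal (V ⊤ ω) ∂μ < ∞ :=
    ENNReal.add_lt_top.2 ⟨hC0, hfin1⟩
  have hsym : ∀ᵐ ω ∂μ, ∀ t, L t ω + A t ω = P t ω := by
    filter_upwards [hPLA] with ω h t using (h t).symm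
  refine ⟨(hLV.cadlagAdapted.add hAca).congr h𝓕 hsym, ?_, ?_⟩
  · have h1 := sqInt_of_eLpNorm_le (hLV.cadlagAdapted.aestronglyMeasurable h𝓕) hLtop.ne hLb
    have h2 := sqInt_of_eLpNorm_le (hAca.aestronglyMeasurable h𝓕) hfin2.ne hAb
    exact MemLp.ae_eq (ae_prod_of_ae_forall hsym) (MemLp.add h1 h2)
  · have h1 : MemLp (L ⊤) 2 μ :=
      hmem ((hLV.cadlagAdapted.adapted ⊤).mono (𝓕.le ⊤)).aestronglyMeasurable
        ((hLb ⊤).trans_lt hLtop)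
    have h2 : MemLp (A ⊤) 2 μ :=
      hmem ((hAca.adapted ⊤).mono (𝓕.le ⊤)).aestronglyMeasurable ((hAb ⊤).trans_lt hfin2)
    refine (h1.add h2).ae_eq ?_
    filter_upwards [hsym] with ω h using h ⊤

end PriceProcess

/-! ### Progressive processes as measurable functions for one σ-algebra. -/

section ProgressiveSigmaAlgebra

variable {T : ℝ} [hT : Fact (0 < T)] {Ω : Type*} [mΩ : MeasurableSpace Ω]
  {μ : Measure Ω} [IsProbabilityMeasure μ] {𝓕 : Filtration (Time T) mΩ}

/-- The progressive σ-algebra. -/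
@[reducible]
def progressiveSigma (𝓕 : Filtration (Time T) mΩ) : MeasurableSpace (Time T × Ω) :=
  ⨅ t : Time T, MeasurableSpace.map (fun p : Set.Iic t × Ω => ((p.1 : Time T), p.2))
    (Prod.instMeasurableSpace (m₂ := 𝓕 t))

/-- This identifies the admissible strategies, up to null sets, with the closed subspace `lpMeas` of
`L²(dt ⊗ dμ)`. -/
lemma isStronglyProgressive_iff_progressiveSigma {v : Time T → Ω → ℝ} :
    IsStronglyProgressive 𝓕 v ↔
      StronglyMeasurable[progressiveSigma 𝓕] fun z : Time T × Ω => v z.1 z.2 := by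
  constructor
  · intro h
    suffices hm : Measurable[progressiveSigma 𝓕] fun z : Time T × Ω => v z.1 z.2 from
      hm.stronglyMeasurable
    intro s hs
    rw [MeasurableSpace.measurableSet_iInf]
    intro t
    exact (h t).measurable hs
  · intro h t
    letI : MeasurableSpace Ω := 𝓕 t
    refine Measurable.stronglyMeasurable fun s hs => ?_
    have h1 := h.measurable hs
    rw [MeasurableSpace.measurableSet_iInf] at h1
    exact h1 t

lemma progressiveSigma_le (𝓕 : Filtration (Time T) mΩ) :
    progressiveSigma 𝓕 ≤ Prod.instMeasurableSpace := by
  intro s hs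
  have h1 : IsStronglyProgressive 𝓕 fun t ω => s.indicator (fun _ => (1 : ℝ)) (t, ω) :=
    isStronglyProgressive_iff_progressiveSigma.2 (stronglyMeasurable_const.indicator hs)
  have h2 := (stronglyMeasurable_of_progressive h1).measurable (measurableSet_singleton 1)
  convert h2 using 1
  ext z
  by_cases hz : z ∈ s <;> simp [hz]

end ProgressiveSigmaAlgebra

/-! ### The deterministic operator of the first order conditions. -/

section GameOperator

variable {T : ℝ}

/-- The linear operator appearing in the first order conditions of the game, without its
multiple of the identity. -/
noncomputable def kernelOp (β c r φ q : ℝ) (f : Time T → ℝ) (t : Time T) : ℝ :=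
  β * volt r f t + c * voltAdj r f t + φ * voltAdj 0 (volt 0 f) t + q * ∫ s, f s

variable {β c r φ q : ℝ}

lemma kernelOp_congr {f g : Time T → ℝ} (h : f =ᵐ[volume] g) (t : Time T) :
    kernelOp β c r φ q f t = kernelOp β c r φ q g t := by
  have : volt 0 f = volt 0 g := funext fun s => volt_congr h 0 s
  simp only [kernelOp, volt_congr h, voltAdj_congr h, this, integral_congr_ae h]

lemma kernelOp_add {f g : Time T → ℝ} (hf : Integrable f) (hg : Integrable g) (t : Time T) :
    kernelOp β c r φ q (fun s => f s + g s) t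
      = kernelOp β c r φ q f t + kernelOp β c r φ q g t := by
  have h : volt 0 (fun s => f s + g s) = fun s => volt 0 f s + volt 0 g s :=
    funext fun s => volt_add hf hg 0 s
  simp only [kernelOp, volt_add hf hg, voltAdj_add hf hg, h,
    voltAdj_add (integrable_of_continuous (continuous_volt hf 0))
      (integrable_of_continuous (continuous_volt hg 0)), integral_add hf hg]
  ring

lemma kernelOp_const_mul (f : Time T → ℝ) (b : ℝ) (t : Time T) :
    kernelOp β c r φ q (fun s => b * f s) t = b * kernelOp β c r φ q f t := by
  have h : volt 0 (fun s => b * f s) = fun s => b * volt 0 f s :=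
    funext fun s => volt_const_mul f b 0 s
  simp only [kernelOp, volt_const_mul, voltAdj_const_mul, h, integral_const_mul]
  ring

lemma kernelOp_sub {f g : Time T → ℝ} (hf : Integrable f) (hg : Integrable g) (t : Time T) :
    kernelOp β c r φ q (fun s => f s - g s) t
      = kernelOp β c r φ q f t - kernelOp β c r φ q g t := by
  have h : (fun s => f s - g s) = fun s => f s + (-1) * g s := by ext s; ring
  rw [h, kernelOp_add hf (hg.const_mul (-1)), kernelOp_const_mul]
  ring

lemma abs_kernelOp_le (hr : 0 ≤ r) {f : Time T → ℝ} (hf : Integrable f) (t : Time T) :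
    |kernelOp β c r φ q f t|
      ≤ (|β| + |c| + |φ| * volume.real (Set.univ : Set (Time T)) + |q|) * ∫ s, |f s| := by
  have h1 := abs_volt_le hr hf t
  have h2 := abs_voltAdj_le hr hf t
  have iv : Integrable (volt 0 f) := integrable_of_continuous (continuous_volt hf 0)
  have h3 : |voltAdj 0 (volt 0 f) t| ≤ volume.real (Set.univ : Set (Time T)) * ∫ s, |f s| := by
    refine (abs_voltAdj_le le_rfl iv t).trans ?_
    calc ∫ s, |volt 0 f s| ≤ ∫ _ : Time T, ∫ s, |f s| :=
          integral_mono iv.abs (integrable_const _) fun s => abs_volt_le le_rfl hf s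
      _ = _ := by rw [integral_const, smul_eq_mul]
  have h4 : |∫ s, f s| ≤ ∫ s, |f s| := abs_integral_le_integral_abs
  calc |kernelOp β c r φ q f t|
      ≤ |β * volt r f t| + |c * voltAdj r f t| + |φ * voltAdj 0 (volt 0 f) t| + |q * ∫ s, f s| :=
        (abs_add_le _ _).trans (add_le_add_left ((abs_add_le _ _).trans
          (add_le_add_left (abs_add_le _ _) _)) _)
    _ ≤ |β| * (∫ s, |f s|) + |c| * (∫ s, |f s|)
        + |φ| * (volume.real (Set.univ : Set (Time T)) * ∫ s, |f s|) + |q| * ∫ s, |f s| := by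
        simp only [abs_mul]
        gcongr
    _ = _ := by ring

lemma continuous_kernelOp {f : Time T → ℝ} (hf : Integrable f) :
    Continuous (kernelOp β c r φ q f) := by
  unfold kernelOp
  have h1 := continuous_volt hf r
  have h2 := continuous_voltAdj hf r
  have h3 := continuous_voltAdj (integrable_of_continuous (continuous_volt hf 0)) 0
  fun_prop

/-- The Volterra operator and its adjoint share one nonnegative quadratic form; the third term
contributes `φ ∫ (volt 0 f)²` and the last `q (∫ f)²`. -/
lemma integral_mul_kernelOp_nonneg (hβ : 0 ≤ β) (hc : 0 ≤ c) (hr : 0 ≤ r) (hφ : 0 ≤ φ)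
    (hq : 0 ≤ q) {f : Time T → ℝ} (hf : Integrable f) :
    0 ≤ ∫ t, f t * kernelOp β c r φ q f t := by
  have hv0 := continuous_volt hf 0
  have im : ∀ g : Time T → ℝ, Continuous g → Integrable fun t => f t * g t := fun g hg => by
    simpa only [mul_comm] using integrable_continuous_mul hf hg
  have i1 := im _ (continuous_volt hf r)
  have i2 := im _ (continuous_voltAdj hf r)
  have i3 := im _ (continuous_voltAdj (integrable_of_continuous hv0) 0)
  have e : ∀ t, f t * kernelOp β c r φ q f t = β * (f t * volt r f t) + c * (f t * voltAdj r f t)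
      + φ * (f t * voltAdj 0 (volt 0 f) t) + f t * (q * ∫ s, f s) := fun t => by
    rw [kernelOp]; ring
  have i12 : Integrable fun t => β * (f t * volt r f t) + c * (f t * voltAdj r f t) :=
    (i1.const_mul β).add (i2.const_mul c)
  have i123 : Integrable fun t => β * (f t * volt r f t) + c * (f t * voltAdj r f t)
      + φ * (f t * voltAdj 0 (volt 0 f) t) := i12.add (i3.const_mul φ)
  simp only [e]
  rw [integral_add i123 (hf.mul_const _), integral_add i12 (i3.const_mul φ),
    integral_add (i1.const_mul β) (i2.const_mul c), integral_const_mul, integral_const_mul,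
    integral_const_mul, integral_mul_const, ← integral_mul_volt hf hf,
    integral_mul_voltAdj_volt hf hf]
  have p1 := integral_mul_volt_nonneg hf hr
  have p2 : 0 ≤ ∫ t, volt 0 f t * volt 0 f t := integral_nonneg fun t => mul_self_nonneg _
  have p3 : (∫ s, f s) * (q * ∫ s, f s) = q * ((∫ s, f s) * ∫ s, f s) := by ring
  rw [p3]
  have p4 := mul_self_nonneg (∫ s, f s)
  positivity

end GameOperator

/-! ### Lax-Milgram on the space of progressive processes. -/

section LaxMilgram

variable {T : ℝ} [hT : Fact (0 < T)] {Ω : Type*} [mΩ : MeasurableSpace Ω]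
  {μ : Measure Ω} [IsProbabilityMeasure μ] {𝓕 : Filtration (Time T) mΩ}
  {α β c r φ q : ℝ}

lemma SqInt.kernelOp (hr : 0 ≤ r) {v : Time T → Ω → ℝ} (hv : SqInt μ v) :
    SqInt μ fun t ω => kernelOp β c r φ q (fun s => v s ω) t := by
  have h1 := MemLp.const_mul (hv.volt hr) β
  have h2 := MemLp.const_mul (hv.voltAdj hr) c
  have h3 := MemLp.const_mul ((hv.volt le_rfl).voltAdj le_rfl) φ
  have h4 := MemLp.const_mul (SqInt.of_const (T := T) hv.memLp_integral) q
  exact ((h1.add h2).add h3).add h4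

lemma SqInt.integral_sq_kernelOp_le (hr : 0 ≤ r) {v : Time T → Ω → ℝ} (hv : SqInt μ v) :
    ∫ z, (PriceImpactGame.kernelOp β c r φ q (fun s => v s z.2) z.1) ^ 2
        ∂((volume : Measure (Time T)).prod μ)
      ≤ ((|β| + |c| + |φ| * volume.real (Set.univ : Set (Time T)) + |q|)
          * volume.real (Set.univ : Set (Time T))) ^ 2
        * ∫ z, v z.1 z.2 ^ 2 ∂((volume : Measure (Time T)).prod μ) := by
  set C := |β| + |c| + |φ| * volume.real (Set.univ : Set (Time T)) + |q|
  set V := volume.real (Set.univ : Set (Time T))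
  have hK := hv.kernelOp (β := β) (c := c) (φ := φ) (q := q) hr
  rw [integral_prod_symm _ (MemLp.integrable_sq hK), integral_prod_symm _ (MemLp.integrable_sq hv),
    ← integral_const_mul]
  refine integral_mono_ae (MemLp.integrable_sq hK).integral_prod_right
    ((MemLp.integrable_sq hv).integral_prod_right.const_mul _) ?_
  filter_upwards [hv.ae_memLp] with ω hω
  have hi := hω.integrable one_le_two
  have h0 : 0 ≤ ∫ s, |v s ω| := integral_nonneg fun s => abs_nonneg _
  have hC : 0 ≤ C := by positivity
  calc ∫ t, (PriceImpactGame.kernelOp β c r φ q (fun s => v s ω) t) ^ 2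
      ≤ ∫ _ : Time T, (C * ∫ s, |v s ω|) ^ 2 := by
        refine integral_mono (integrable_of_continuous ((continuous_kernelOp hi).pow 2))
          (integrable_const _) fun t => ?_
        exact sq_le_sq' ((neg_le_neg (abs_kernelOp_le hr hi t)).trans (neg_abs_le _))
          ((le_abs_self _).trans (abs_kernelOp_le hr hi t))
    _ = V * (C ^ 2 * (∫ s, |v s ω|) ^ 2) := by
        rw [integral_const, smul_eq_mul, mul_pow]
    _ ≤ V * (C ^ 2 * (V * ∫ s, v s ω ^ 2)) := by
        have := SqInt.sq_integral_abs_le hω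
        have hV : 0 ≤ V := measureReal_nonneg
        gcongr
    _ = (C * V) ^ 2 * ∫ s, v s ω ^ 2 := by ring

/-- Coercivity with constant `α`: the kernel part is nonnegative path by path, so only the multiple
of the identity is needed. -/
lemma SqInt.integral_mul_gameOp_ge (hβ : 0 ≤ β) (hc : 0 ≤ c) (hr : 0 ≤ r) (hφ : 0 ≤ φ)
    (hq : 0 ≤ q) {v : Time T → Ω → ℝ} (hv : SqInt μ v) :
    α * ∫ z, v z.1 z.2 ^ 2 ∂((volume : Measure (Time T)).prod μ)
      ≤ ∫ z, v z.1 z.2 * (α * v z.1 z.2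
          + PriceImpactGame.kernelOp β c r φ q (fun s => v s z.2) z.1)
        ∂((volume : Measure (Time T)).prod μ) := by
  have hK := hv.kernelOp (β := β) (c := c) (φ := φ) (q := q) hr
  have e : ∀ z : Time T × Ω, v z.1 z.2 * (α * v z.1 z.2
      + PriceImpactGame.kernelOp β c r φ q (fun s => v s z.2) z.1)
      = α * v z.1 z.2 ^ 2
        + v z.1 z.2 * PriceImpactGame.kernelOp β c r φ q (fun s => v s z.2) z.1 :=
    fun z => by ring
  simp only [e]
  rw [integral_add ((MemLp.integrable_sq hv).const_mul α) (hv.integrable_mul hK),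
    integral_const_mul, hv.integral_eq hK]
  have : 0 ≤ ∫ ω, (∫ t, v t ω * PriceImpactGame.kernelOp β c r φ q (fun s => v s ω) t) ∂μ := by
    refine integral_nonneg_of_ae ?_
    filter_upwards [hv.ae_integrable] with ω hω
    exact integral_mul_kernelOp_nonneg hβ hc hr hφ hq hω
  linarith

/-- The square integrable processes, up to almost everywhere equality. -/
noncomputable abbrev ProcessSpace (T : ℝ) (μ : Measure Ω) := Lp ℝ 2 ((volume : Measure (Time T)).prod μ)

lemma sqInt_coe (f : ProcessSpace T μ) : SqInt μ fun t ω => f (t, ω) := Lp.memLp f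

/-- The element of the Hilbert space defined by a square integrable process. -/
noncomputable def SqInt.toL2 {v : Time T → Ω → ℝ} (hv : SqInt μ v) : ProcessSpace T μ :=
  MemLp.toLp _ hv

lemma SqInt.coeFn_toL2 {v : Time T → Ω → ℝ} (hv : SqInt μ v) :
    hv.toL2 =ᵐ[(volume : Measure (Time T)).prod μ] fun z => v z.1 z.2 := MemLp.coeFn_toLp hv

lemma SqInt.toL2_congr {v w : Time T → Ω → ℝ} (hv : SqInt μ v) (hw : SqInt μ w)
    (h : SameStrategy μ v w) : hv.toL2 = hw.toL2 := (MemLp.toLp_eq_toLp_iff hv hw).2 h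

lemma SqInt.eq_toL2 {v : Time T → Ω → ℝ} (hv : SqInt μ v) {f : ProcessSpace T μ}
    (h : f =ᵐ[(volume : Measure (Time T)).prod μ] fun z => v z.1 z.2) : f = hv.toL2 :=
  Lp.ext (h.trans hv.coeFn_toL2.symm)

lemma inner_toL2 {v w : Time T → Ω → ℝ} (hv : SqInt μ v) (hw : SqInt μ w) :
    inner ℝ hv.toL2 hw.toL2
      = ∫ z, v z.1 z.2 * w z.1 z.2 ∂((volume : Measure (Time T)).prod μ) := by
  rw [L2.inner_def]
  refine integral_congr_ae ?_
  filter_upwards [hv.coeFn_toL2, hw.coeFn_toL2] with z h1 h2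
  rw [h1, h2]
  simp [mul_comm]

lemma toL2_coe (f : ProcessSpace T μ) : (sqInt_coe f).toL2 = f :=
  ((sqInt_coe f).eq_toL2 (ae_of_all _ fun _ => rfl)).symm

lemma norm_sq_toL2 {v : Time T → Ω → ℝ} (hv : SqInt μ v) :
    ‖hv.toL2‖ ^ 2 = ∫ z, v z.1 z.2 ^ 2 ∂((volume : Measure (Time T)).prod μ) := by
  rw [← real_inner_self_eq_norm_sq, inner_toL2 hv hv]
  simp only [pow_two]

lemma toL2_kernelOp_congr (hr : 0 ≤ r) {v w : Time T → Ω → ℝ} (hv : SqInt μ v) (hw : SqInt μ w)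
    (h : SameStrategy μ v w) :
    (hv.kernelOp (β := β) (c := c) (φ := φ) (q := q) hr).toL2
      = (hw.kernelOp (β := β) (c := c) (φ := φ) (q := q) hr).toL2 := by
  refine SqInt.toL2_congr _ _ (ae_prod_of_ae_forall (p := fun t ω => PriceImpactGame.kernelOp β c r φ q
    (fun s => v s ω) t = PriceImpactGame.kernelOp β c r φ q (fun s => w s ω) t) ?_)
  filter_upwards [ae_ae_swap (p := fun t ω => v t ω = w t ω) h] with ω hω t
  exact kernelOp_congr hω t

/-- The kernel operator on the Hilbert space of square integrable processes. -/
noncomputable def kernelCLM (β c φ q : ℝ) (hr : 0 ≤ r) : ProcessSpace T μ →L[ℝ] ProcessSpace T μ :=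
  LinearMap.mkContinuous
    { toFun := fun f => ((sqInt_coe f).kernelOp (β := β) (c := c) (φ := φ) (q := q) hr).toL2
      map_add' := fun f g => by
        symm
        refine SqInt.eq_toL2 _ ?_
        refine (Lp.coeFn_add _ _).trans ?_
        have h1 : ∀ᵐ ω ∂μ, ∀ t, kernelOp β c r φ q (fun s => (f + g) (s, ω)) t
            = kernelOp β c r φ q (fun s => f (s, ω)) t
              + kernelOp β c r φ q (fun s => g (s, ω)) t := by
          filter_upwards [(sqInt_coe f).ae_integrable, (sqInt_coe g).ae_integrable,
            ae_ae_swap (p := fun t ω => (f + g) (t, ω) = f (t, ω) + g (t, ω))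
              (Lp.coeFn_add f g)] with ω h1 h2 h3 t
          rw [kernelOp_congr h3, kernelOp_add h1 h2]
        filter_upwards [ae_prod_of_ae_forall h1, SqInt.coeFn_toL2 ((sqInt_coe f).kernelOp
          (β := β) (c := c) (φ := φ) (q := q) hr), SqInt.coeFn_toL2 ((sqInt_coe g).kernelOp
          (β := β) (c := c) (φ := φ) (q := q) hr)] with z h1 h2 h3
        rw [h1, Pi.add_apply, h2, h3]
      map_smul' := fun a f => by
        symm
        refine SqInt.eq_toL2 _ ?_
        refine (Lp.coeFn_smul _ _).trans ?_
        have h1 : ∀ᵐ ω ∂μ, ∀ t, kernelOp β c r φ q (fun s => (a • f) (s, ω)) t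
            = a * kernelOp β c r φ q (fun s => f (s, ω)) t := by
          filter_upwards [ae_ae_swap (p := fun t ω => (a • f) (t, ω) = a * f (t, ω))
              (Lp.coeFn_smul a f)] with ω h3 t
          rw [kernelOp_congr h3, kernelOp_const_mul]
        filter_upwards [ae_prod_of_ae_forall h1, SqInt.coeFn_toL2 ((sqInt_coe f).kernelOp
          (β := β) (c := c) (φ := φ) (q := q) hr)] with z h1 h2
        rw [h1, RingHom.id_apply, Pi.smul_apply, h2, smul_eq_mul] }
    ((|β| + |c| + |φ| * volume.real (Set.univ : Set (Time T)) + |q|)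
          * volume.real (Set.univ : Set (Time T)))
    (fun f => by
      have hV : 0 ≤ volume.real (Set.univ : Set (Time T)) := measureReal_nonneg
      have h1 := (sqInt_coe f).integral_sq_kernelOp_le (β := β) (c := c) (φ := φ) (q := q) hr
      rw [← norm_sq_toL2 (sqInt_coe f), toL2_coe, ← norm_sq_toL2 ((sqInt_coe f).kernelOp hr),
        ← mul_pow] at h1
      exact le_of_sq_le_sq h1 (by positivity))

lemma kernelCLM_toL2 (hr : 0 ≤ r) {v : Time T → Ω → ℝ} (hv : SqInt μ v) :
    kernelCLM β c φ q hr hv.toL2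
      = (hv.kernelOp (β := β) (c := c) (φ := φ) (q := q) hr).toL2 :=
  toL2_kernelOp_congr hr (sqInt_coe _) hv hv.coeFn_toL2

/-- Solvability of the linear first order condition, by the Lax-Milgram theorem. -/
theorem exists_admissible_gameOp (𝓕 : Filtration (Time T) mΩ) (hα : 0 < α) (hβ : 0 ≤ β) (hc : 0 ≤ c)
    (hr : 0 ≤ r) (hφ : 0 ≤ φ) (hq : 0 ≤ q) {b : Time T → Ω → ℝ} (hb : SqInt μ b) :
    ∃ u : Time T → Ω → ℝ, IsAdmissible 𝓕 μ u ∧ ∀ w, IsAdmissible 𝓕 μ w →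
      ∫ z, w z.1 z.2 * (α * u z.1 z.2 + kernelOp β c r φ q (fun s => u s z.2) z.1)
          ∂((volume : Measure (Time T)).prod μ)
        = ∫ z, w z.1 z.2 * b z.1 z.2 ∂((volume : Measure (Time T)).prod μ) := by
  haveI : Fact (progressiveSigma 𝓕 ≤ Prod.instMeasurableSpace) := ⟨progressiveSigma_le 𝓕⟩
  -- The adjoint operators look into the future and leave the progressive subspace. The bilinear
  -- form is therefore restricted to `H`, which is why the equation is only solved weakly, against
  -- admissible tests.
  let H : Submodule ℝ (ProcessSpace T μ) :=
    lpMeas ℝ ℝ (progressiveSigma 𝓕) 2 ((volume : Measure (Time T)).prod μ)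
  haveI : CompleteSpace H := inferInstanceAs (CompleteSpace (lpMeas ℝ ℝ (progressiveSigma 𝓕) 2
    ((volume : Measure (Time T)).prod μ)))
  let A : ProcessSpace T μ →L[ℝ] ProcessSpace T μ :=
    α • ContinuousLinearMap.id ℝ _ + kernelCLM β c φ q hr
  let B : H →L[ℝ] H →L[ℝ] ℝ := ((innerSL ℝ).comp A).bilinearComp H.subtypeL H.subtypeL
  have hB : ∀ f g : H, B f g = inner ℝ (A f) (g : ProcessSpace T μ) := fun f g => rfl
  have hA : ∀ {v w : Time T → Ω → ℝ} (hv : SqInt μ v) (hw : SqInt μ w),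
      inner ℝ (A hv.toL2) hw.toL2
        = ∫ z, w z.1 z.2 * (α * v z.1 z.2 + kernelOp β c r φ q (fun s => v s z.2) z.1)
          ∂((volume : Measure (Time T)).prod μ) := by
    intro v w hv hw
    have hK := hv.kernelOp (β := β) (c := c) (φ := φ) (q := q) hr
    have h1 : A hv.toL2 = α • hv.toL2 + hK.toL2 := by
      simp only [A, add_apply, smul_apply,
        ContinuousLinearMap.id_apply, kernelCLM_toL2]
    rw [h1, inner_add_left, real_inner_smul_left, inner_toL2 hv hw, inner_toL2 hK hw,
      ← integral_const_mul, ← integral_add ((hv.integrable_mul hw).const_mul α)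
        (hK.integrable_mul hw)]
    congr 1 with z
    ring
  have hcoer : IsCoercive B := by
    refine ⟨α, hα, fun f => ?_⟩
    have h1 := (sqInt_coe (f : ProcessSpace T μ)).integral_mul_gameOp_ge (α := α) hβ hc hr hφ hq
    rw [← hA (sqInt_coe _) (sqInt_coe _), ← norm_sq_toL2 (sqInt_coe _), toL2_coe] at h1
    rw [hB]
    calc α * ‖f‖ * ‖f‖ = α * ‖(f : ProcessSpace T μ)‖ ^ 2 := by
          rw [Submodule.coe_norm]; ring
      _ ≤ _ := h1
  let ℓ : H →L[ℝ] ℝ := ((innerSL ℝ) hb.toL2).comp H.subtypeL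
  let f₀ : H := (InnerProductSpace.toDual ℝ H).symm ℓ
  let f : H := hcoer.continuousLinearEquivOfBilin.symm f₀
  have hf : ∀ g : H, inner ℝ (A f) (g : ProcessSpace T μ)
      = inner ℝ hb.toL2 (g : ProcessSpace T μ) := by
    intro g
    have h1 := hcoer.continuousLinearEquivOfBilin_apply f g
    rw [ContinuousLinearEquiv.apply_symm_apply, InnerProductSpace.toDual_symm_apply, hB] at h1
    exact h1.symm
  -- An element of `H` is a class of processes; an admissible strategy is a progressively measurable
  -- representative of it.
  have hfm : AEStronglyMeasurable[progressiveSigma 𝓕] (f : ProcessSpace T μ)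
      ((volume : Measure (Time T)).prod μ) := mem_lpMeas_iff_aestronglyMeasurable.1 f.2
  have hu : SqInt μ fun t ω => hfm.mk _ (t, ω) := MemLp.ae_eq hfm.ae_eq_mk (Lp.memLp _)
  have hfu : (f : ProcessSpace T μ) = hu.toL2 := hu.eq_toL2 hfm.ae_eq_mk
  refine ⟨fun t ω => hfm.mk _ (t, ω), isAdmissible_iff.2
    ⟨isStronglyProgressive_iff_progressiveSigma.2 hfm.stronglyMeasurable_mk, hu⟩, fun w hw => ?_⟩
  have hwm : hw.sqInt.toL2 ∈ H := by
    refine mem_lpMeas_iff_aestronglyMeasurable.2 ?_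
    exact ⟨fun z => w z.1 z.2, isStronglyProgressive_iff_progressiveSigma.1 hw.1,
      hw.sqInt.coeFn_toL2⟩
  have h1 := hf ⟨_, hwm⟩
  rw [hfu, hA hu hw.sqInt, inner_toL2 hb hw.sqInt] at h1
  rw [h1]
  congr 1 with z
  ring

end LaxMilgram

/-! ### The pairing of processes in `L²(dt ⊗ dμ)`. -/

section Pairing

variable {T : ℝ} [hT : Fact (0 < T)] {Ω : Type*} [mΩ : MeasurableSpace Ω]
  {μ : Measure Ω} [IsProbabilityMeasure μ] {𝓕 : Filtration (Time T) mΩ}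

/-- The `L²(dt ⊗ dμ)` pairing of two processes. -/
noncomputable def pairing (μ : Measure Ω) (w f : Time T → Ω → ℝ) : ℝ :=
  ∫ z, w z.1 z.2 * f z.1 z.2 ∂((volume : Measure (Time T)).prod μ)

variable {v w f g : Time T → Ω → ℝ}

lemma pairing_congr (h : SameStrategy μ f g) : pairing μ w f = pairing μ w g := by
  refine integral_congr_ae ?_
  filter_upwards [h] with z hz
  rw [hz]

lemma pairing_add (hw : SqInt μ w) (hf : SqInt μ f) (hg : SqInt μ g) :
    pairing μ w (fun t ω => f t ω + g t ω) = pairing μ w f + pairing μ w g := by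
  simp only [pairing, mul_add]
  exact integral_add (hw.integrable_mul hf) (hw.integrable_mul hg)

lemma pairing_sub (hw : SqInt μ w) (hf : SqInt μ f) (hg : SqInt μ g) :
    pairing μ w (fun t ω => f t ω - g t ω) = pairing μ w f - pairing μ w g := by
  simp only [pairing, mul_sub]
  exact integral_sub (hw.integrable_mul hf) (hw.integrable_mul hg)

lemma pairing_const_mul (a : ℝ) : pairing μ w (fun t ω => a * f t ω) = a * pairing μ w f := by
  simp only [pairing, ← integral_const_mul]
  congr 1 with z
  ring

lemma pairing_sum {ι : Type*} (S : Finset ι) {f : ι → Time T → Ω → ℝ} (hw : SqInt μ w)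
    (hf : ∀ i, SqInt μ (f i)) :
    pairing μ w (fun t ω => ∑ i ∈ S, f i t ω) = ∑ i ∈ S, pairing μ w (f i) := by
  simp only [pairing, Finset.mul_sum]
  exact integral_finsetSum _ fun i _ => hw.integrable_mul (hf i)

lemma sameStrategy_zero_of_pairing_self (hv : SqInt μ v) (h : pairing μ v v ≤ 0) :
    SameStrategy μ v fun _ _ => 0 := by
  have e : pairing μ v v = ∫ z, v z.1 z.2 ^ 2 ∂((volume : Measure (Time T)).prod μ) := by
    simp only [pairing, pow_two]
  rw [e] at h
  have h1 := (integral_eq_zero_iff_of_nonneg (fun z => sq_nonneg _) (MemLp.integrable_sq hv)).1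
    (le_antisymm h (integral_nonneg fun z => sq_nonneg _))
  filter_upwards [h1] with z hz
  simpa using hz

lemma sameStrategy_zero_of_gameOp {α β c r φ q : ℝ} (hα : 0 < α) (hβ : 0 ≤ β) (hc : 0 ≤ c)
    (hr : 0 ≤ r) (hφ : 0 ≤ φ) (hq : 0 ≤ q) (hv : SqInt μ v)
    (h : pairing μ v (fun t ω => α * v t ω + kernelOp β c r φ q (fun s => v s ω) t) = 0) :
    SameStrategy μ v fun _ _ => 0 := by
  have h1 := hv.integral_mul_gameOp_ge (α := α) hβ hc hr hφ hq
  refine sameStrategy_zero_of_pairing_self hv ?_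
  have e : pairing μ v v = ∫ z, v z.1 z.2 ^ 2 ∂((volume : Measure (Time T)).prod μ) := by
    simp only [pairing, pow_two]
  rw [← e] at h1
  have h2 : α * pairing μ v v ≤ 0 := h1.trans h.le
  by_contra hcon
  exact absurd h2 (not_le.2 (mul_pos hα (not_le.1 hcon)))

end Pairing

/-! ### First order conditions: existence and uniqueness of their solution. -/

section FirstOrder

variable {T : ℝ} [hT : Fact (0 < T)] {Ω : Type*} [mΩ : MeasurableSpace Ω]
  {μ : Measure Ω} [IsProbabilityMeasure μ] {𝓕 : Filtration (Time T) mΩ} {N : ℕ}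

/-- The price impact of a single player's trading rate. -/
noncomputable def Params.imp (p : Params N) : ℝ := p.γ * p.κ / N

lemma Params.imp_nonneg (p : Params N) : 0 ≤ p.imp := by
  have := p.γ_pos; have := p.κ_pos
  unfold Params.imp
  positivity

lemma inventory_eq (p : Params N) (i : Fin N) (v : Time T → Ω → ℝ) (t : Time T) (ω : Ω) :
    inventory p i v t ω = p.x i - volt 0 (fun s => v s ω) t := by
  rw [inventory, volt_zero]

lemma inventory_top (p : Params N) (i : Fin N) (v : Time T → Ω → ℝ) (ω : Ω) :
    inventory p i v ⊤ ω = p.x i - ∫ s, v s ω := by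
  rw [inventory, Set.Iic_top, setIntegral_univ]

lemma distortion_eq (p : Params N) (u : Fin N → Time T → Ω → ℝ) (t : Time T) (ω : Ω) :
    distortion p u t ω = Real.exp (-p.ρ * (t : ℝ)) * p.y
      + p.γ / N * volt p.ρ (fun s => ∑ j, u j s ω) t := by
  have h := volt_const_mul (fun s => ∑ j, u j s ω) (1 / (N : ℝ)) p.ρ t
  rw [volt] at h
  rw [distortion, h]
  ring

/-- Minus the gradient of player `i`'s performance in her own strategy. -/
noncomputable def grad (p : Params N) (P : Time T → Ω → ℝ) (u : Fin N → Time T → Ω → ℝ)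
    (i : Fin N) (t : Time T) (ω : Ω) : ℝ :=
  2 * p.lam * u i t ω - P t ω + p.κ * distortion p u t ω
    + p.imp * voltAdj p.ρ (fun s => u i s ω) t
    - 2 * p.φ * voltAdj 0 (fun s => inventory p i (u i) s ω) t
    + P ⊤ ω - 2 * p.varrho * inventory p i (u i) ⊤ ω

/-- The first order conditions of all players, in weak form. -/
def IsCritical (p : Params N) (𝓕 : Filtration (Time T) mΩ) (μ : Measure Ω) (P : Time T → Ω → ℝ)
    (u : Fin N → Time T → Ω → ℝ) : Prop :=
  ∀ i, ∀ w, IsAdmissible 𝓕 μ w → pairing μ w (grad p P u i) = 0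

/-- The inhomogeneity of the first order condition. -/
noncomputable def gradSource (p : Params N) (P : Time T → Ω → ℝ) (i : Fin N) (t : Time T) (ω : Ω) :
    ℝ :=
  P t ω - P ⊤ ω + (2 * p.φ * voltAdj 0 (fun _ => p.x i) t + 2 * p.varrho * p.x i
    - p.κ * (Real.exp (-p.ρ * (t : ℝ)) * p.y))

/-- The condition of player `i` splits into an operator on her own rate, a Volterra term in the
aggregate rate and a source free of `u`. The aggregate is the only coupling between players. -/
lemma grad_eq (p : Params N) (P : Time T → Ω → ℝ) (u : Fin N → Time T → Ω → ℝ) (i : Fin N) (ω : Ω)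
    (hu : Integrable fun s => u i s ω) (t : Time T) :
    grad p P u i t ω
      = 2 * p.lam * u i t ω + kernelOp 0 p.imp p.ρ (2 * p.φ) (2 * p.varrho) (fun s => u i s ω) t
        + p.imp * volt p.ρ (fun s => ∑ j, u j s ω) t - gradSource p P i t ω := by
  have h1 : (fun s => inventory p i (u i) s ω)
      = fun s => p.x i + (-1) * volt 0 (fun s => u i s ω) s := by
    ext s
    rw [inventory_eq]; ring
  have iv : Integrable fun s => volt 0 (fun s => u i s ω) s :=
    integrable_of_continuous (continuous_volt hu 0)
  rw [grad, gradSource, kernelOp, inventory_top, distortion_eq, h1,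
    voltAdj_add (integrable_const _) (iv.const_mul (-1)), voltAdj_const_mul, Params.imp]
  ring

lemma sqInt_gradSource {P : Time T → Ω → ℝ} (hP : IsSqIntPrice 𝓕 μ P) (p : Params N) (i : Fin N) :
    SqInt μ (gradSource p P i) := by
  have h : SqInt μ fun (t : Time T) (_ : Ω) => 2 * p.φ * voltAdj 0 (fun _ => p.x i) t
      + 2 * p.varrho * p.x i - p.κ * (Real.exp (-p.ρ * (t : ℝ)) * p.y) := by
    refine SqInt.of_continuous (g := fun t : Time T => 2 * p.φ * voltAdj 0 (fun _ => p.x i) t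
      + 2 * p.varrho * p.x i - p.κ * (Real.exp (-p.ρ * (t : ℝ)) * p.y)) ?_
    have := continuous_voltAdj (T := T) (integrable_const (p.x i)) 0
    fun_prop
  exact MemLp.add (MemLp.sub hP.sqInt (SqInt.of_const hP.memLp_top)) h

lemma SqInt.finsetSum {ι : Type*} (S : Finset ι) {v : ι → Time T → Ω → ℝ}
    (hv : ∀ i, SqInt μ (v i)) : SqInt μ fun t ω => ∑ i ∈ S, v i t ω :=
  memLp_finsetSum S fun i _ => hv i

lemma sameStrategy_grad (p : Params N) (P : Time T → Ω → ℝ) {u : Fin N → Time T → Ω → ℝ} (i : Fin N)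
    (hu : ∀ i, SqInt μ (u i)) :
    SameStrategy μ (grad p P u i) fun t ω =>
      2 * p.lam * u i t ω + kernelOp 0 p.imp p.ρ (2 * p.φ) (2 * p.varrho) (fun s => u i s ω) t
        + p.imp * volt p.ρ (fun s => ∑ j, u j s ω) t - gradSource p P i t ω := by
  refine ae_prod_of_ae_forall (p := fun t ω => grad p P u i t ω =
      2 * p.lam * u i t ω + kernelOp 0 p.imp p.ρ (2 * p.φ) (2 * p.varrho) (fun s => u i s ω) t
        + p.imp * volt p.ρ (fun s => ∑ j, u j s ω) t - gradSource p P i t ω) ?_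
  filter_upwards [(hu i).ae_integrable] with ω hω t
  exact grad_eq p P u i ω hω t

/-- The process `2λ u + 𝒦 u` with `𝒦` the kernel operator. -/
noncomputable def gameOp (p : Params N) (β : ℝ) (v : Time T → Ω → ℝ) (t : Time T) (ω : Ω) : ℝ :=
  2 * p.lam * v t ω + kernelOp β p.imp p.ρ (2 * p.φ) (2 * p.varrho) (fun s => v s ω) t

lemma SqInt.gameOp {v : Time T → Ω → ℝ} (hv : SqInt μ v) (p : Params N) (β : ℝ) :
    SqInt μ (gameOp p β v) :=
  MemLp.add (MemLp.const_mul hv _) (hv.kernelOp p.ρ_pos.le)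

lemma gameOp_sub (p : Params N) (β : ℝ) {v w : Time T → Ω → ℝ} (hv : SqInt μ v) (hw : SqInt μ w) :
    SameStrategy μ (gameOp p β fun t ω => v t ω - w t ω)
      fun t ω => gameOp p β v t ω - gameOp p β w t ω := by
  refine ae_prod_of_ae_forall (p := fun t ω => gameOp p β (fun t ω => v t ω - w t ω) t ω
    = gameOp p β v t ω - gameOp p β w t ω) ?_
  filter_upwards [hv.ae_integrable, hw.ae_integrable] with ω h1 h2 t
  simp only [gameOp, kernelOp_sub h1 h2]
  ring

lemma gameOp_sum (p : Params N) (β : ℝ) {ι : Type*} (S : Finset ι) {v : ι → Time T → Ω → ℝ}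
    (hv : ∀ i, SqInt μ (v i)) :
    SameStrategy μ (gameOp p β fun t ω => ∑ i ∈ S, v i t ω)
      fun t ω => ∑ i ∈ S, gameOp p β (v i) t ω := by
  classical
  induction S using Finset.induction_on with
  | empty =>
    refine ae_of_all _ fun z => ?_
    simp [gameOp, kernelOp, volt, voltAdj]
  | insert i S hi ih =>
    have h1 : SameStrategy μ (gameOp p β fun t ω => v i t ω + ∑ j ∈ S, v j t ω)
        fun t ω => gameOp p β (v i) t ω + gameOp p β (fun t ω => ∑ j ∈ S, v j t ω) t ω := by
      refine ae_prod_of_ae_forall (p := fun t ω =>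
        gameOp p β (fun t ω => v i t ω + ∑ j ∈ S, v j t ω) t ω
        = gameOp p β (v i) t ω + gameOp p β (fun t ω => ∑ j ∈ S, v j t ω) t ω) ?_
      filter_upwards [(hv i).ae_integrable, (SqInt.finsetSum S hv).ae_integrable] with ω h1 h2 t
      simp only [gameOp, kernelOp_add h1 h2]
      ring
    simp only [Finset.sum_insert hi]
    filter_upwards [h1, ih] with z h2 h3
    rw [h2, h3]

lemma gameOp_add_volt (p : Params N) (β : ℝ) (v : Time T → Ω → ℝ) (t : Time T) (ω : Ω) :
    gameOp p β v t ω = gameOp p 0 v t ω + β * volt p.ρ (fun s => v s ω) t := by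
  simp only [gameOp, kernelOp]
  ring

lemma sameStrategy_zero_of_gameOp_eq_zero (p : Params N) {β : ℝ} (hβ : 0 ≤ β)
    {v : Time T → Ω → ℝ} (hv : SqInt μ v) (h : pairing μ v (gameOp p β v) = 0) :
    SameStrategy μ v fun _ _ => 0 := by
  have := p.φ_pos; have := p.varrho_pos; have := p.lam_pos
  exact sameStrategy_zero_of_gameOp (by positivity) hβ p.imp_nonneg p.ρ_pos.le (by positivity)
    (by positivity) hv h

lemma exists_admissible_gameOp_eq (𝓕 : Filtration (Time T) mΩ) (p : Params N) {β : ℝ} (hβ : 0 ≤ β)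
    {b : Time T → Ω → ℝ} (hb : SqInt μ b) :
    ∃ u : Time T → Ω → ℝ, IsAdmissible 𝓕 μ u ∧ ∀ w, IsAdmissible 𝓕 μ w →
      pairing μ w (gameOp p β u) = pairing μ w b := by
  have := p.φ_pos; have := p.varrho_pos; have := p.lam_pos
  exact exists_admissible_gameOp 𝓕 (by positivity) hβ p.imp_nonneg p.ρ_pos.le (by positivity)
    (by positivity) hb

lemma pairing_grad (p : Params N) {P : Time T → Ω → ℝ} (hP : IsSqIntPrice 𝓕 μ P)
    {u : Fin N → Time T → Ω → ℝ} (hu : ∀ i, SqInt μ (u i)) (i : Fin N)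
    {w : Time T → Ω → ℝ} (hw : SqInt μ w) :
    pairing μ w (grad p P u i) = pairing μ w (gameOp p 0 (u i))
      + p.imp * pairing μ w (fun t ω => volt p.ρ (fun s => ∑ j, u j s ω) t)
      - pairing μ w (gradSource p P i) := by
  have h1 := (hu i).gameOp p 0
  have h2 : SqInt μ fun t ω => p.imp * volt p.ρ (fun s => ∑ j, u j s ω) t :=
    MemLp.const_mul ((SqInt.finsetSum _ hu).volt p.ρ_pos.le) p.imp
  rw [pairing_congr (sameStrategy_grad p P i hu),
    ← pairing_const_mul (μ := μ) (f := fun t ω => volt p.ρ (fun s => ∑ j, u j s ω) t) p.imp,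
    ← pairing_add hw h1 h2]
  exact pairing_sub hw (MemLp.add h1 h2) (sqInt_gradSource hP p i)

lemma sqInt_grad (p : Params N) {P : Time T → Ω → ℝ} (hP : IsSqIntPrice 𝓕 μ P)
    {u : Fin N → Time T → Ω → ℝ} (hu : ∀ i, SqInt μ (u i)) (i : Fin N) :
    SqInt μ (grad p P u i) := by
  have h1 := (hu i).gameOp p 0
  have h2 : SqInt μ fun t ω => p.imp * volt p.ρ (fun s => ∑ j, u j s ω) t :=
    MemLp.const_mul ((SqInt.finsetSum _ hu).volt p.ρ_pos.le) p.imp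
  have h3 : SqInt μ fun t ω => gameOp p 0 (u i) t ω
      + p.imp * volt p.ρ (fun s => ∑ j, u j s ω) t - gradSource p P i t ω :=
    MemLp.sub (MemLp.add h1 h2) (sqInt_gradSource hP p i)
  refine h3.congr ?_
  filter_upwards [sameStrategy_grad p P i hu] with z hz using hz.symm

/-- Summed over the players, the coupling becomes `N` times `imp` times the Volterra term of the
aggregate; taking this coefficient as `β` absorbs it into the operator. -/
lemma pairing_gameOp_add_volt (p : Params N) (β : ℝ) {v w : Time T → Ω → ℝ} (hv : SqInt μ v)
    (hw : SqInt μ w) :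
    pairing μ w (gameOp p β v) = pairing μ w (gameOp p 0 v)
      + β * pairing μ w fun t ω => volt p.ρ (fun s => v s ω) t := by
  have h2 : SqInt μ fun t ω => β * volt p.ρ (fun s => v s ω) t :=
    MemLp.const_mul (hv.volt p.ρ_pos.le) β
  rw [← pairing_const_mul (μ := μ) (f := fun t ω => volt p.ρ (fun s => v s ω) t) β,
    ← pairing_add hw (hv.gameOp p 0) h2]
  exact pairing_congr (ae_of_all _ fun z => gameOp_add_volt p β v z.1 z.2)

/-- The first order conditions have a solution. -/
theorem exists_isCritical (p : Params N) {P : Time T → Ω → ℝ} (hP : IsSqIntPrice 𝓕 μ P) :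
    ∃ u : Fin N → Time T → Ω → ℝ, (∀ i, IsAdmissible 𝓕 μ (u i)) ∧ IsCritical p 𝓕 μ P u := by
  have hb := fun i => sqInt_gradSource hP p i
  have hNc : 0 ≤ N * p.imp := mul_nonneg (Nat.cast_nonneg N) p.imp_nonneg
  -- The sum of all conditions is a closed equation for the aggregate rate; `s` solves it.
  obtain ⟨s, hs, hs'⟩ := exists_admissible_gameOp_eq 𝓕 p hNc (SqInt.finsetSum Finset.univ hb)
  have hvs : SqInt μ fun t ω => p.imp * volt p.ρ (fun r => s r ω) t :=
    MemLp.const_mul (hs.sqInt.volt p.ρ_pos.le) p.imp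
  have hbs : ∀ i, SqInt μ fun t ω => gradSource p P i t ω
      - p.imp * volt p.ρ (fun r => s r ω) t := fun i => MemLp.sub (hb i) hvs
  -- With `s` put in place of the aggregate, each player faces an equation of her own.
  choose u hu hu' using fun i => exists_admissible_gameOp_eq 𝓕 p le_rfl (hbs i)
  have huS : ∀ i, SqInt μ (u i) := fun i => (hu i).sqInt
  have hσ : IsAdmissible 𝓕 μ fun t ω => ∑ i, u i t ω := IsAdmissible.finsetSum _ hu
  have hd : IsAdmissible 𝓕 μ fun t ω => (∑ i, u i t ω) - s t ω := hσ.sub hs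
  -- Consistency: the true aggregate minus `s` solves the homogeneous equation with `β = 0`, so it
  -- vanishes.
  have hzero : SameStrategy μ (fun t ω => (∑ i, u i t ω) - s t ω) fun _ _ => 0 := by
    refine sameStrategy_zero_of_gameOp_eq_zero p le_rfl hd.sqInt ?_
    rw [pairing_congr (gameOp_sub p 0 hσ.sqInt hs.sqInt),
      pairing_sub hd.sqInt (hσ.sqInt.gameOp p 0) (hs.sqInt.gameOp p 0),
      pairing_congr (gameOp_sum p 0 _ huS),
      pairing_sum _ hd.sqInt (fun i => (huS i).gameOp p 0)]
    simp only [fun i => hu' i _ hd, fun i => pairing_sub hd.sqInt (hb i) hvs]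
    have h1 := hs' _ hd
    rw [pairing_gameOp_add_volt p _ hs.sqInt hd.sqInt, pairing_sum _ hd.sqInt hb] at h1
    rw [Finset.sum_sub_distrib, pairing_const_mul, Finset.sum_const, Finset.card_univ,
      Fintype.card_fin, nsmul_eq_mul]
    linarith
  refine ⟨u, hu, fun i w hw => ?_⟩
  have hvolt : SameStrategy μ (fun t ω => volt p.ρ (fun r => ∑ j, u j r ω) t)
      fun t ω => volt p.ρ (fun r => s r ω) t := by
    refine ae_prod_of_ae_forall (p := fun t ω => volt p.ρ (fun r => ∑ j, u j r ω) t
      = volt p.ρ (fun r => s r ω) t) ?_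
    filter_upwards [ae_ae_swap (p := fun t ω => (∑ i, u i t ω) - s t ω = 0) hzero] with ω hω t
    refine volt_congr ?_ _ _
    filter_upwards [hω] with r hr using sub_eq_zero.1 hr
  rw [pairing_grad p hP huS i hw.sqInt, hu' i w hw, pairing_congr hvolt,
    pairing_sub hw.sqInt (hb i) hvs, pairing_const_mul]
  ring

/-- The first order conditions determine the strategies. -/
theorem IsCritical.unique (p : Params N) {P : Time T → Ω → ℝ} (hP : IsSqIntPrice 𝓕 μ P)
    {u u' : Fin N → Time T → Ω → ℝ} (hu : ∀ i, IsAdmissible 𝓕 μ (u i))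
    (hu' : ∀ i, IsAdmissible 𝓕 μ (u' i)) (hc : IsCritical p 𝓕 μ P u) (hc' : IsCritical p 𝓕 μ P u')
    (i : Fin N) : SameStrategy μ (u i) (u' i) := by
  have hS := fun i => (hu i).sqInt
  have hS' := fun i => (hu' i).sqInt
  have hd : ∀ i, IsAdmissible 𝓕 μ fun t ω => u i t ω - u' i t ω := fun i => (hu i).sub (hu' i)
  have hdS := fun i => (hd i).sqInt
  have hD : IsAdmissible 𝓕 μ fun t ω => ∑ i, (u i t ω - u' i t ω) := IsAdmissible.finsetSum _ hd
  have hNc : 0 ≤ N * p.imp := mul_nonneg (Nat.cast_nonneg N) p.imp_nonneg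
  have hvolt : ∀ w, SqInt μ w → pairing μ w (fun t ω => volt p.ρ
      (fun s => ∑ j, (u j s ω - u' j s ω)) t)
      = pairing μ w (fun t ω => volt p.ρ (fun s => ∑ j, u j s ω) t)
        - pairing μ w (fun t ω => volt p.ρ (fun s => ∑ j, u' j s ω) t) := by
    intro w hw
    rw [← pairing_sub hw ((SqInt.finsetSum _ hS).volt p.ρ_pos.le)
      ((SqInt.finsetSum _ hS').volt p.ρ_pos.le)]
    refine pairing_congr (ae_prod_of_ae_forall (p := fun t ω => volt p.ρ
      (fun s => ∑ j, (u j s ω - u' j s ω)) t = volt p.ρ (fun s => ∑ j, u j s ω) t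
        - volt p.ρ (fun s => ∑ j, u' j s ω) t) ?_)
    filter_upwards [(SqInt.finsetSum Finset.univ hS).ae_integrable,
      (SqInt.finsetSum Finset.univ hS').ae_integrable] with ω h1 h2 t
    have h3 := volt_add h1 (h2.const_mul (-1)) p.ρ t
    rw [volt_const_mul] at h3
    simp only [Finset.sum_sub_distrib]
    convert h3 using 1
    · congr 1 with s
      ring
    · ring
  -- The sources cancel in the difference of the two systems.
  have key : ∀ i w, IsAdmissible 𝓕 μ w →
      pairing μ w (gameOp p 0 fun t ω => u i t ω - u' i t ω)
        + p.imp * pairing μ w (fun t ω => volt p.ρ (fun s => ∑ j, (u j s ω - u' j s ω)) t)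
        = 0 := by
    intro i w hw
    have h1 := hc i w hw
    have h2 := hc' i w hw
    rw [pairing_grad p hP hS i hw.sqInt] at h1
    rw [pairing_grad p hP hS' i hw.sqInt] at h2
    rw [pairing_congr (gameOp_sub p 0 (hS i) (hS' i)),
      pairing_sub hw.sqInt ((hS i).gameOp p 0) ((hS' i).gameOp p 0), hvolt w hw.sqInt]
    linarith
  -- Summing over the players first kills the aggregate difference. The coupling term then
  -- disappears, and coercivity applies to each player separately.
  have hzero : SameStrategy μ (fun t ω => ∑ i, (u i t ω - u' i t ω)) fun _ _ => 0 := by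
    refine sameStrategy_zero_of_gameOp_eq_zero p hNc hD.sqInt ?_
    have h1 := Finset.sum_congr (rfl : (Finset.univ : Finset (Fin N)) = Finset.univ)
      (fun i _ => key i _ hD)
    rw [Finset.sum_add_distrib, ← pairing_sum _ hD.sqInt (fun i => (hdS i).gameOp p 0),
      ← pairing_congr (gameOp_sum p 0 _ hdS), Finset.sum_const, Finset.card_univ,
      Fintype.card_fin, nsmul_eq_mul, Finset.sum_const_zero] at h1
    rw [pairing_gameOp_add_volt p _ hD.sqInt hD.sqInt]
    linarith
  have hvz : SameStrategy μ (fun t ω => volt p.ρ (fun s => ∑ j, (u j s ω - u' j s ω)) t)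
      fun _ _ => 0 := by
    refine ae_prod_of_ae_forall (p := fun t ω => volt p.ρ
      (fun s => ∑ j, (u j s ω - u' j s ω)) t = 0) ?_
    filter_upwards [ae_ae_swap (p := fun t ω => ∑ i, (u i t ω - u' i t ω) = 0) hzero] with ω hω t
    rw [volt_congr (g := fun _ => 0) hω]
    simp [volt]
  have h0 := sameStrategy_zero_of_gameOp_eq_zero p le_rfl (hdS i) (by
    have := key i _ (hd i)
    rw [pairing_congr hvz] at this
    simpa [pairing] using this)
  filter_upwards [h0] with z hz using sub_eq_zero.1 hz

end FirstOrder

/-! ### Bilinear identities for integrals in time. -/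

section Expansion

variable {T : ℝ} [hT : Fact (0 < T)]

lemma integral_mul_add_right {a b c : Time T → ℝ} (ha : MemLp a 2) (hb : MemLp b 2)
    (hc : MemLp c 2) : ∫ t, a t * (b t + c t) = (∫ t, a t * b t) + ∫ t, a t * c t := by
  simp only [mul_add]
  exact integral_add (ha.integrable_mul hb) (ha.integrable_mul hc)

lemma integral_mul_sub_right {a b c : Time T → ℝ} (ha : MemLp a 2) (hb : MemLp b 2)
    (hc : MemLp c 2) : ∫ t, a t * (b t - c t) = (∫ t, a t * b t) - ∫ t, a t * c t := by
  simp only [mul_sub]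
  exact integral_sub (ha.integrable_mul hb) (ha.integrable_mul hc)

lemma integral_mul_const_mul (a b : Time T → ℝ) (c : ℝ) :
    ∫ t, a t * (c * b t) = c * ∫ t, a t * b t := by
  rw [← integral_const_mul]
  congr 1 with t
  ring

lemma integral_sq_add {a b : Time T → ℝ} (ha : MemLp a 2) (hb : MemLp b 2) :
    ∫ t, (a t + b t) ^ 2 = (∫ t, a t ^ 2) + 2 * (∫ t, b t * a t) + ∫ t, b t ^ 2 := by
  have e : ∀ t, (a t + b t) ^ 2 = (a t ^ 2 + 2 * (b t * a t)) + b t ^ 2 := fun t => by ring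
  have h1 : Integrable fun t => b t * a t := hb.integrable_mul ha
  simp only [e]
  have h2 : Integrable fun t => a t ^ 2 + 2 * (b t * a t) := ha.integrable_sq.add (h1.const_mul 2)
  rw [integral_add h2 hb.integrable_sq, integral_add ha.integrable_sq (h1.const_mul 2), integral_const_mul]

lemma memLp_of_continuous {g : Time T → ℝ} (hg : Continuous g) : MemLp g 2 := by
  obtain ⟨C, hC⟩ := isCompact_univ.exists_bound_of_continuousOn hg.continuousOn
  exact MemLp.of_bound hg.aestronglyMeasurable C (ae_of_all _ fun t => hC t (Set.mem_univ t))

end Expansion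

/-! ### Quadratic expansion of the performance; Nash equilibria are critical points. -/

section Variation

variable {T : ℝ} [hT : Fact (0 < T)] {Ω : Type*} [mΩ : MeasurableSpace Ω]
  {μ : Measure Ω} [IsProbabilityMeasure μ] {𝓕 : Filtration (Time T) mΩ} {N : ℕ}

/-- The pathwise performance of player `i`. -/
noncomputable def payoff (p : Params N) (P : Time T → Ω → ℝ) (i : Fin N)
    (u : Fin N → Time T → Ω → ℝ) (ω : Ω) : ℝ :=
  (∫ t, execPrice p P u t ω * u i t ω)
      - p.lam * (∫ t, (u i t ω) ^ 2)
      - p.φ * (∫ t, (inventory p i (u i) t ω) ^ 2)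
      + inventory p i (u i) ⊤ ω * (P ⊤ ω - p.varrho * inventory p i (u i) ⊤ ω)

/-- The second order term of the performance in a player's own strategy. -/
noncomputable def quadCost (p : Params N) (f : Time T → ℝ) : ℝ :=
  p.imp * (∫ t, f t * volt p.ρ f t) + p.lam * (∫ t, f t ^ 2) + p.φ * (∫ t, volt 0 f t ^ 2)
    + p.varrho * (∫ t, f t) ^ 2

lemma quadCost_nonneg (p : Params N) {f : Time T → ℝ} (hf : Integrable f) : 0 ≤ quadCost p f := by
  have h1 := integral_mul_volt_nonneg hf p.ρ_pos.le
  have h2 : 0 ≤ ∫ t, f t ^ 2 := integral_nonneg fun t => sq_nonneg _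
  have h3 : 0 ≤ ∫ t, volt 0 f t ^ 2 := integral_nonneg fun t => sq_nonneg _
  have := p.imp_nonneg; have := p.lam_pos; have := p.φ_pos; have := p.varrho_pos
  unfold quadCost
  positivity

lemma quadCost_const_mul (p : Params N) (f : Time T → ℝ) (c : ℝ) :
    quadCost p (fun t => c * f t) = c ^ 2 * quadCost p f := by
  have e : ∀ t, c * f t * (c * volt p.ρ f t) = c ^ 2 * (f t * volt p.ρ f t) := fun t => by ring
  simp only [quadCost, volt_const_mul, mul_pow, e, integral_const_mul]
  ring

/-- An exact second order expansion along almost every path. Adjointness moves the Volterra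
operators off `h`, so that the first order terms assemble into a pairing of `h` with `grad`. -/
lemma payoff_update (p : Params N) (P : Time T → Ω → ℝ) (i : Fin N) (u : Fin N → Time T → Ω → ℝ)
    (h : Time T → Ω → ℝ) {ω : Ω} (hP : MemLp (fun t => P t ω) 2)
    (hu : ∀ j, MemLp (fun t => u j t ω) 2) (hh : MemLp (fun t => h t ω) 2) :
    payoff p P i (Function.update u i fun t ω => u i t ω + h t ω) ω
      = payoff p P i u ω - (∫ t, h t ω * grad p P u i t ω) - quadCost p fun t => h t ω := by
  have iu := fun j => (hu j).integrable one_le_two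
  have ih := hh.integrable one_le_two
  have isum : Integrable fun s => ∑ j, u j s ω := integrable_finsetSum _ fun j _ => iu j
  have cW := continuous_volt ih p.ρ
  have cH := continuous_volt ih 0
  have cX : Continuous fun t => inventory p i (u i) t ω := by
    simp only [inventory_eq]
    exact continuous_const.sub (continuous_volt (iu i) 0)
  have cD : Continuous fun t => distortion p u t ω := by
    simp only [distortion_eq]
    have := continuous_volt isum p.ρ
    fun_prop
  have hS : MemLp (fun t => execPrice p P u t ω) 2 := hP.sub ((memLp_of_continuous cD).const_mul _)
  have hW := memLp_of_continuous cW
  have hH := memLp_of_continuous cH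
  have hX := memLp_of_continuous cX
  have hA := memLp_of_continuous (continuous_voltAdj (iu i) p.ρ)
  have hB := memLp_of_continuous (continuous_voltAdj (integrable_of_continuous cX) 0)
  have adj1 : ∫ t, u i t ω * volt p.ρ (fun s => h s ω) t
      = ∫ t, h t ω * voltAdj p.ρ (fun s => u i s ω) t := integral_mul_volt ih (iu i) p.ρ
  have adj2 : ∫ t, inventory p i (u i) t ω * volt 0 (fun s => h s ω) t
      = ∫ t, h t ω * voltAdj 0 (fun s => inventory p i (u i) s ω) t :=
    integral_mul_volt ih (integrable_of_continuous cX) 0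
  have eI : ∀ t, inventory p i (fun t ω => u i t ω + h t ω) t ω
      = inventory p i (u i) t ω + (-1) * volt 0 (fun s => h s ω) t := fun t => by
    rw [inventory_eq, inventory_eq, volt_add (iu i) ih]
    ring
  have eIT : inventory p i (fun t ω => u i t ω + h t ω) ⊤ ω
      = inventory p i (u i) ⊤ ω - ∫ s, h s ω := by
    rw [inventory_top, inventory_top, integral_add (iu i) ih]
    ring
  have eS : ∀ t, execPrice p P (Function.update u i fun t ω => u i t ω + h t ω) t ω
      = execPrice p P u t ω - p.imp * volt p.ρ (fun s => h s ω) t := fun t => by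
    have e : ∀ s, ∑ j, Function.update u i (fun t ω => u i t ω + h t ω) j s ω
        = (∑ j, u j s ω) + h s ω := fun s => by
      rw [← Finset.add_sum_erase _ _ (Finset.mem_univ i),
        ← Finset.add_sum_erase _ (fun j => u j s ω) (Finset.mem_univ i), Function.update_self,
        Finset.sum_congr rfl fun j hj => by rw [Function.update_of_ne (Finset.ne_of_mem_erase hj)]]
      ring
    rw [execPrice, execPrice, distortion_eq, distortion_eq, Params.imp]
    simp only [e]
    rw [volt_add isum ih]
    ring
  have hg : ∫ t, h t ω * grad p P u i t ω
      = 2 * p.lam * (∫ t, h t ω * u i t ω) - (∫ t, h t ω * execPrice p P u t ω)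
        + p.imp * (∫ t, h t ω * voltAdj p.ρ (fun s => u i s ω) t)
        - 2 * p.φ * (∫ t, h t ω * voltAdj 0 (fun s => inventory p i (u i) s ω) t)
        + (P ⊤ ω - 2 * p.varrho * inventory p i (u i) ⊤ ω) * ∫ t, h t ω := by
    have e : ∀ t, h t ω * grad p P u i t ω = h t ω * ((2 * p.lam * u i t ω - execPrice p P u t ω
        + p.imp * voltAdj p.ρ (fun s => u i s ω) t)
        - 2 * p.φ * voltAdj 0 (fun s => inventory p i (u i) s ω) t)
        + (P ⊤ ω - 2 * p.varrho * inventory p i (u i) ⊤ ω) * h t ω := fun t => by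
      rw [grad, execPrice]; ring
    have m1 := (hu i).const_mul (2 * p.lam)
    have m2 := hA.const_mul p.imp
    have m3 := hB.const_mul (2 * p.φ)
    have m4 : MemLp (fun t => 2 * p.lam * u i t ω - execPrice p P u t ω) 2 := m1.sub hS
    have m5 : MemLp (fun t => 2 * p.lam * u i t ω - execPrice p P u t ω
        + p.imp * voltAdj p.ρ (fun s => u i s ω) t) 2 := m4.add m2
    have m6 : Integrable fun t => h t ω * (2 * p.lam * u i t ω - execPrice p P u t ω
        + p.imp * voltAdj p.ρ (fun s => u i s ω) t
        - 2 * p.φ * voltAdj 0 (fun s => inventory p i (u i) s ω) t) :=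
      hh.integrable_mul (m5.sub m3)
    simp only [e]
    rw [integral_add m6 (ih.const_mul _),
      integral_mul_sub_right hh m5 m3, integral_mul_add_right hh m4 m2,
      integral_mul_sub_right hh m1 hS, integral_mul_const_mul, integral_mul_const_mul,
      integral_mul_const_mul, integral_const_mul]
  have mW := hW.const_mul p.imp
  have mH := hH.const_mul (-1)
  have e1 : ∫ t, execPrice p P (Function.update u i fun t ω => u i t ω + h t ω) t ω
        * (u i t ω + h t ω)
      = (∫ t, execPrice p P u t ω * u i t ω) + (∫ t, h t ω * execPrice p P u t ω)
        - p.imp * (∫ t, u i t ω * volt p.ρ (fun s => h s ω) t)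
        - p.imp * (∫ t, h t ω * volt p.ρ (fun s => h s ω) t) := by
    simp only [eS]
    have m4 : MemLp (fun t => execPrice p P u t ω - p.imp * volt p.ρ (fun s => h s ω) t) 2 :=
      hS.sub mW
    rw [integral_mul_add_right m4 (hu i) hh]
    simp only [mul_comm _ (u i _ ω), mul_comm _ (h _ ω)]
    rw [integral_mul_sub_right (hu i) hS mW, integral_mul_sub_right hh hS mW,
      integral_mul_const_mul, integral_mul_const_mul]
    ring
  have e3 : ∫ t, inventory p i (fun t ω => u i t ω + h t ω) t ω ^ 2
      = (∫ t, inventory p i (u i) t ω ^ 2)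
        - 2 * (∫ t, inventory p i (u i) t ω * volt 0 (fun s => h s ω) t)
        + ∫ t, volt 0 (fun s => h s ω) t ^ 2 := by
    have e : ∀ t, -1 * volt 0 (fun s => h s ω) t * inventory p i (u i) t ω
        = -1 * (inventory p i (u i) t ω * volt 0 (fun s => h s ω) t) := fun t => by ring
    simp only [eI]
    rw [integral_sq_add hX mH]
    simp only [e, mul_pow, integral_const_mul]
    ring
  simp only [payoff, Function.update_self]
  rw [e1, integral_sq_add (hu i) hh, e3, eIT, hg, adj1, adj2, quadCost]
  ring

lemma SqInt.inventory {v : Time T → Ω → ℝ} (hv : SqInt μ v) (p : Params N) (i : Fin N) :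
    SqInt μ (inventory p i v) := by
  have h : SqInt μ fun t ω => p.x i - PriceImpactGame.volt 0 (fun s => v s ω) t :=
    MemLp.sub (SqInt.of_const (memLp_const (p.x i))) (hv.volt le_rfl)
  exact h.congr (ae_of_all _ fun z => (inventory_eq p i v z.1 z.2).symm)

lemma sqInt_distortion (p : Params N) {u : Fin N → Time T → Ω → ℝ} (hu : ∀ j, SqInt μ (u j)) :
    SqInt μ (distortion p u) := by
  have h1 : SqInt μ fun (t : Time T) (_ : Ω) => Real.exp (-p.ρ * (t : ℝ)) * p.y :=
    SqInt.of_continuous (g := fun t : Time T => Real.exp (-p.ρ * (t : ℝ)) * p.y) (by fun_prop)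
  have h2 : SqInt μ fun t ω => p.γ / N * PriceImpactGame.volt p.ρ (fun s => ∑ j, u j s ω) t :=
    MemLp.const_mul ((SqInt.finsetSum _ hu).volt p.ρ_pos.le) (p.γ / N)
  have h3 : SqInt μ fun t ω => Real.exp (-p.ρ * (t : ℝ)) * p.y
      + p.γ / N * PriceImpactGame.volt p.ρ (fun s => ∑ j, u j s ω) t := MemLp.add h1 h2
  exact h3.congr (ae_of_all _ fun z => (distortion_eq p u z.1 z.2).symm)

lemma SqInt.memLp_inventory_top {v : Time T → Ω → ℝ} (hv : SqInt μ v) (p : Params N) (i : Fin N) :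
    MemLp (fun ω => PriceImpactGame.inventory p i v ⊤ ω) 2 μ := by
  simp only [inventory_top]
  exact (memLp_const _).sub hv.memLp_integral

lemma integrable_payoff (p : Params N) {P : Time T → Ω → ℝ} (hP : IsSqIntPrice 𝓕 μ P) (i : Fin N)
    {u : Fin N → Time T → Ω → ℝ} (hu : ∀ j, SqInt μ (u j)) : Integrable (payoff p P i u) μ := by
  have hS : SqInt μ (execPrice p P u) := MemLp.sub hP.sqInt (MemLp.const_mul (sqInt_distortion p hu) _)
  have h1 := hS.integrable_integral (hu i)
  have h2 := (hu i).integrable_integral (hu i)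
  have h3 := ((hu i).inventory p i).integrable_integral ((hu i).inventory p i)
  have h4 := (hu i).memLp_inventory_top p i
  have h5 : Integrable (fun ω => inventory p i (u i) ⊤ ω
      * (P ⊤ ω - p.varrho * inventory p i (u i) ⊤ ω)) μ :=
    h4.integrable_mul (hP.memLp_top.sub (h4.const_mul _))
  simp only [← pow_two] at h2 h3
  exact ((h1.sub (h2.const_mul _)).sub (h3.const_mul _)).add h5

lemma integrable_quadCost (p : Params N) {h : Time T → Ω → ℝ} (hh : SqInt μ h) :
    Integrable (fun ω => quadCost p fun t => h t ω) μ := by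
  have hW := hh.volt p.ρ_pos.le
  have hH := hh.volt le_rfl
  have h1 := hh.integrable_integral hW
  have h2 := hh.integrable_integral hh
  have h3 := hH.integrable_integral hH
  simp only [← pow_two] at h2 h3
  exact (((h1.const_mul _).add (h2.const_mul _)).add (h3.const_mul _)).add
    (hh.memLp_integral.integrable_sq.const_mul _)

lemma performance_update (p : Params N) {P : Time T → Ω → ℝ} (hP : IsSqIntPrice 𝓕 μ P) (i : Fin N)
    {u : Fin N → Time T → Ω → ℝ} (hu : ∀ j, SqInt μ (u j)) {h : Time T → Ω → ℝ} (hh : SqInt μ h) :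
    performance p μ P i (Function.update u i fun t ω => u i t ω + h t ω)
      = performance p μ P i u - pairing μ h (grad p P u i) - ∫ ω, quadCost p fun t => h t ω ∂μ := by
  have hg := sqInt_grad p hP hu i
  have e : ∀ w, performance p μ P i w = ∫ ω, payoff p P i w ω ∂μ := fun w => rfl
  have i1 : Integrable (fun ω => payoff p P i u ω - ∫ t, h t ω * grad p P u i t ω) μ :=
    (integrable_payoff p hP i hu).sub (hh.integrable_integral hg)
  rw [e, e, pairing, hh.integral_eq hg, ← integral_sub (integrable_payoff p hP i hu)
    (hh.integrable_integral hg), ← integral_sub i1 (integrable_quadCost p hh)]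
  refine integral_congr_ae ?_
  filter_upwards [hP.sqInt.ae_memLp, ae_all_iff.2 fun j => (hu j).ae_memLp, hh.ae_memLp]
    with ω h1 h2 h3
  exact payoff_update p P i u h h1 h2 h3

/-- Nash equilibria are the solutions of the first order conditions. -/
theorem isNash_iff_isCritical (p : Params N) {P : Time T → Ω → ℝ} (hP : IsSqIntPrice 𝓕 μ P)
    {u : Fin N → Time T → Ω → ℝ} (hu : ∀ j, IsAdmissible 𝓕 μ (u j)) :
    IsNash p 𝓕 μ P u ↔ IsCritical p 𝓕 μ P u := by
  have hS := fun j => (hu j).sqInt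
  constructor
  · rintro ⟨-, h⟩ i w hw
    set a := pairing μ w (grad p P u i) with ha
    set q := ∫ ω, quadCost p (fun t => w t ω) ∂μ with hq
    have hq0 : 0 ≤ q := integral_nonneg_of_ae (by
      filter_upwards [hw.sqInt.ae_integrable] with ω hω using quadCost_nonneg p hω)
    have key : ∀ c : ℝ, -(c * a) - c ^ 2 * q ≤ 0 := by
      intro c
      have h1 := h i _ ((hu i).add (hw.const_mul c))
      rw [performance_update p hP i hS (hw.const_mul c).sqInt] at h1
      have e1 : pairing μ (fun t ω => c * w t ω) (grad p P u i) = c * a := by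
        simp only [ha, pairing, mul_assoc, integral_const_mul]
      have e2 : ∫ ω, quadCost p (fun t => c * w t ω) ∂μ = c ^ 2 * q := by
        simp only [quadCost_const_mul, integral_const_mul, hq]
      rw [e1, e2] at h1
      linarith
    -- This step size also works when `q = 0`, and the resulting gain is the perfect square `(a / (q
    -- + 1))²`, which optimality forces to vanish.
    have h1 := key (-a / (q + 1))
    have h2 : -(-a / (q + 1) * a) - (-a / (q + 1)) ^ 2 * q = (a / (q + 1)) ^ 2 := by
      field_simp
      ring
    rw [h2] at h1
    have h3 := pow_eq_zero_iff (two_ne_zero) |>.1 (le_antisymm h1 (sq_nonneg _))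
    exact (div_eq_zero_iff.1 h3).resolve_right (by positivity)
  · intro h
    refine ⟨hu, fun i v hv => ?_⟩
    have hd := hv.sub (hu i)
    have e : v = fun t ω => u i t ω + (v t ω - u i t ω) := by
      ext t ω
      ring
    rw [e, performance_update p hP i hS hd.sqInt, h i _ hd]
    have hq0 : 0 ≤ ∫ ω, quadCost p (fun t => v t ω - u i t ω) ∂μ := integral_nonneg_of_ae (by
      filter_upwards [hd.sqInt.ae_integrable] with ω hω using quadCost_nonneg p hω)
    linarith

end Variation

/-! ### Càdlàg paths and the pathwise backward equation. -/

section Paths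

variable {T : ℝ} [hT : Fact (0 < T)]

/-- One-sided limits bound the path near each time; compactness makes the bound global. -/
lemma IsCadlag.exists_bound {f : Time T → ℝ} (hf : IsCadlag f) : ∃ C, ∀ t, |f t| ≤ C := by
  have h : ∃ C, ∀ t ∈ (Set.univ : Set (Time T)), |f t| ≤ C := by
    refine isCompact_univ.induction_on (p := fun s => ∃ C, ∀ t ∈ s, |f t| ≤ C) ⟨0, by simp⟩ ?_ ?_ ?_
    · rintro s t hst ⟨C, hC⟩
      exact ⟨C, fun x hx => hC x (hst hx)⟩
    · rintro s t ⟨C, hC⟩ ⟨D, hD⟩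
      refine ⟨max C D, fun x hx => ?_⟩
      rcases hx with hx | hx
      · exact (hC x hx).trans (le_max_left _ _)
      · exact (hD x hx).trans (le_max_right _ _)
    · intro x _
      obtain ⟨l, hl⟩ := (hf x).2
      have h1 : ∀ᶠ t in 𝓝[<] x, |f t| ≤ max (|l| + 1) (|f x| + 1) := by
        filter_upwards [hl.abs.eventually (Iio_mem_nhds (lt_add_one |l|))] with t ht
        exact (le_of_lt ht).trans (le_max_left _ _)
      have h2 : ∀ᶠ t in 𝓝[≥] x, |f t| ≤ max (|l| + 1) (|f x| + 1) := by
        filter_upwards [(hf x).1.tendsto.abs.eventually (Iio_mem_nhds (lt_add_one |f x|))] with t ht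
        exact (le_of_lt ht).trans (le_max_right _ _)
      have h3 : ∀ᶠ t in 𝓝 x, |f t| ≤ max (|l| + 1) (|f x| + 1) := by
        rw [← nhdsLT_sup_nhdsGE]
        exact eventually_sup.2 ⟨h1, h2⟩
      exact ⟨_, by rwa [nhdsWithin_univ], _, fun t ht => ht⟩
  obtain ⟨C, hC⟩ := h
  exact ⟨C, fun t => hC t (Set.mem_univ t)⟩

lemma IsCadlag.stronglyMeasurable {f : Time T → ℝ} (hf : IsCadlag f) : StronglyMeasurable f := by
  refine stronglyMeasurable_of_tendsto atTop (f := fun n s => f (grid n (gridIndex T n s)))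
    (fun n => ?_) (tendsto_pi_nhds.2 fun s => ?_)
  · have h : Measurable fun s : Time T => gridIndex T n s := by
      unfold gridIndex
      exact (Nat.measurable_floor.comp (by fun_prop)).add_const 1
    exact ((measurable_from_nat (f := fun k => f (grid n k))).comp h).stronglyMeasurable
  · exact (hf s).1.tendsto.comp (tendsto_nhdsWithin_iff.2
      ⟨tendsto_grid_gridIndex s, Eventually.of_forall fun n => le_grid_gridIndex n s⟩)

lemma IsCadlag.integrable {f : Time T → ℝ} (hf : IsCadlag f) : Integrable f := by
  obtain ⟨C, hC⟩ := hf.exists_bound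
  exact Integrable.of_bound hf.stronglyMeasurable.aestronglyMeasurable C (ae_of_all _ hC)

lemma setIntegral_Iic_bot (f : Time T → ℝ) : ∫ s in Set.Iic (⊥ : Time T), f s = 0 := by
  rw [Set.Iic_bot]
  exact setIntegral_measure_zero _ (measure_singleton _)

lemma eq_increment_of_primitive {f K h : Time T → ℝ} {c : ℝ}
    (hf : ∀ t, f t = c + (∫ s in Set.Iic t, h s) + K t) (t : Time T) :
    f t = f ⊥ + (∫ s in Set.Iic t, h s) + (K t - K ⊥) := by
  have h0 := hf ⊥
  rw [setIntegral_Iic_bot] at h0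
  rw [hf t, h0]
  ring

/-- Variation of constants: `e^{-rt} Z` has differential `c e^{-rt} u dt + e^{-rt} dK`, and
integrating from `t` to `T` with `Z_T = 0` gives the claim. The `K` terms on the right are the
increment from `T` back to `t` of `expTransform (-r)`. -/
lemma add_voltAdj_eq_of_backward {Z K u : Time T → ℝ} (hZ : Integrable Z) (hK : Integrable K)
    (hu : Integrable u) {r c : ℝ}
    (h : ∀ t, Z t = Z ⊥ + (∫ s in Set.Iic t, (r * Z s + c * u s)) + (K t - K ⊥)) (hT : Z ⊤ = 0)
    (t : Time T) :
    Z t + c * voltAdj r u t = Real.exp (r * t)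
      * ((Real.exp (-r * t) * K t - ∫ s in Set.Iic t, -r * Real.exp (-r * s) * K s)
        - (Real.exp (-r * (⊤ : Time T)) * K ⊤
          - ∫ s in Set.Iic (⊤ : Time T), -r * Real.exp (-r * s) * K s)) := by
  have hh : Integrable fun s => r * Z s + c * u s := (hZ.const_mul r).add (hu.const_mul c)
  -- Only `Z - K` is absolutely continuous, so the integration by parts is applied to this
  -- difference.
  have hg : ∀ t, Z t - K t = (Z ⊥ - K ⊥) + ∫ s in Set.Iic t, (r * Z s + c * u s) := fun t => by
    rw [h t]; ring
  have iK : Integrable fun s : Time T => -r * Real.exp (-r * s) * K s :=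
    integrable_continuous_mul hK (by fun_prop)
  have iu : Integrable fun s : Time T => Real.exp (-r * s) * u s :=
    integrable_continuous_mul hu (by fun_prop)
  have key : ∀ t : Time T, Real.exp (-r * t) * Z t = (Z ⊥ - K ⊥)
      + (Real.exp (-r * t) * K t - ∫ s in Set.Iic t, -r * Real.exp (-r * s) * K s)
      + c * ∫ s in Set.Iic t, Real.exp (-r * s) * u s := fun t => by
    have h1 := exp_mul_eq_of_primitive (g := fun t => Z t - K t) hh hg (-r) t
    have h2 : ∀ s : Time T, -r * Real.exp (-r * s) * (Z s - K s)
        + Real.exp (-r * s) * (r * Z s + c * u s)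
        = c * (Real.exp (-r * s) * u s) - -r * Real.exp (-r * s) * K s := fun s => by ring
    simp only [h2] at h1
    rw [integral_sub (iu.const_mul c).integrableOn iK.integrableOn, integral_const_mul] at h1
    linarith
  have hTop := key ⊤
  have ht := key t
  rw [hT, mul_zero] at hTop
  have e : Z t = Real.exp (r * t) * (Real.exp (-r * t) * Z t) := by
    rw [← mul_assoc, ← Real.exp_add]
    simp
  have eTop : ∫ s in Set.Iic (⊤ : Time T), Real.exp (-r * s) * u s
      = ∫ s : Time T, Real.exp (-r * s) * u s := by
    rw [Set.Iic_top, setIntegral_univ]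
  rw [voltAdj_eq hu, e, ht, ← eTop]
  linear_combination (-Real.exp (r * t)) * hTop

end Paths

/-! ### Solutions of the system satisfy the first order conditions. -/

section Forward

variable {T : ℝ} [hT : Fact (0 < T)] {Ω : Type*} [mΩ : MeasurableSpace Ω]
  {μ : Measure Ω} [IsProbabilityMeasure μ] {𝓕 : Filtration (Time T) mΩ} {N : ℕ}

lemma continuous_distortion (p : Params N) {u : Fin N → Time T → Ω → ℝ} {ω : Ω}
    (hu : Integrable fun s => ∑ j, u j s ω) : Continuous fun t => distortion p u t ω := by
  simp only [distortion_eq]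
  have := continuous_volt hu p.ρ
  fun_prop

lemma distortion_eq_primitive (p : Params N) {u : Fin N → Time T → Ω → ℝ} {ω : Ω}
    (hu : Integrable fun s => ∑ j, u j s ω) (t : Time T) :
    distortion p u t ω = p.y
      + ∫ s in Set.Iic t, (-p.ρ * distortion p u s ω + p.γ / (N : ℝ) * ∑ j, u j s ω) := by
  have hv := integrable_of_continuous (continuous_volt hu p.ρ)
  have i1 : Integrable fun s : Time T => p.y * (-p.ρ * Real.exp (-p.ρ * s)) :=
    integrable_of_continuous (by fun_prop)
  have i2 : Integrable fun s => p.γ / (N : ℝ) * ((∑ j, u j s ω)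
      - p.ρ * volt p.ρ (fun s => ∑ j, u j s ω) s) := (hu.sub (hv.const_mul _)).const_mul _
  have e : ∀ s, -p.ρ * distortion p u s ω + p.γ / (N : ℝ) * ∑ j, u j s ω
      = p.y * (-p.ρ * Real.exp (-p.ρ * s))
        + p.γ / (N : ℝ) * ((∑ j, u j s ω) - p.ρ * volt p.ρ (fun s => ∑ j, u j s ω) s) :=
    fun s => by rw [distortion_eq]; ring
  simp only [e]
  rw [integral_add i1.integrableOn i2.integrableOn, integral_const_mul (p.y),
    integral_const_mul (p.γ / N), primitive_exp, ← volt_eq_primitive hu, distortion_eq]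
  ring

lemma eq_distortion_of_primitive (p : Params N) {u : Fin N → Time T → Ω → ℝ} {ω : Ω}
    (hu : Integrable fun s => ∑ j, u j s ω) {Y : Time T → ℝ} (hY : Integrable Y)
    (h : ∀ t, Y t = p.y + ∫ s in Set.Iic t, (-p.ρ * Y s + p.γ / (N : ℝ) * ∑ j, u j s ω))
    (t : Time T) : Y t = distortion p u t ω := by
  have hD := integrable_of_continuous (continuous_distortion p hu)
  refine sub_eq_zero.1 (eq_zero_of_linear_ode (D := fun t => Y t - distortion p u t ω)
    (hY.sub hD) (-p.ρ) (fun t => ?_) t)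
  have i1 : Integrable fun s => -p.ρ * Y s + p.γ / (N : ℝ) * ∑ j, u j s ω :=
    (hY.const_mul _).add (hu.const_mul _)
  have i2 : Integrable fun s => -p.ρ * distortion p u s ω + p.γ / (N : ℝ) * ∑ j, u j s ω :=
    (hD.const_mul _).add (hu.const_mul _)
  have e : ∀ s, -p.ρ * (Y s - distortion p u s ω)
      = (-p.ρ * Y s + p.γ / (N : ℝ) * ∑ j, u j s ω)
        - (-p.ρ * distortion p u s ω + p.γ / (N : ℝ) * ∑ j, u j s ω) := fun s => by ring
  simp only [e]
  rw [integral_sub i1.integrableOn i2.integrableOn, h t, distortion_eq_primitive p hu t]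
  ring

variable {p : Params N} {P : Time T → Ω → ℝ} {X : Fin N → Time T → Ω → ℝ} {Y : Time T → Ω → ℝ}
  {u Z M K : Fin N → Time T → Ω → ℝ}

namespace IsFBSDESolution

lemma ae_integrable_sum (h : IsFBSDESolution p 𝓕 μ P X Y u Z M K) :
    ∀ᵐ ω ∂μ, Integrable fun s => ∑ j, u j s ω :=
  (SqInt.finsetSum Finset.univ fun j => (h.admissible_u j).sqInt).ae_integrable

lemma ae_eq_distortion (h : IsFBSDESolution p 𝓕 μ P X Y u Z M K) :
    ∀ᵐ ω ∂μ, ∀ t, Y t ω = distortion p u t ω := by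
  filter_upwards [h.ae_integrable_sum, h.cadlag_Y.cadlag, h.eq_Y] with ω h1 h2 h3
  exact eq_distortion_of_primitive p h1 h2.integrable h3

lemma ae_add_voltAdj_eq (h : IsFBSDESolution p 𝓕 μ P X Y u Z M K) (i : Fin N) :
    ∀ᵐ ω ∂μ, ∀ t : Time T, Z i t ω + p.imp * voltAdj p.ρ (fun s => u i s ω) t
      = Real.exp (p.ρ * t) * (expTransform (-p.ρ) (K i) t ω - expTransform (-p.ρ) (K i) ⊤ ω) := by
  filter_upwards [(h.admissible_u i).sqInt.ae_integrable, (h.cadlag_Z i).cadlag,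
    (h.martingale_K i).cadlag, h.eq_Z i, h.terminal_Z i] with ω h1 h2 h3 h4 h5 t
  exact add_voltAdj_eq_of_backward h2.integrable h3.integrable h1 h4 h5 t

/-- On a solution, `grad` consists of future martingale increments only: its adapted part and its
anticipating integrals are tied together by the dynamics and the terminal conditions. -/
lemma ae_grad_eq (h : IsFBSDESolution p 𝓕 μ P X Y u Z M K) (i : Fin N) :
    ∀ᵐ ω ∂μ, ∀ t : Time T, grad p P u i t ω
      = Real.exp (p.ρ * t) * (expTransform (-p.ρ) (K i) t ω - expTransform (-p.ρ) (K i) ⊤ ω)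
        + (2 * p.lam * (M i t ω - M i ⊤ ω) + -1 * (K i t ω - K i ⊤ ω)) := by
  have hlam := p.lam_pos
  filter_upwards [h.ae_add_voltAdj_eq i, h.ae_eq_distortion, h.eq_X i, h.eq_Y, h.eq_Z i, h.eq_u i,
    h.terminal_u i, h.terminal_Z i, (h.cadlag_X i).cadlag, h.cadlag_Y.cadlag, (h.cadlag_Z i).cadlag,
    SqInt.ae_all_integrable fun j => (h.admissible_u j).sqInt]
    with ω hadj hD hX hY hZ hu huT hZT cX cY cZ iu t
  have iX := cX.integrable
  have iY := cY.integrable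
  have iZ := cZ.integrable
  have isum : Integrable fun s => ∑ j, u j s ω := integrable_finsetSum _ fun j _ => iu j
  have iu' : Integrable fun s => ∑ j ∈ Finset.univ.erase i, u j s ω :=
    integrable_finsetSum _ fun j _ => iu j
  -- A conserved quantity: all drifts cancel and only `2λ M - K` moves. Comparing its values at `t`
  -- and at `T` yields the claim.
  have key : ∀ t, 2 * p.lam * u i t ω - P t ω + p.κ * Y t ω - Z i t ω
      + 2 * p.φ * (∫ s in Set.Iic t, X i s ω)
      = (2 * p.lam * u i ⊥ ω - P ⊥ ω + p.κ * p.y - Z i ⊥ ω - 2 * p.lam * M i ⊥ ω + K i ⊥ ω)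
        + 2 * p.lam * M i t ω - K i t ω := by
    intro t
    have i1 : Integrable fun s => -p.ρ * Y s ω + p.γ / (N : ℝ) * ∑ j, u j s ω :=
      (iY.const_mul _).add (isum.const_mul _)
    have i2 : Integrable fun s => p.ρ * Z i s ω + p.γ * p.κ / (N : ℝ) * u i s ω :=
      (iZ.const_mul _).add ((iu i).const_mul _)
    -- The drift of `Z` supplies the own rate `u i` that is missing from the sum over the other
    -- players; together with it the sum becomes the drift of `Y`.
    have e : ∀ s, p.κ * p.ρ * Y s ω / (2 * p.lam)
          - p.γ * p.κ / (2 * p.lam * (N : ℝ)) * ∑ j ∈ Finset.univ.erase i, u j s ω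
          - p.φ * X i s ω / p.lam + p.ρ * Z i s ω / (2 * p.lam)
        = (1 / (2 * p.lam)) * ((p.ρ * Z i s ω + p.γ * p.κ / (N : ℝ) * u i s ω)
          - p.κ * (-p.ρ * Y s ω + p.γ / (N : ℝ) * ∑ j, u j s ω) - 2 * p.φ * X i s ω) := by
      intro s
      rw [← Finset.add_sum_erase _ (fun j => u j s ω) (Finset.mem_univ i)]
      have hN : (N : ℝ) ≠ 0 := by
        have := i.pos
        positivity
      field_simp
      ring
    have h1 := hu t
    simp only [e] at h1
    have i3 : Integrable fun s => (p.ρ * Z i s ω + p.γ * p.κ / (N : ℝ) * u i s ω)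
          - p.κ * (-p.ρ * Y s ω + p.γ / (N : ℝ) * ∑ j, u j s ω) := i2.sub (i1.const_mul _)
    rw [integral_const_mul, integral_sub i3.integrableOn (iX.const_mul _).integrableOn,
      integral_sub i2.integrableOn (i1.const_mul _).integrableOn, integral_const_mul,
      integral_const_mul] at h1
    rw [h1, hZ t, hY t]
    field_simp
    ring
  have eI : ∀ t, inventory p i (u i) t ω = X i t ω := fun t => (hX t).symm
  have eX : voltAdj 0 (fun s => inventory p i (u i) s ω) t
      = (∫ s, X i s ω) - ∫ s in Set.Iic t, X i s ω := by
    simp only [eI]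
    rw [voltAdj_zero, setIntegral_Ici_eq iX]
  have kt := key t
  have kT := key ⊤
  rw [huT, hZT, Set.Iic_top, setIntegral_univ] at kT
  have kT' : 2 * p.lam * (p.varrho / p.lam * X i ⊤ ω - p.κ / (2 * p.lam) * Y ⊤ ω)
      = 2 * p.varrho * X i ⊤ ω - p.κ * Y ⊤ ω := by
    field_simp
  rw [kT'] at kT
  rw [← hadj t, grad, eX, eI, ← hD t]
  linear_combination kt - kT

/-- The strategies of a solution satisfy the first order conditions. -/
theorem isCritical (h : IsFBSDESolution p 𝓕 μ P X Y u Z M K) (h𝓕 : IsCompleteFiltration 𝓕 μ) :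
    IsCritical p 𝓕 μ P u := by
  intro i w hw
  have hm := (h.martingale_K i).expTransform h𝓕 (-p.ρ)
  have hE : Continuous fun t : Time T => Real.exp (p.ρ * t) := by fun_prop
  have hsq : ∀ {L : Time T → Ω → ℝ} {g : Time T → ℝ}, IsSqIntMartingale 𝓕 μ L → Continuous g →
      SqInt μ fun t ω => g t * (L t ω - L ⊤ ω) := fun hL hg =>
    SqInt.continuous_mul hg (MemLp.sub (hL.sqInt h𝓕) (SqInt.of_const (hL.sqIntegrable ⊤)))
  have t1 : pairing μ w (fun t ω => Real.exp (p.ρ * t)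
      * (expTransform (-p.ρ) (K i) t ω - expTransform (-p.ρ) (K i) ⊤ ω)) = 0 :=
    hm.integral_test_eq_zero h𝓕 hw hE
  have t2 : pairing μ w (fun t ω => 2 * p.lam * (M i t ω - M i ⊤ ω)) = 0 :=
    (h.martingale_M i).integral_test_eq_zero h𝓕 hw (continuous_const (y := 2 * p.lam))
  have t3 : pairing μ w (fun t ω => -1 * (K i t ω - K i ⊤ ω)) = 0 :=
    (h.martingale_K i).integral_test_eq_zero h𝓕 hw (continuous_const (y := -1))
  have s2 := hsq (h.martingale_M i) (continuous_const (y := 2 * p.lam))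
  have s3 := hsq (h.martingale_K i) (continuous_const (y := (-1 : ℝ)))
  have hgrad : SameStrategy μ (grad p P u i) fun t ω => Real.exp (p.ρ * t)
      * (expTransform (-p.ρ) (K i) t ω - expTransform (-p.ρ) (K i) ⊤ ω)
        + (2 * p.lam * (M i t ω - M i ⊤ ω) + -1 * (K i t ω - K i ⊤ ω)) :=
    ae_prod_of_ae_forall (p := fun t ω => grad p P u i t ω = Real.exp (p.ρ * t)
      * (expTransform (-p.ρ) (K i) t ω - expTransform (-p.ρ) (K i) ⊤ ω)
        + (2 * p.lam * (M i t ω - M i ⊤ ω) + -1 * (K i t ω - K i ⊤ ω))) (h.ae_grad_eq i)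
  have s4 : SqInt μ fun t ω => 2 * p.lam * (M i t ω - M i ⊤ ω) + -1 * (K i t ω - K i ⊤ ω) :=
    MemLp.add s2 s3
  rw [pairing_congr hgrad, pairing_add hw.sqInt (hsq hm hE) s4, t1, pairing_add hw.sqInt s2 s3, t2, t3]
  ring

end IsFBSDESolution

end Forward

/-! ### From the first order conditions to a solution of the system. -/

section Existence

variable {T : ℝ} [hT : Fact (0 < T)] {Ω : Type*} [mΩ : MeasurableSpace Ω]
  {μ : Measure Ω} [IsProbabilityMeasure μ] {𝓕 : Filtration (Time T) mΩ} {N : ℕ}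

lemma exists_cadlag_martingale_closing [𝓕.IsRightContinuous] (h𝓕 : IsCompleteFiltration 𝓕 μ)
    {ξ : Ω → ℝ} (hξ : MemLp ξ 2 μ) (hm : StronglyMeasurable[𝓕 ⊤] ξ) :
    ∃ M : Time T → Ω → ℝ, IsSqIntMartingale 𝓕 μ M ∧ ∀ᵐ ω ∂μ, M ⊤ ω = ξ ω := by
  obtain ⟨M, hM, h⟩ := exists_cadlag_martingale h𝓕 hξ
  refine ⟨M, hM, ?_⟩
  have h1 := h ⊤
  rwa [condExp_of_stronglyMeasurable (𝓕.le ⊤) hm (hξ.integrable one_le_two)] at h1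

lemma IsAdmissible.continuous_mul {v : Time T → Ω → ℝ} (hv : IsAdmissible 𝓕 μ v)
    {g : Time T → ℝ} (hg : Continuous g) : IsAdmissible 𝓕 μ fun t ω => g t * v t ω :=
  isAdmissible_iff.2 ⟨IsStronglyProgressive.mul (isStronglyProgressive_of_continuous_const hg) hv.1,
    hv.sqInt.continuous_mul hg⟩

lemma IsAdmissible.inventory {v : Time T → Ω → ℝ} (hv : IsAdmissible 𝓕 μ v) (p : Params N)
    (i : Fin N) : IsAdmissible 𝓕 μ (inventory p i v) := by
  have h : IsAdmissible 𝓕 μ fun (_ : Time T) (_ : Ω) => p.x i :=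
    isAdmissible_iff.2 ⟨isStronglyProgressive_const 𝓕 _, SqInt.of_const (memLp_const _)⟩
  have e : PriceImpactGame.inventory p i v
      = fun t ω => p.x i - PriceImpactGame.volt 0 (fun s => v s ω) t := by
    ext t ω
    exact inventory_eq p i v t ω
  rw [e]
  exact h.sub (hv.volt le_rfl)

lemma IsAdmissible.cadlagAdapted_inventory {v : Time T → Ω → ℝ} (hv : IsAdmissible 𝓕 μ v)
    (p : Params N) (i : Fin N) : IsCadlagAdapted 𝓕 μ (PriceImpactGame.inventory p i v) := by
  have e : PriceImpactGame.inventory p i v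
      = fun t ω => p.x i - PriceImpactGame.volt 0 (fun s => v s ω) t := by
    ext t ω
    exact inventory_eq p i v t ω
  rw [e]
  exact (IsCadlagAdapted.of_continuous (g := fun _ => p.x i) continuous_const).sub
    (hv.cadlagAdapted_volt 0)

lemma cadlagAdapted_distortion {u : Fin N → Time T → Ω → ℝ} (hu : ∀ j, IsAdmissible 𝓕 μ (u j))
    (p : Params N) : IsCadlagAdapted 𝓕 μ (distortion p u) := by
  have e : distortion p u = fun (t : Time T) ω => Real.exp (-p.ρ * (t : ℝ)) * p.y
      + p.γ / N * PriceImpactGame.volt p.ρ (fun s => ∑ j, u j s ω) t := by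
    ext t ω
    exact distortion_eq p u t ω
  rw [e]
  exact (IsCadlagAdapted.of_continuous (g := fun t : Time T => Real.exp (-p.ρ * (t : ℝ)) * p.y)
    (by fun_prop)).add (((IsAdmissible.finsetSum _ hu).cadlagAdapted_volt p.ρ).const_mul _)

lemma inventory_congr (p : Params N) (i : Fin N) {v w : Time T → Ω → ℝ} {ω : Ω}
    (h : ∀ᵐ s, v s ω = w s ω) (t : Time T) : inventory p i v t ω = inventory p i w t ω := by
  rw [inventory_eq, inventory_eq, volt_congr h]

lemma distortion_congr (p : Params N) {u w : Fin N → Time T → Ω → ℝ} {ω : Ω}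
    (h : ∀ j, ∀ᵐ s, u j s ω = w j s ω) (t : Time T) : distortion p u t ω = distortion p w t ω := by
  rw [distortion_eq, distortion_eq, volt_congr]
  filter_upwards [ae_all_iff.2 h] with s hs
  simp only [hs]

/-- The linear backward equation `dZ = (r Z + c v) dt + dK`, `Z_T = 0` has a solution. -/
lemma exists_linear_backward [𝓕.IsRightContinuous] (h𝓕 : IsCompleteFiltration 𝓕 μ)
    {v : Time T → Ω → ℝ} (hv : IsAdmissible 𝓕 μ v) (r c : ℝ) :
    ∃ Z K : Time T → Ω → ℝ, IsCadlagAdapted 𝓕 μ Z ∧ SqInt μ Z ∧ IsSqIntMartingale 𝓕 μ K ∧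
      (∀ᵐ ω ∂μ, ∀ t, Z t ω = (∫ s in Set.Iic t, (r * Z s ω + c * v s ω)) + K t ω) ∧
      ∀ᵐ ω ∂μ, Z ⊤ ω = 0 := by
  have hev : SqInt μ fun t ω => Real.exp (-r * (t : ℝ)) * v t ω :=
    hv.sqInt.continuous_mul (g := fun t : Time T => Real.exp (-r * (t : ℝ))) (by fun_prop)
  have eV : ∀ (t : Time T) ω, volt (-r) (fun s => v s ω) t
      = Real.exp (r * t) * volt 0 (fun s => Real.exp (-r * s) * v s ω) t := fun t ω => by
    rw [volt_eq, volt_zero, neg_neg]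
  have hξm : StronglyMeasurable[𝓕 ⊤] fun ω => ∫ s : Time T, Real.exp (-r * s) * v s ω := by
    have h1 := (progressive_volt
      (hv.continuous_mul (g := fun t : Time T => Real.exp (-r * t)) (by fun_prop)).1
        0).stronglyAdapted ⊤
    simpa only [volt_zero, Set.Iic_top, setIntegral_univ] using h1
  obtain ⟨m, hm, hmT⟩ := exists_cadlag_martingale_closing h𝓕 hev.memLp_integral hξm
  have hexp : Continuous fun t : Time T => Real.exp (r * t) := by fun_prop
  -- Here `m_t` is the conditional expectation of `∫₀ᵀ e^{-rs} v ds`, so `Z_t` is `-c` times that of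
  -- `∫ₜᵀ e^{-r(s-t)} v ds`. The martingale part is `-c ∫ e^{rs} dm`.
  refine ⟨fun t ω => -c * (Real.exp (r * t) * m t ω - volt (-r) (fun s => v s ω) t),
    fun t ω => -c * expTransform r m t ω, ?_, ?_, (hm.expTransform h𝓕 r).const_mul _, ?_, ?_⟩
  · exact ((hm.cadlagAdapted.continuous_mul hexp).sub (hv.cadlagAdapted_volt (-r))).const_mul (-c)
  · have h1 : SqInt μ fun t ω => Real.exp (r * (t : ℝ)) * m t ω :=
      (hm.sqInt h𝓕).continuous_mul hexp
    have h2 : SqInt μ fun t ω => volt (-r) (fun s => v s ω) t := by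
      simp only [eV]
      exact (hev.volt le_rfl).continuous_mul hexp
    exact MemLp.const_mul (MemLp.sub h1 h2) (-c)
  · filter_upwards [hv.sqInt.ae_integrable, hm.cadlag] with ω h1 h2 t
    have i1 : Integrable fun s : Time T => r * Real.exp (r * s) * m s ω :=
      integrable_continuous_mul h2.integrable (by fun_prop)
    have i2 : Integrable fun s => v s ω - -r * volt (-r) (fun s => v s ω) s :=
      h1.sub ((integrable_of_continuous (continuous_volt h1 (-r))).const_mul _)
    have e : ∀ s : Time T, r * (-c * (Real.exp (r * s) * m s ω - volt (-r) (fun s => v s ω) s))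
        + c * v s ω = -c * (r * Real.exp (r * s) * m s ω
          - (v s ω - -r * volt (-r) (fun s => v s ω) s)) := fun s => by ring
    simp only [e]
    rw [integral_const_mul, integral_sub i1.integrableOn i2.integrableOn,
      ← volt_eq_primitive h1, expTransform]
    ring
  · filter_upwards [hmT] with ω h1
    rw [h1, eV, volt_zero, Set.Iic_top, setIntegral_univ]
    ring

/-- The candidate obtained from the first order conditions by projecting onto the present. -/
lemma exists_projected_candidate [𝓕.IsRightContinuous] (h𝓕 : IsCompleteFiltration 𝓕 μ)
    (p : Params N) {P : Time T → Ω → ℝ} (hP : IsSqIntPrice 𝓕 μ P) {u : Fin N → Time T → Ω → ℝ}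
    (hu : ∀ i, IsAdmissible 𝓕 μ (u i)) (i : Fin N) :
    ∃ v Z K R : Time T → Ω → ℝ, IsAdmissible 𝓕 μ v ∧ IsCadlagAdapted 𝓕 μ v ∧
      IsCadlagAdapted 𝓕 μ Z ∧ IsSqIntMartingale 𝓕 μ K ∧ IsSqIntMartingale 𝓕 μ R ∧
      (∀ᵐ ω ∂μ, ∀ t, Z t ω = (∫ s in Set.Iic t, (p.ρ * Z s ω + p.imp * u i s ω)) + K t ω) ∧
      (∀ᵐ ω ∂μ, Z ⊤ ω = 0) ∧
      (∀ᵐ ω ∂μ, R ⊤ ω = 2 * p.varrho * inventory p i (u i) ⊤ ω - P ⊤ ω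
        + 2 * p.φ * ∫ s, inventory p i (u i) s ω) ∧
      ∀ᵐ ω ∂μ, ∀ t, 2 * p.lam * v t ω = P t ω - p.κ * distortion p u t ω + Z t ω
        - 2 * p.φ * volt 0 (fun s => inventory p i (u i) s ω) t + R t ω := by
  have hlam := p.lam_pos
  have hS := fun i => (hu i).sqInt
  obtain ⟨Z, K, hZc, hZs, hK, hZeq, hZT⟩ := exists_linear_backward h𝓕 (hu i) p.ρ p.imp
  have hX := (hu i).inventory p i
  -- In the projected condition the future integral of the inventory is its total integral minus its
  -- past one. The total joins the terminal terms in one variable, closed by the martingale `R`.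
  have hη : MemLp (fun ω => 2 * p.varrho * inventory p i (u i) ⊤ ω - P ⊤ ω
      + 2 * p.φ * ∫ s, inventory p i (u i) s ω) 2 μ :=
    ((((hS i).memLp_inventory_top p i).const_mul _).sub hP.memLp_top).add
      (hX.sqInt.memLp_integral.const_mul _)
  have hηm : StronglyMeasurable[𝓕 ⊤] fun ω => 2 * p.varrho * inventory p i (u i) ⊤ ω - P ⊤ ω
      + 2 * p.φ * ∫ s, inventory p i (u i) s ω := by
    have h1 := (progressive_volt hX.1 0).stronglyAdapted ⊤
    simp only [volt_zero, Set.Iic_top, setIntegral_univ] at h1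
    exact (((hX.1.stronglyAdapted ⊤).const_mul _).sub (hP.cadlagAdapted.adapted ⊤)).add
      (h1.const_mul _)
  obtain ⟨R, hR, hRT⟩ := exists_cadlag_martingale_closing h𝓕 hη hηm
  have hIc : IsCadlagAdapted 𝓕 μ fun t ω =>
      2 * p.φ * volt 0 (fun s => inventory p i (u i) s ω) t := (hX.cadlagAdapted_volt 0).const_mul _
  have hIs : SqInt μ fun t ω => 2 * p.φ * volt 0 (fun s => inventory p i (u i) s ω) t :=
    MemLp.const_mul (hX.sqInt.volt le_rfl) _
  have hDc : IsCadlagAdapted 𝓕 μ fun t ω => p.κ * distortion p u t ω :=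
    (cadlagAdapted_distortion hu p).const_mul p.κ
  have hDs : SqInt μ fun t ω => p.κ * distortion p u t ω :=
    MemLp.const_mul (sqInt_distortion p hS) _
  have hc : IsCadlagAdapted 𝓕 μ fun t ω => 1 / (2 * p.lam) * (P t ω - p.κ * distortion p u t ω
      + Z t ω - 2 * p.φ * volt 0 (fun s => inventory p i (u i) s ω) t + R t ω) :=
    ((((hP.cadlagAdapted.sub hDc).add hZc).sub hIc).add hR.cadlagAdapted).const_mul _
  have h1 : SqInt μ fun t ω => P t ω - p.κ * distortion p u t ω := MemLp.sub hP.sqInt hDs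
  have h2 : SqInt μ fun t ω => P t ω - p.κ * distortion p u t ω + Z t ω := MemLp.add h1 hZs
  have h3 : SqInt μ fun t ω => P t ω - p.κ * distortion p u t ω + Z t ω
      - 2 * p.φ * volt 0 (fun s => inventory p i (u i) s ω) t := MemLp.sub h2 hIs
  have h4 : SqInt μ fun t ω => P t ω - p.κ * distortion p u t ω + Z t ω
      - 2 * p.φ * volt 0 (fun s => inventory p i (u i) s ω) t + R t ω := MemLp.add h3 (hR.sqInt h𝓕)
  obtain ⟨v, hv, hvc, hveq⟩ := hc.exists_admissible h𝓕 (MemLp.const_mul h4 (1 / (2 * p.lam)))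
  refine ⟨v, Z, K, R, hv, hvc, hZc, hK, hR, hZeq, hZT, hRT, ?_⟩
  filter_upwards [hveq] with ω hω t
  rw [← hω t]
  field_simp

/-- Strategies satisfying the first order conditions solve the forward backward system. -/
theorem IsCritical.exists_solution [𝓕.IsRightContinuous] (h𝓕 : IsCompleteFiltration 𝓕 μ)
    {p : Params N} {P : Time T → Ω → ℝ} (hP : IsSqIntPrice 𝓕 μ P) {u : Fin N → Time T → Ω → ℝ}
    (hu : ∀ i, IsAdmissible 𝓕 μ (u i)) (hc : IsCritical p 𝓕 μ P u) :
    ∃ u' Z M K : Fin N → Time T → Ω → ℝ, (∀ i, SameStrategy μ (u' i) (u i)) ∧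
      IsFBSDESolution p 𝓕 μ P (fun i => inventory p i (u' i)) (distortion p u') u' Z M K := by
  have hlam := p.lam_pos
  have hS := fun i => (hu i).sqInt
  choose u' Z K R hu' hu'c hZc hK hR hZeq hZT hRT hu'eq using
    fun i => exists_projected_candidate h𝓕 p hP hu i
  have hX := fun i => (hu i).inventory p i
  -- By construction `u` and its projected candidate differ by `grad` up to future martingale
  -- increments.
  have hgrad : ∀ i, SameStrategy μ (fun t ω => 2 * p.lam * (u i t ω - u' i t ω))
      fun t ω => grad p P u i t ω - (Real.exp (p.ρ * (t : ℝ))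
        * (expTransform (-p.ρ) (K i) t ω - expTransform (-p.ρ) (K i) ⊤ ω)
        + 1 * (R i t ω - R i ⊤ ω)) := fun i => by
    refine ae_prod_of_ae_forall (p := fun t ω => 2 * p.lam * (u i t ω - u' i t ω)
      = grad p P u i t ω - (Real.exp (p.ρ * (t : ℝ))
        * (expTransform (-p.ρ) (K i) t ω - expTransform (-p.ρ) (K i) ⊤ ω)
        + 1 * (R i t ω - R i ⊤ ω))) ?_
    filter_upwards [hZeq i, hZT i, hRT i, hu'eq i, (hZc i).cadlag, (hK i).cadlag,
      (hS i).ae_integrable, (hX i).sqInt.ae_integrable] with ω h1 h2 h3 h4 h5 h6 h7 h8 t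
    have e1 := add_voltAdj_eq_of_backward h5.integrable h6.integrable h7
      (eq_increment_of_primitive (c := 0) (by simpa using h1)) h2 t
    have e2 := h4 t
    rw [volt_zero] at e2
    simp only [expTransform]
    rw [← e1, h3, grad, voltAdj_zero, setIntegral_Ici_eq h8]
    linear_combination -e2
  -- Tested against the admissible process `u - u'`, `grad` vanishes by criticality and the
  -- increments by the martingale property.
  have hsame : ∀ i, SameStrategy μ (u' i) (u i) := fun i => by
    have hw := (hu i).sub (hu' i)
    have hm := (hK i).expTransform h𝓕 (-p.ρ)
    have hE : Continuous fun t : Time T => Real.exp (p.ρ * t) := by fun_prop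
    have hsq : ∀ {L : Time T → Ω → ℝ} {g : Time T → ℝ}, IsSqIntMartingale 𝓕 μ L → Continuous g →
        SqInt μ fun t ω => g t * (L t ω - L ⊤ ω) := fun hL hg =>
      SqInt.continuous_mul hg (MemLp.sub (hL.sqInt h𝓕) (SqInt.of_const (hL.sqIntegrable ⊤)))
    have t1 : pairing μ (fun t ω => u i t ω - u' i t ω) (fun t ω => Real.exp (p.ρ * t)
        * (expTransform (-p.ρ) (K i) t ω - expTransform (-p.ρ) (K i) ⊤ ω)) = 0 :=
      hm.integral_test_eq_zero h𝓕 hw hE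
    have t2 : pairing μ (fun t ω => u i t ω - u' i t ω) (fun t ω => 1 * (R i t ω - R i ⊤ ω)) = 0 :=
      (hR i).integral_test_eq_zero h𝓕 hw (continuous_const (y := (1 : ℝ)))
    have s1 := hsq hm hE
    have s2 := hsq (hR i) (continuous_const (y := (1 : ℝ)))
    have s3 : SqInt μ fun t ω => Real.exp (p.ρ * (t : ℝ))
        * (expTransform (-p.ρ) (K i) t ω - expTransform (-p.ρ) (K i) ⊤ ω)
        + 1 * (R i t ω - R i ⊤ ω) := MemLp.add s1 s2
    have h0 := pairing_congr (w := fun t ω => u i t ω - u' i t ω) (hgrad i)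
    rw [pairing_sub hw.sqInt (sqInt_grad p hP hS i) s3, hc i _ hw, pairing_add hw.sqInt s1 s2, t1,
      t2, pairing_const_mul (f := fun t ω => u i t ω - u' i t ω)] at h0
    have h1 := sameStrategy_zero_of_pairing_self hw.sqInt (by
      have : pairing μ (fun t ω => u i t ω - u' i t ω) (fun t ω => u i t ω - u' i t ω) = 0 := by
        have h2 : 2 * p.lam ≠ 0 := by positivity
        simpa [h2] using h0
      exact this.le)
    filter_upwards [h1] with z hz using (sub_eq_zero.1 hz).symm
  have hae : ∀ᵐ ω ∂μ, ∀ j, ∀ᵐ s, u' j s ω = u j s ω :=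
    ae_all_iff.2 fun j => ae_ae_swap (p := fun s ω => u' j s ω = u j s ω) (hsame j)
  have hint : ∀ᵐ ω ∂μ, ∀ j, Integrable fun s => u' j s ω :=
    SqInt.ae_all_integrable fun j => (hu' j).sqInt
  -- The candidate was defined through `u`; time integrals ignore null sets, so `u'` may now be
  -- substituted throughout.
  have hZeq' : ∀ i, ∀ᵐ ω ∂μ, ∀ t, Z i t ω
      = (∫ s in Set.Iic t, (p.ρ * Z i s ω + p.imp * u' i s ω)) + K i t ω := fun i => by
    filter_upwards [hZeq i, hae] with ω h1 h2 t
    rw [h1 t]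
    congr 1
    refine integral_congr_ae (ae_restrict_of_ae ?_)
    filter_upwards [h2 i] with s hs
    rw [hs]
  have hu2 : ∀ i, ∀ᵐ ω ∂μ, ∀ t, u' i t ω = 1 / (2 * p.lam) * (P t ω - p.κ * distortion p u' t ω
      + Z i t ω - 2 * p.φ * (∫ s in Set.Iic t, inventory p i (u' i) s ω) + R i t ω) := fun i => by
    filter_upwards [hu'eq i, hae] with ω h1 h2 t
    have h3 := h1 t
    simp only [volt_zero, ← inventory_congr p i (h2 i), ← distortion_congr p h2] at h3
    rw [← h3]
    field_simp
  have hRT2 : ∀ i, ∀ᵐ ω ∂μ, R i ⊤ ω = 2 * p.varrho * inventory p i (u' i) ⊤ ω - P ⊤ ω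
      + 2 * p.φ * ∫ s, inventory p i (u' i) s ω := fun i => by
    filter_upwards [hRT i, hae] with ω h1 h2
    simp only [h1, inventory_congr p i (h2 i)]
  -- The formula for `2λ u'` contains both `R` and `Z`, and `Z` has martingale part `K`; hence `M =
  -- (R + K) / (2λ)`.
  refine ⟨u', Z, fun i t ω => 1 / (2 * p.lam) * (R i t ω + K i t ω), K, hsame, hu',
    fun i => (hu' i).cadlagAdapted_inventory p i, cadlagAdapted_distortion hu' p, hu'c, hZc,
    fun i => ((hR i).add (hK i)).const_mul _, hK, fun i => ae_of_all _ fun ω t => rfl, ?_,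
    fun i => ?_, fun i => ?_, fun i => ?_, hZT⟩
  · filter_upwards [hint] with ω hω t
    exact distortion_eq_primitive p (integrable_finsetSum _ fun j _ => hω j) t
  · filter_upwards [hZeq' i, hu2 i, (hZc i).cadlag, hint] with ω h1 h2 h3 h5 t
    have iZ := h3.integrable
    have isum : Integrable fun s => ∑ j, u' j s ω := integrable_finsetSum _ fun j _ => h5 j
    have iY : Integrable fun s => distortion p u' s ω :=
      integrable_of_continuous (continuous_distortion p isum)
    have iX : Integrable fun s => inventory p i (u' i) s ω := by
      simp only [inventory_eq]
      exact (integrable_const _).sub (integrable_of_continuous (continuous_volt (h5 i) 0))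
    have i1 : Integrable fun s => -p.ρ * distortion p u' s ω + p.γ / (N : ℝ) * ∑ j, u' j s ω :=
      (iY.const_mul _).add (isum.const_mul _)
    have i2 : Integrable fun s => p.ρ * Z i s ω + p.imp * u' i s ω :=
      (iZ.const_mul _).add ((h5 i).const_mul _)
    have i3 : Integrable fun s => (p.ρ * Z i s ω + p.imp * u' i s ω)
          - p.κ * (-p.ρ * distortion p u' s ω + p.γ / (N : ℝ) * ∑ j, u' j s ω) :=
      i2.sub (i1.const_mul _)
    have e : ∀ s, p.κ * p.ρ * distortion p u' s ω / (2 * p.lam)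
          - p.γ * p.κ / (2 * p.lam * (N : ℝ)) * ∑ j ∈ Finset.univ.erase i, u' j s ω
          - p.φ * inventory p i (u' i) s ω / p.lam + p.ρ * Z i s ω / (2 * p.lam)
        = (1 / (2 * p.lam)) * ((p.ρ * Z i s ω + p.imp * u' i s ω)
          - p.κ * (-p.ρ * distortion p u' s ω + p.γ / (N : ℝ) * ∑ j, u' j s ω)
          - 2 * p.φ * inventory p i (u' i) s ω) := by
      intro s
      rw [← Finset.add_sum_erase _ (fun j => u' j s ω) (Finset.mem_univ i), Params.imp]
      have hN : (N : ℝ) ≠ 0 := by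
        have := i.pos
        positivity
      field_simp
      ring
    -- With `P` subtracted, `u'` is a primitive plus a martingale; the constant comes from the
    -- initial distortion `p.y`.
    have key := eq_increment_of_primitive (f := fun t => u' i t ω - P t ω / (2 * p.lam))
      (K := fun t => 1 / (2 * p.lam) * (R i t ω + K i t ω)) (c := -p.κ * p.y / (2 * p.lam))
      (h := fun s => p.κ * p.ρ * distortion p u' s ω / (2 * p.lam)
          - p.γ * p.κ / (2 * p.lam * (N : ℝ)) * ∑ j ∈ Finset.univ.erase i, u' j s ω
          - p.φ * inventory p i (u' i) s ω / p.lam + p.ρ * Z i s ω / (2 * p.lam)) (fun t => by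
        simp only [e]
        rw [integral_const_mul, integral_sub i3.integrableOn (iX.const_mul _).integrableOn,
          integral_sub i2.integrableOn (i1.const_mul _).integrableOn, integral_const_mul p.κ,
          integral_const_mul (2 * p.φ), h2 t]
        linear_combination (1 / (2 * p.lam)) * h1 t
          - (p.κ / (2 * p.lam)) * distortion_eq_primitive p isum t) t
    linear_combination key
  · filter_upwards [hu2 i, hRT2 i, hZT i] with ω h1 h2 h3
    rw [h1 ⊤, h2, h3, Set.Iic_top, setIntegral_univ]
    field_simp
    ring
  · filter_upwards [hZeq' i] with ω h1 t
    exact eq_increment_of_primitive (f := fun t => Z i t ω) (K := fun t => K i t ω)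
      (h := fun s => p.ρ * Z i s ω + p.γ * p.κ / (N : ℝ) * u' i s ω) (c := 0)
      (fun t => (h1 t).trans (by rw [zero_add, Params.imp])) t

end Existence

/-! ### Uniqueness up to indistinguishability. -/

section Uniqueness

variable {T : ℝ} [hT : Fact (0 < T)] {Ω : Type*} [mΩ : MeasurableSpace Ω]
  {μ : Measure Ω} [IsProbabilityMeasure μ] {𝓕 : Filtration (Time T) mΩ} {N : ℕ}
  {p : Params N} {P : Time T → Ω → ℝ}

/-- Right continuity settles every time but the last, where equality has to be supplied by a
terminal condition. -/
lemma IsCadlag.eq_of_ae_eq {f g : Time T → ℝ} (hf : IsCadlag f) (hg : IsCadlag g)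
    (h : ∀ᵐ t, f t = g t) (hTop : f ⊤ = g ⊤) (t : Time T) : f t = g t := by
  rcases eq_or_ne t ⊤ with rfl | ht
  · exact hTop
  · exact eq_of_ae_eq_of_rightCont (fun t => (hf t).1) (fun t => (hg t).1) h (lt_top_iff_ne_top.2 ht)

/-- An adapted process of the form `g t * (M_t - M_T)` with a martingale `M` vanishes. -/
lemma IsCadlagAdapted.ae_eq_zero_of_eq_mul_sub_top (h𝓕 : IsCompleteFiltration 𝓕 μ)
    {D M : Time T → Ω → ℝ} (hD : IsCadlagAdapted 𝓕 μ D) (hM : IsSqIntMartingale 𝓕 μ M)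
    {g : Time T → ℝ} (hg : Continuous g) (h : ∀ᵐ ω ∂μ, ∀ t, D t ω = g t * (M t ω - M ⊤ ω)) :
    ∀ᵐ ω ∂μ, ∀ t, D t ω = 0 := by
  have hs : SqInt μ fun t ω => g t * (M t ω - M ⊤ ω) :=
    SqInt.continuous_mul hg (MemLp.sub (hM.sqInt h𝓕) (SqInt.of_const (hM.sqIntegrable ⊤)))
  have hsame : SameStrategy μ (fun t ω => g t * (M t ω - M ⊤ ω)) D :=
    ae_prod_of_ae_forall (p := fun t ω => g t * (M t ω - M ⊤ ω) = D t ω) (by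
      filter_upwards [h] with ω hω t using (hω t).symm)
  obtain ⟨D', hD', -, hDD⟩ := hD.exists_admissible h𝓕 (hs.congr hsame)
  have hsame' : SameStrategy μ D' fun t ω => g t * (M t ω - M ⊤ ω) :=
    ae_prod_of_ae_forall (p := fun t ω => D' t ω = g t * (M t ω - M ⊤ ω)) (by
      filter_upwards [h, hDD] with ω h1 h2 t
      rw [← h2, h1])
  -- Being adapted, the process is an admissible test against itself.
  have h0 : pairing μ D' D' = 0 := by
    rw [pairing_congr hsame']
    exact hM.integral_test_eq_zero h𝓕 hD' hg
  have hz := sameStrategy_zero_of_pairing_self hD'.sqInt h0.le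
  filter_upwards [ae_ae_swap (p := fun t ω => D' t ω = 0) hz, hDD, hD.cadlag, h] with ω h1 h2 h3 h4
  refine h3.eq_of_ae_eq (isCadlag_of_continuous continuous_const) ?_ (by simp [h4])
  filter_upwards [h1] with t ht
  rw [h2, ht]

namespace IsFBSDESolution

variable {X X' : Fin N → Time T → Ω → ℝ} {Y Y' : Time T → Ω → ℝ}
  {u u' Z Z' M M' K K' : Fin N → Time T → Ω → ℝ}

/-- Solutions of the forward backward system are unique up to indistinguishability. -/
theorem unique (h𝓕 : IsCompleteFiltration 𝓕 μ) (hP : IsSqIntPrice 𝓕 μ P)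
    (h : IsFBSDESolution p 𝓕 μ P X Y u Z M K) (h' : IsFBSDESolution p 𝓕 μ P X' Y' u' Z' M' K') :
    ∀ᵐ ω ∂μ, ∀ t, Y' t ω = Y t ω ∧ ∀ i,
      X' i t ω = X i t ω ∧ u' i t ω = u i t ω ∧ Z' i t ω = Z i t ω ∧
      M' i t ω - M' i ⊥ ω = M i t ω - M i ⊥ ω ∧ K' i t ω - K' i ⊥ ω = K i t ω - K i ⊥ ω := by
  have hsame := IsCritical.unique p hP h'.admissible_u h.admissible_u (h'.isCritical h𝓕)
    (h.isCritical h𝓕)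
  have hae : ∀ᵐ ω ∂μ, ∀ j, ∀ᵐ s, u' j s ω = u j s ω :=
    ae_all_iff.2 fun j => ae_ae_swap (p := fun s ω => u' j s ω = u j s ω) (hsame j)
  have hXY : ∀ᵐ ω ∂μ, (∀ t, Y' t ω = Y t ω) ∧ ∀ i t, X' i t ω = X i t ω := by
    filter_upwards [hae, h.ae_eq_distortion, h'.ae_eq_distortion, ae_all_iff.2 h.eq_X,
      ae_all_iff.2 h'.eq_X] with ω h1 h2 h3 h4 h5
    refine ⟨fun t => by rw [h2, h3, distortion_congr p h1], fun i t => ?_⟩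
    rw [h4, h5]
    exact inventory_congr p i (h1 i) t
  -- The forward processes depend only on the almost everywhere class of `u`, and they determine
  -- `u_T`.
  have huu : ∀ᵐ ω ∂μ, ∀ i t, u' i t ω = u i t ω := by
    filter_upwards [hae, hXY, ae_all_iff.2 fun i => (h.cadlag_u i).cadlag,
      ae_all_iff.2 fun i => (h'.cadlag_u i).cadlag, ae_all_iff.2 h.terminal_u,
      ae_all_iff.2 h'.terminal_u] with ω h1 h2 h3 h4 h5 h6 i
    exact (h4 i).eq_of_ae_eq (h3 i) (h1 i) (by rw [h5, h6, h2.1, h2.2])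
  -- The terms in `u` cancel, so the adapted difference `Z' - Z` equals `e^{ρt}` times a future
  -- martingale increment and must vanish.
  have hZZ : ∀ i, ∀ᵐ ω ∂μ, ∀ t, Z' i t ω = Z i t ω := fun i => by
    have hm := ((h'.martingale_K i).expTransform h𝓕 (-p.ρ)).sub
      ((h.martingale_K i).expTransform h𝓕 (-p.ρ))
    have hz := ((h'.cadlag_Z i).sub (h.cadlag_Z i)).ae_eq_zero_of_eq_mul_sub_top h𝓕 hm
      (g := fun t : Time T => Real.exp (p.ρ * t)) (by fun_prop) (by
        filter_upwards [h.ae_add_voltAdj_eq i, h'.ae_add_voltAdj_eq i, hae] with ω h1 h2 h3 t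
        have e1 := h1 t
        have e2 := h2 t
        rw [voltAdj_congr (h3 i)] at e2
        linear_combination e2 - e1)
    filter_upwards [hz] with ω hω t using sub_eq_zero.1 (hω t)
  filter_upwards [hXY, huu, ae_all_iff.2 hZZ, ae_all_iff.2 h.eq_Z, ae_all_iff.2 h'.eq_Z,
    ae_all_iff.2 h.eq_u, ae_all_iff.2 h'.eq_u] with ω h1 h2 h3 h4 h5 h6 h7 t
  refine ⟨h1.1 t, fun i => ⟨h1.2 i t, h2 i t, h3 i t, ?_, ?_⟩⟩
  · have e := h7 i t
    simp only [h1.1, h1.2, h2, h3] at e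
    linear_combination h6 i t - e
  · have e := h5 i t
    simp only [h2, h3] at e
    linear_combination h4 i t - e

end IsFBSDESolution

lemma IsCritical.congr {u u' : Fin N → Time T → Ω → ℝ} (hc : IsCritical p 𝓕 μ P u')
    (h : ∀ i, SameStrategy μ (u' i) (u i)) : IsCritical p 𝓕 μ P u := by
  intro i w hw
  rw [← hc i w hw]
  refine pairing_congr ?_
  have hae : ∀ᵐ ω ∂μ, ∀ t, distortion p u t ω = distortion p u' t ω
      ∧ voltAdj p.ρ (fun s => u i s ω) t = voltAdj p.ρ (fun s => u' i s ω) t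
      ∧ ∀ s, inventory p i (u i) s ω = inventory p i (u' i) s ω := by
    filter_upwards [ae_all_iff.2 fun j => ae_ae_swap (p := fun s ω => u' j s ω = u j s ω) (h j)]
      with ω hω t
    exact ⟨(distortion_congr p hω t).symm, (voltAdj_congr (hω i) _ t).symm,
      fun s => (inventory_congr p i (hω i) s).symm⟩
  filter_upwards [h i, ae_prod_of_ae_forall (p := fun t ω => distortion p u t ω = distortion p u' t ω
      ∧ voltAdj p.ρ (fun s => u i s ω) t = voltAdj p.ρ (fun s => u' i s ω) t
      ∧ ∀ s, inventory p i (u i) s ω = inventory p i (u' i) s ω) hae] with z h1 h2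
  simp only [grad, h1, h2]

end Uniqueness

end PriceImpactGame

open PriceImpactGame in
theorem lemma2p2 {T : ℝ} [Fact (0 < T)] {Ω : Type*} [mΩ : MeasurableSpace Ω]
    (μ : Measure Ω) [IsProbabilityMeasure μ]
    (𝓕 : Filtration (Time T) mΩ) [𝓕.IsRightContinuous] (h_compl : IsCompleteFiltration 𝓕 μ)
    (P : Time T → Ω → ℝ) (hP : IsH2 𝓕 μ P)
    {N : ℕ} (hN : 1 ≤ N) (p : Params N) :
    (∀ u : Fin N → Time T → Ω → ℝ, (∀ i, IsAdmissible 𝓕 μ (u i)) →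
      (IsUniqueNash p 𝓕 μ P u ↔
        ∃ u' Z M K : Fin N → Time T → Ω → ℝ,
          (∀ i, SameStrategy μ (u' i) (u i)) ∧
          IsFBSDESolution p 𝓕 μ P (fun i => inventory p i (u' i)) (distortion p u') u' Z M K)) ∧
    (∃ (X : Fin N → Time T → Ω → ℝ) (Y : Time T → Ω → ℝ) (u Z M K : Fin N → Time T → Ω → ℝ),
      IsFBSDESolution p 𝓕 μ P X Y u Z M K ∧
      ∀ (X' : Fin N → Time T → Ω → ℝ) (Y' : Time T → Ω → ℝ) (u' Z' M' K' : Fin N → Time T → Ω → ℝ),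
        IsFBSDESolution p 𝓕 μ P X' Y' u' Z' M' K' →
        ∀ᵐ ω ∂μ, ∀ t, Y' t ω = Y t ω ∧ ∀ i,
          X' i t ω = X i t ω ∧ u' i t ω = u i t ω ∧ Z' i t ω = Z i t ω ∧
          M' i t ω - M' i ⊥ ω = M i t ω - M i ⊥ ω ∧
          K' i t ω - K' i ⊥ ω = K i t ω - K i ⊥ ω) := by
  have hQ := hP.isSqIntPrice h_compl
  refine ⟨fun u hu => ⟨fun h => ?_, ?_⟩, ?_⟩
  · exact ((isNash_iff_isCritical p hQ hu).1 h.1).exists_solution h_compl hQ hu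
  · rintro ⟨u', Z, M, K, hsame, hsol⟩
    have hc := (hsol.isCritical h_compl).congr hsame
    refine ⟨(isNash_iff_isCritical p hQ hu).2 hc, fun w hw i => ?_⟩
    -- All equilibria are critical and critical profiles coincide, so any equilibrium is
    -- automatically the only one.
    exact IsCritical.unique p hQ hw.1 hu ((isNash_iff_isCritical p hQ hw.1).1 hw) hc i
  · obtain ⟨u, hu, hc⟩ := exists_isCritical p hQ (𝓕 := 𝓕)
    obtain ⟨u', Z, M, K, -, hsol⟩ := hc.exists_solution h_compl hQ hu
    exact ⟨_, _, u', Z, M, K, hsol, fun X' Y' v' Z' M' K' h' => hsol.unique h_compl hQ h'⟩
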